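/- Let $N\ge 1$ be an integer, $s>-1$, $1\le p<\infty$ and $\rho>0$ (fixed once and for all). All functions and distributions are real-valued on $\mathbb{R}^N$, and $B_\rho$ is the open ball with center $0$ and radius $\rho$. For $t\in\mathbb{R}$ and $1\le q\le\infty$ let $L^q_t:=\{v\in L^q_{loc}:(1+|x|)^{-t-N/q}v\in L^q(\mathbb{R}^N)\}$, with norm $\|v\|_{L^q_t}:=\|(1+|x|)^{-t-N/q}v\|_{L^q}$ (where $N/\infty:=0$). Let $p^*:=Np/(N-p)$ if $p<N$ and $p^*:=\infty$ otherwise, and let $I_{1,p}:=[p,p^*]$ if $p\ne N$ or $p=N=1$, and $I_{1,p}:=[p,\infty)$ if $p=N>1$. Let $u\in\mathcal{D}'(\mathbb{R}^N)$ be a distribution whose distributional gradient satisfies $\nabla u\in(L^p_s)^N$. Then $u$ is a locally integrable function and, with $c_u:=|B_\rho|^{-1}\int_{B_\rho}u$, the following hold. (i) $u\in L^p_{s+1}$, and there is a constant $C>0$ independent of $u$ (depending only on $N,\rho,s,p$) such that $$\|u-c_u\|_{L^p_{s+1}}\le C\,\|\,|\nabla u|\,\|_{L^p_s}.$$ (ii)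 If $N=1$ or if $u$ is radially symmetric, then for every $q\in I_{1,p}$ one has $u\in L^q_{s+1}$, and there is a constant $C>0$ independent of $u$ (depending only on $N,\rho,s,p,q$) such that $$\|u-c_u\|_{L^q_{s+1}}\le C\,\|\,|\nabla u|\,\|_{L^p_s}.$$ Furthermore, if in this case $p>N$ or $p=N=1$ (so that $\infty\in I_{1,p}$), then $u$ has a continuous representative, and for this representative $\lim_{|x|\to\infty}|x|^{-(s+1)}u(x)=0$. -/

import Mathlib

open MeasureTheory TopologicalSpace Filter Topology
open scoped ENNReal Distributions LineDeriv

namespace Growth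

/-- The Euclidean space `ℝ^N`. -/
abbrev Eu (N : ℕ) := EuclideanSpace ℝ (Fin N)

/-- The space `𝓓'` of real distributions on `ℝ^N`. -/
abbrev Distr (N : ℕ) := 𝓓'((⊤ : Opens (Eu N)), ℝ)

/-- The distribution `T` is (given by) the locally integrable function `f`. -/
def IsGivenBy {N : ℕ} (T : Distr N) (f : Eu N → ℝ) : Prop :=
  LocallyIntegrable f volume ∧
    ∀ φ : 𝓓((⊤ : Opens (Eu N)), ℝ), T φ = ∫ x, f x * φ x

/-- The function `x ↦ (1 + |x|)^(-s - N/q) u(x)`. When `q = ∞` one has `q.toReal = 0`, and the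
division by zero convention gives `N/q = 0`, as it should be. -/
noncomputable def weighted {N : ℕ} (q : ℝ≥0∞) (s : ℝ) (u : Eu N → ℝ) : Eu N → ℝ :=
  fun x => (1 + ‖x‖) ^ (-s - (N : ℝ) / q.toReal) * u x

/-- The norm `‖u‖_{L^q_s} = ‖(1 + |x|)^(-s - N/q) u‖_q`, as an extended nonnegative number. -/
noncomputable def wnorm {N : ℕ} (q : ℝ≥0∞) (s : ℝ) (u : Eu N → ℝ) : ℝ≥0∞ :=
  eLpNorm (weighted q s u) q volume

/-- Membership in `L^q_s = {u ∈ L^q_loc : (1 + |x|)^(-s - N/q) u ∈ L^q}`. -/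
def MemWeighted {N : ℕ} (q : ℝ≥0∞) (s : ℝ) (u : Eu N → ℝ) : Prop :=
  (∀ K : Set (Eu N), IsCompact K → MemLp u q (volume.restrict K)) ∧
    MemLp (weighted q s u) q volume

/-- The distributional gradient of `u` is (given by) the vector field `g`, and it belongs to
`(L^p_s)^N`. -/
def HasGradientIn {N : ℕ} (p : ℝ≥0∞) (s : ℝ) (u : Distr N) (g : Eu N → Eu N) : Prop :=
  ∀ i : Fin N, IsGivenBy (∂_{EuclideanSpace.single i (1 : ℝ)} u) (fun x => g x i) ∧
    MemWeighted p s (fun x => g x i)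

/-- The mean value of `f` on the open ball `B_ρ` with center `0` and radius `ρ`. -/
noncomputable def ballMean {N : ℕ} (ρ : ℝ) (f : Eu N → ℝ) : ℝ :=
  (volume.real (Metric.ball (0 : Eu N) ρ))⁻¹ * ∫ x in Metric.ball (0 : Eu N) ρ, f x

/-- `f` is radially symmetric: up to a null set, it depends only on `|x|`. -/
def IsRadial {N : ℕ} (f : Eu N → ℝ) : Prop :=
  ∃ F : ℝ → ℝ, f =ᵐ[volume] fun x => F ‖x‖

/-- The Sobolev exponent: `p* = Np/(N - p)` if `p < N`, and `p* = ∞` otherwise. -/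
noncomputable def sobolevExponent (N : ℕ) (p : ℝ) : ℝ≥0∞ :=
  if p < N then ENNReal.ofReal (N * p / (N - p)) else ∞

/-- The interval of exponents: `[p, p*]` if `p ≠ N` or `p = N = 1`, and `[p, ∞)` if `p = N > 1`. -/
noncomputable def exponentRange (N : ℕ) (p : ℝ) : Set ℝ≥0∞ :=
  if p = N ∧ 1 < N then Set.Ico (ENNReal.ofReal p) ∞
  else Set.Icc (ENNReal.ofReal p) (sobolevExponent N p)

end Growth

/-! Let η be a test function with integral 1. Integrating ∇u along the segment from x to x + y gives
u(x + y) - u(x) = ∫₀¹ y·∇u(x + ty) dt. Averaging in y against η produces `segPart`, formally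
(η-average of u around x) - u(x). Averaging in x produces `conePart`, formally (η-average of u
around y) - u(η). Subtracting, u = u(η) + `conePart` - `segPart`. For a distribution this is proved
by duality: an explicit test vector field has divergence (∫η)φ - η∗φ (`apply_mul_integral`), and
eliminating u(η∗φ) between the two versions with η and φ exchanged leaves only integrals of ∇u
(`isGivenBy_of_gradient`). So u is a function.

For the L^p bound, `segPart` averages ∇u over bounded translations, which is harmless in weighted
spaces. `conePart` is dominated by |y| ∫₀¹ V(ry) dr with V a local average of |∇u|. The part of V
outside the unit ball is handled by a Hardy inequality, obtained from Jensen for r^s dr and scaling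
(`lintegral_ray_average_le`); here s > -1 is essential. The part inside contributes a bounded
function, and bounded functions have finite norm because s + 1 > 0. The constant u(η) is finally
exchanged for the mean over the ball.

Below or at the critical exponent, higher integrability comes from the Gagliardo-Nirenberg-Sobolev
inequality on smoothly cut dyadic shells. It is scale invariant with these weights, so its constants
do not depend on the shell, and the pieces are summed using ℓ¹ ⊂ ℓ^(r/p)
(`exists_wInt_le_of_contDiff`). Mollification and Fatou extend it to weak gradients.

If p > N or p = N = 1, u is its mollification at radius R minus a `segPart`, and the latter is at
most C R^(1 - N/p) ‖∇u‖_{L^p(B(x,R))}. Small R gives continuity. Taking R comparable to 1 + |y|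
bounds (1 + |y|)^(-(s+1)) |u(y) - c| by an integral over an exterior region
(`exists_wt_mul_enorm_sub_le`), which yields both the sup bound and the decay at infinity.
Intermediate exponents follow by interpolation. -/

namespace Growth

/-! ### Superpositions of translates and the adjoint averages -/

/-- The superposition `∫ k(θ) φ(x - τ(θ)) dν(θ)` of translates of `φ`. -/
noncomputable def smear {N : ℕ} {Θ F : Type} [MeasurableSpace Θ] [NormedAddCommGroup F]
    [NormedSpace ℝ F] (ν : Measure Θ) (k : Θ → ℝ) (τ : Θ → Eu N) (φ : Eu N → F) (x : Eu N) : F :=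
  ∫ θ, k θ • φ (x - τ θ) ∂ν

section Smear

variable {N : ℕ} {Θ F : Type} [MeasurableSpace Θ] [NormedAddCommGroup F] [NormedSpace ℝ F]
  {ν : Measure Θ} {k : Θ → ℝ} {τ : Θ → Eu N} {φ : Eu N → F}

theorem aestronglyMeasurable_smear_integrand (hk : Integrable k ν) (hτ : AEMeasurable τ ν)
    (hφ : Continuous φ) (x : Eu N) :
    AEStronglyMeasurable (fun θ => k θ • φ (x - τ θ)) ν :=
  hk.aestronglyMeasurable.smul
    (hφ.comp_aestronglyMeasurable (aestronglyMeasurable_const.sub hτ.aestronglyMeasurable))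

theorem integrable_smear_integrand (hk : Integrable k ν) (hτ : AEMeasurable τ ν)
    (hφ : Continuous φ) (hc : HasCompactSupport φ) (x : Eu N) :
    Integrable (fun θ => k θ • φ (x - τ θ)) ν := by
  obtain ⟨C, hC⟩ := hc.exists_bound_of_continuous hφ
  refine (hk.norm.mul_const C).mono' (aestronglyMeasurable_smear_integrand hk hτ hφ x) ?_
  refine Eventually.of_forall fun θ => ?_
  rw [norm_smul]
  gcongr
  exact hC _

theorem hasFDerivAt_smear (hk : Integrable k ν) (hτ : AEMeasurable τ ν)
    (hφ : ContDiff ℝ 1 φ) (hc : HasCompactSupport φ) (x : Eu N) :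
    HasFDerivAt (smear ν k τ φ) (smear ν k τ (fderiv ℝ φ) x) x := by
  have hd : Continuous (fderiv ℝ φ) := hφ.continuous_fderiv one_ne_zero
  obtain ⟨C, hC⟩ := hc.fderiv (𝕜 := ℝ) |>.exists_bound_of_continuous hd
  refine hasFDerivAt_integral_of_dominated_of_fderiv_le (bound := fun θ => ‖k θ‖ * C)
    (F' := fun x θ => k θ • fderiv ℝ φ (x - τ θ)) univ_mem
    (Eventually.of_forall fun y => aestronglyMeasurable_smear_integrand hk hτ hφ.continuous y)
    (integrable_smear_integrand hk hτ hφ.continuous hc x)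
    (aestronglyMeasurable_smear_integrand hk hτ hd x) ?_ (hk.norm.mul_const C) ?_
  · refine Eventually.of_forall fun θ y _ => ?_
    rw [norm_smul]
    gcongr
    exact hC _
  · refine Eventually.of_forall fun θ y _ => ?_
    have h1 : HasFDerivAt φ (fderiv ℝ φ (y - τ θ)) (y - τ θ) :=
      (hφ.differentiable one_ne_zero _).hasFDerivAt
    have h2 : HasFDerivAt (fun y => y - τ θ) (ContinuousLinearMap.id ℝ (Eu N)) y :=
      (hasFDerivAt_id y).sub_const _
    exact (h1.comp y h2).const_smul (k θ)

/-- The derivative of a superposition is the superposition of the derivatives, which takes values in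
another space; the induction therefore quantifies over the target. One order of smoothness is lost,
which is harmless for smooth φ. -/
theorem contDiff_smear_nat (hk : Integrable k ν) (hτ : AEMeasurable τ ν) (n : ℕ) :
    ∀ {F : Type} [NormedAddCommGroup F] [NormedSpace ℝ F] {φ : Eu N → F},
      ContDiff ℝ (n + 1) φ → HasCompactSupport φ → ContDiff ℝ n (smear ν k τ φ) := by
  induction n with
  | zero =>
    intro F _ _ φ hφ hc
    have h1 : ContDiff ℝ 1 φ := by simpa using hφ
    rw [Nat.cast_zero, contDiff_zero]
    exact continuous_iff_continuousAt.2 fun x => (hasFDerivAt_smear hk hτ h1 hc x).continuousAt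
  | succ n ih =>
    intro F _ _ φ hφ hc
    have h1 : ContDiff ℝ 1 φ := hφ.of_le (by exact_mod_cast Nat.le_add_left 1 (n + 1))
    push_cast
    rw [contDiff_succ_iff_fderiv]
    refine ⟨fun x => (hasFDerivAt_smear hk hτ h1 hc x).differentiableAt, by simp, ?_⟩
    have : fderiv ℝ (smear ν k τ φ) = smear ν k τ (fderiv ℝ φ) :=
      funext fun x => (hasFDerivAt_smear hk hτ h1 hc x).fderiv
    rw [this]
    refine ih ?_ (hc.fderiv (𝕜 := ℝ))
    exact hφ.fderiv_right (m := ((n : WithTop ℕ∞) + 1)) (by push_cast; rfl)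

theorem contDiff_smear (hk : Integrable k ν) (hτ : AEMeasurable τ ν)
    (hφ : ContDiff ℝ (⊤ : ℕ∞) φ) (hc : HasCompactSupport φ) :
    ContDiff ℝ (⊤ : ℕ∞) (smear ν k τ φ) := by
  rw [contDiff_infty]
  intro n
  exact contDiff_smear_nat hk hτ n (hφ.of_le (by exact_mod_cast le_top)) hc

theorem hasCompactSupport_smear {R : ℝ} (hR : ∀ᵐ θ ∂ν, k θ ≠ 0 → ‖τ θ‖ ≤ R)
    (hc : HasCompactSupport φ) : HasCompactSupport (smear ν k τ φ) := by
  obtain ⟨S, hS⟩ := hc.isCompact.isBounded.subset_closedBall (0 : Eu N)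
  refine HasCompactSupport.intro (isCompact_closedBall (0 : Eu N) (R + S)) fun x hx => ?_
  refine integral_eq_zero_of_ae ?_
  filter_upwards [hR] with θ hθ
  by_cases h : k θ = 0
  · simp [h]
  · have : φ (x - τ θ) = 0 := by
      by_contra h0
      have h1 := hS (subset_tsupport φ h0)
      rw [mem_closedBall_zero_iff] at h1 hx
      have h2 := norm_sub_norm_le x (τ θ)
      have := hθ h
      linarith
    simp [this]

/-- The superposition of translates of a test function, as a test function. -/
noncomputable def smearTest {R : ℝ} (hk : Integrable k ν) (hτ : AEMeasurable τ ν)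
    (hR : ∀ᵐ θ ∂ν, k θ ≠ 0 → ‖τ θ‖ ≤ R) (φ : 𝓓((⊤ : Opens (Eu N)), ℝ)) :
    𝓓((⊤ : Opens (Eu N)), ℝ) where
  toFun := smear ν k τ φ
  contDiff' := contDiff_smear hk hτ φ.contDiff φ.hasCompactSupport
  hasCompactSupport' := hasCompactSupport_smear hR φ.hasCompactSupport
  tsupport_subset' := by simp

/-- Shearing a product by translations preserves the measure. -/
theorem measurePreserving_shear [SFinite ν] (hτ : Measurable τ) :
    MeasurePreserving (fun z : Θ × Eu N => (z.1, z.2 + τ z.1)) (ν.prod volume)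
      (ν.prod volume) := by
  refine (MeasurePreserving.id ν).skew_product (g := fun θ x => x + τ θ) ?_ ?_
  · exact (measurable_snd.add (hτ.comp measurable_fst))
  · exact Eventually.of_forall fun θ => (measurePreserving_add_right volume (τ θ)).map_eq

theorem measurableEmbedding_shear (hτ : Measurable τ) :
    MeasurableEmbedding (fun z : Θ × Eu N => (z.1, z.2 + τ z.1)) := by
  let e : (Θ × Eu N) ≃ᵐ (Θ × Eu N) :=
    { toFun := fun z => (z.1, z.2 + τ z.1)
      invFun := fun z => (z.1, z.2 - τ z.1)
      left_inv := fun z => by simp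
      right_inv := fun z => by simp
      measurable_toFun := by
        exact measurable_fst.prodMk (measurable_snd.add (hτ.comp measurable_fst))
      measurable_invFun := by
        exact measurable_fst.prodMk (measurable_snd.sub (hτ.comp measurable_fst)) }
  exact e.measurableEmbedding

variable {G ψ : Eu N → ℝ}

/-- Where the integrand is nonzero, x + τ(θ) stays in the ball of radius S + R, so G may be
truncated there. The shear then turns the majorant into a tensor product of integrable functions.
Every use of Fubini below rests on this. -/
theorem integrable_prod_translate [SFinite ν] {R S C : ℝ} (hk : Integrable k ν)
    (hτ : Measurable τ) (hR : ∀ᵐ θ ∂ν, k θ ≠ 0 → ‖τ θ‖ ≤ R) (hG : LocallyIntegrable G volume)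
    (hψ : AEStronglyMeasurable ψ volume) (hC : ∀ x, ‖ψ x‖ ≤ C) (hS : ∀ x, ψ x ≠ 0 → ‖x‖ ≤ S) :
    Integrable (fun z : Θ × Eu N => k z.1 * G (z.2 + τ z.1) * ψ z.2) (ν.prod volume) := by
  have hC0 : 0 ≤ C := (norm_nonneg _).trans (hC 0)
  have hme : AEStronglyMeasurable (fun z : Θ × Eu N => k z.1 * G (z.2 + τ z.1) * ψ z.2)
      (ν.prod volume) := by
    refine (hk.aestronglyMeasurable.comp_fst.mul ?_).mul hψ.comp_snd
    exact (hG.aestronglyMeasurable.comp_snd (μ := ν)).comp_measurePreserving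
      (measurePreserving_shear hτ)
  have hGi : IntegrableOn G (Metric.closedBall 0 (S + R)) :=
    hG.integrableOn_isCompact (isCompact_closedBall _ _)
  have hpt : ∀ θ x, (k θ ≠ 0 → ‖τ θ‖ ≤ R) → ‖k θ * G (x + τ θ) * ψ x‖ ≤
      (‖k θ‖ * C) * ‖(Metric.closedBall 0 (S + R)).indicator G (x + τ θ)‖ := by
    intro θ x hθ
    by_cases h1 : k θ = 0
    · simp [h1]
    by_cases h2 : ψ x = 0
    · simp only [h2, mul_zero, norm_zero]; positivity
    have : x + τ θ ∈ Metric.closedBall (0 : Eu N) (S + R) := by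
      rw [mem_closedBall_zero_iff]
      exact (norm_add_le _ _).trans (add_le_add (hS x h2) (hθ h1))
    rw [Set.indicator_of_mem this, norm_mul, norm_mul]
    nlinarith [hC x, mul_nonneg (norm_nonneg (k θ)) (norm_nonneg (G (x + τ θ))),
      mul_le_mul_of_nonneg_left (hC x)
        (mul_nonneg (norm_nonneg (k θ)) (norm_nonneg (G (x + τ θ))))]
  have hbi : Integrable (fun z : Θ × Eu N => (‖k z.1‖ * C) *
      ‖(Metric.closedBall 0 (S + R)).indicator G (z.2 + τ z.1)‖) (ν.prod volume) := by
    have h1 : Integrable (fun z : Θ × Eu N => (‖k z.1‖ * C) *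
        ‖(Metric.closedBall 0 (S + R)).indicator G z.2‖) (ν.prod volume) :=
      (hk.norm.mul_const C).mul_prod
        ((integrable_indicator_iff measurableSet_closedBall).2 hGi).norm
    exact ((measurePreserving_shear hτ).integrable_comp_emb (measurableEmbedding_shear hτ)).2 h1
  refine hbi.mono' hme ?_
  filter_upwards [Measure.quasiMeasurePreserving_fst.ae hR] with z hz using hpt z.1 z.2 hz

/-- The average `∫ k(θ) G(x + τ(θ)) dν(θ)` of a locally integrable function is locally
integrable. -/
theorem locallyIntegrable_average [SFinite ν] {R : ℝ} (hk : Integrable k ν)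
    (hτ : Measurable τ) (hR : ∀ᵐ θ ∂ν, k θ ≠ 0 → ‖τ θ‖ ≤ R) (hG : LocallyIntegrable G volume) :
    LocallyIntegrable (fun x => ∫ θ, k θ * G (x + τ θ) ∂ν) volume := by
  rw [locallyIntegrable_iff]
  intro K hK
  obtain ⟨S, hS⟩ := hK.isBounded.subset_closedBall (0 : Eu N)
  rw [← integrable_indicator_iff hK.measurableSet]
  -- With the indicator of the compact set in the role of ψ, Fubini yields integrability of the
  -- average over that set.
  have h := (integrable_prod_translate (ψ := K.indicator 1) (S := S) (C := 1) hk hτ hR hG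
    ((measurable_one.indicator hK.measurableSet).aestronglyMeasurable)
    (fun x => by by_cases h : x ∈ K <;> simp [h])
    (fun x hx => by
      have : x ∈ K := Set.mem_of_indicator_ne_zero hx
      simpa using hS this)).swap.integral_prod_left
  refine h.congr (Eventually.of_forall fun x => ?_)
  by_cases hx : x ∈ K <;> simp [hx]

/-- Smearing is the adjoint of averaging. -/
theorem integral_mul_smear [SFinite ν] {R : ℝ} (hk : Integrable k ν)
    (hτ : Measurable τ) (hR : ∀ᵐ θ ∂ν, k θ ≠ 0 → ‖τ θ‖ ≤ R) (hG : LocallyIntegrable G volume)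
    (hψ : Continuous ψ) (hc : HasCompactSupport ψ) :
    ∫ x, G x * smear ν k τ ψ x = ∫ x, (∫ θ, k θ * G (x + τ θ) ∂ν) * ψ x := by
  obtain ⟨C, hC⟩ := hc.exists_bound_of_continuous hψ
  obtain ⟨S, hS⟩ := hc.isCompact.isBounded.subset_closedBall (0 : Eu N)
  have hI := integrable_prod_translate hk hτ hR hG hψ.aestronglyMeasurable hC
    (fun x hx => by simpa using hS (subset_tsupport ψ hx))
  have hI' : Integrable (fun z : Θ × Eu N => k z.1 * G z.2 * ψ (z.2 - τ z.1))
      (ν.prod volume) := by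
    rw [← (measurePreserving_shear hτ).integrable_comp_emb (measurableEmbedding_shear hτ)]
    refine hI.congr (Eventually.of_forall fun z => ?_)
    simp
  calc ∫ x, G x * smear ν k τ ψ x
      = ∫ x, ∫ θ, k θ * G x * ψ (x - τ θ) ∂ν := by
        refine integral_congr_ae (Eventually.of_forall fun x => ?_)
        simp only [smear]
        rw [← integral_const_mul]
        refine integral_congr_ae (Eventually.of_forall fun θ => ?_)
        simp only [smul_eq_mul]; ring
    _ = ∫ z, k z.1 * G z.2 * ψ (z.2 - τ z.1) ∂(ν.prod volume) :=
        (integral_prod_symm _ hI').symm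
    _ = ∫ z, k z.1 * G (z.2 + τ z.1) * ψ z.2 ∂(ν.prod volume) := by
        rw [← (measurePreserving_shear hτ).integral_comp (measurableEmbedding_shear hτ)]
        simp
    _ = ∫ x, ∫ θ, k θ * G (x + τ θ) * ψ x ∂ν := integral_prod_symm _ hI
    _ = ∫ x, (∫ θ, k θ * G (x + τ θ) ∂ν) * ψ x := by
        simp_rw [integral_mul_const]

end Smear

/-! ### Homotopy along segments and the representation by the gradient -/

/-- The product of Lebesgue measure on `(0, 1]` and Lebesgue measure on `ℝ^N`. -/
noncomputable def homot (N : ℕ) : Measure (ℝ × Eu N) :=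
  ((volume : Measure ℝ).restrict (Set.Ioc 0 1)).prod (volume : Measure (Eu N))

instance (N : ℕ) : SFinite (homot N) := by unfold homot; infer_instance

/-- The average of `G` along the segments issued from `x`: `∫∫ ω(y) G(x + ty) dy dt`. -/
noncomputable def segAvg {N : ℕ} (ω G : Eu N → ℝ) (x : Eu N) : ℝ :=
  ∫ z, ω z.2 * G (x + z.1 • z.2) ∂(homot N)

/-- The average `∫∫ η(x) G(x + ty) dx dt`. -/
noncomputable def coneAvg {N : ℕ} (η G : Eu N → ℝ) (y : Eu N) : ℝ :=
  ∫ z, η z.2 * G (z.2 + z.1 • y) ∂(homot N)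

section Representation

variable {N : ℕ} {ω η G ψ : Eu N → ℝ} {R : ℝ}

theorem ae_homot : ∀ᵐ z ∂(homot N), 0 < z.1 ∧ z.1 ≤ 1 := by
  have : ∀ᵐ t ∂((volume : Measure ℝ).restrict (Set.Ioc 0 1)), t ∈ Set.Ioc (0 : ℝ) 1 :=
    ae_restrict_mem measurableSet_Ioc
  exact Measure.quasiMeasurePreserving_fst.ae this

theorem integrable_comp_snd_homot (hω : Integrable ω) :
    Integrable (fun z : ℝ × Eu N => ω z.2) (homot N) :=
  hω.comp_snd _

theorem ae_norm_smul_le (hR : ∀ y, ω y ≠ 0 → ‖y‖ ≤ R) :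
    ∀ᵐ z ∂(homot N), ω z.2 ≠ 0 → ‖z.1 • z.2‖ ≤ R := by
  filter_upwards [ae_homot] with z hz h
  rw [norm_smul, Real.norm_of_nonneg hz.1.le]
  exact (mul_le_of_le_one_left (norm_nonneg _) hz.2).trans (hR _ h)

theorem measurable_smul_homot : Measurable (fun z : ℝ × Eu N => z.1 • z.2) :=
  measurable_fst.smul measurable_snd

theorem locallyIntegrable_segAvg (hω : Integrable ω) (hR : ∀ y, ω y ≠ 0 → ‖y‖ ≤ R)
    (hG : LocallyIntegrable G volume) : LocallyIntegrable (segAvg ω G) volume :=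
  locallyIntegrable_average (integrable_comp_snd_homot hω) measurable_smul_homot
    (ae_norm_smul_le hR) hG

theorem integral_mul_smear_homot (hω : Integrable ω) (hR : ∀ y, ω y ≠ 0 → ‖y‖ ≤ R)
    (hG : LocallyIntegrable G volume) (hψ : Continuous ψ) (hc : HasCompactSupport ψ) :
    ∫ x, G x * smear (homot N) (fun z => ω z.2) (fun z => z.1 • z.2) ψ x =
      ∫ x, segAvg ω G x * ψ x :=
  integral_mul_smear (integrable_comp_snd_homot hω) measurable_smul_homot
    (ae_norm_smul_le hR) hG hψ hc

/-- The exchange of the two space variables in `(ℝ × ℝ^N) × ℝ^N`. -/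
def exchange (N : ℕ) : (ℝ × Eu N) × Eu N ≃ᵐ (ℝ × Eu N) × Eu N where
  toFun z := ((z.1.1, z.2), z.1.2)
  invFun z := ((z.1.1, z.2), z.1.2)
  left_inv _ := rfl
  right_inv _ := rfl
  measurable_toFun := by
    change Measurable fun z : (ℝ × Eu N) × Eu N => ((z.1.1, z.2), z.1.2)
    fun_prop
  measurable_invFun := by
    change Measurable fun z : (ℝ × Eu N) × Eu N => ((z.1.1, z.2), z.1.2)
    fun_prop

theorem measurePreserving_exchange :
    MeasurePreserving (exchange N) ((homot N).prod volume) ((homot N).prod volume) := by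
  have h1 := measurePreserving_prodAssoc ((volume : Measure ℝ).restrict (Set.Ioc 0 1))
    (volume : Measure (Eu N)) (volume : Measure (Eu N))
  have h2 := (MeasurePreserving.id ((volume : Measure ℝ).restrict (Set.Ioc 0 1))).prod
    (Measure.measurePreserving_swap (μ := (volume : Measure (Eu N)))
      (ν := (volume : Measure (Eu N))))
  exact (h1.symm.comp (h2.comp h1))

theorem integrable_exchange (hω : Integrable ω) (hR : ∀ y, ω y ≠ 0 → ‖y‖ ≤ R)
    (hG : LocallyIntegrable G volume) (hψ : Continuous ψ) (hc : HasCompactSupport ψ) :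
    Integrable (fun z : (ℝ × Eu N) × Eu N => ω z.2 * G (z.1.2 + z.1.1 • z.2) * ψ z.1.2)
      ((homot N).prod volume) := by
  obtain ⟨C, hC⟩ := hc.exists_bound_of_continuous hψ
  obtain ⟨S, hS⟩ := hc.isCompact.isBounded.subset_closedBall (0 : Eu N)
  have hI := integrable_prod_translate (integrable_comp_snd_homot hω) measurable_smul_homot
    (ae_norm_smul_le hR) hG hψ.aestronglyMeasurable hC
    (fun x hx => by simpa using hS (subset_tsupport ψ hx))
  exact (measurePreserving_exchange.integrable_comp_emb (exchange N).measurableEmbedding).2 hI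

theorem integral_mul_coneAvg_aux (ψ : Eu N → ℝ) (y : Eu N) :
    ∫ z, ω y * G (z.2 + z.1 • y) * ψ z.2 ∂(homot N) = ω y * coneAvg ψ G y := by
  rw [coneAvg, ← integral_const_mul]
  exact integral_congr_ae (Eventually.of_forall fun z => by simp only; ring)

theorem integrable_mul_coneAvg (hω : Integrable ω) (hR : ∀ y, ω y ≠ 0 → ‖y‖ ≤ R)
    (hG : LocallyIntegrable G volume) (hψ : Continuous ψ) (hc : HasCompactSupport ψ) :
    Integrable (fun y => ω y * coneAvg ψ G y) := by
  have h := (integrable_exchange hω hR hG hψ hc).swap.integral_prod_left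
  refine h.congr (Eventually.of_forall fun y => ?_)
  exact integral_mul_coneAvg_aux ψ y

/-- Fubini in the variables t, x, y: integrating y out first gives `segAvg`, integrating x out first
gives `coneAvg`. -/
theorem integral_segAvg_mul (hω : Integrable ω) (hR : ∀ y, ω y ≠ 0 → ‖y‖ ≤ R)
    (hG : LocallyIntegrable G volume) (hψ : Continuous ψ) (hc : HasCompactSupport ψ) :
    ∫ x, segAvg ω G x * ψ x = ∫ y, ω y * coneAvg ψ G y := by
  have hI := integrable_exchange hω hR hG hψ hc
  have hI' := (measurePreserving_exchange.integrable_comp_emb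
    (exchange N).measurableEmbedding).2 hI
  calc ∫ x, segAvg ω G x * ψ x
      = ∫ x, ∫ z, ω z.2 * G (x + z.1 • z.2) * ψ x ∂(homot N) := by
        simp_rw [integral_mul_const]; rfl
    _ = ∫ z, ω z.1.2 * G (z.2 + z.1.1 • z.1.2) * ψ z.2 ∂((homot N).prod volume) :=
        (integral_prod_symm _ hI').symm
    _ = ∫ z, ω z.2 * G (z.1.2 + z.1.1 • z.2) * ψ z.1.2 ∂((homot N).prod volume) := by
        rw [← measurePreserving_exchange.integral_comp (exchange N).measurableEmbedding]
        rfl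
    _ = ∫ y, ∫ z, ω y * G (z.2 + z.1 • y) * ψ z.2 ∂(homot N) := integral_prod_symm _ hI
    _ = ∫ y, ω y * coneAvg ψ G y :=
        integral_congr_ae (Eventually.of_forall fun y => integral_mul_coneAvg_aux ψ y)

theorem locallyIntegrable_mul_coneAvg {ℓ : Eu N → ℝ} (hℓ : Continuous ℓ)
    (hG : LocallyIntegrable G volume) (hψ : Continuous ψ) (hc : HasCompactSupport ψ) :
    LocallyIntegrable (fun y => ℓ y * coneAvg ψ G y) volume := by
  rw [locallyIntegrable_iff]
  intro K hK
  obtain ⟨S, hS⟩ := hK.isBounded.subset_closedBall (0 : Eu N)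
  rw [← integrable_indicator_iff hK.measurableSet]
  have h := integrable_mul_coneAvg (ω := K.indicator ℓ) (R := S)
    ((integrable_indicator_iff hK.measurableSet).2 (hℓ.continuousOn.integrableOn_compact hK))
    (fun y hy => by simpa using hS (Set.mem_of_indicator_ne_zero hy)) hG hψ hc
  refine h.congr (Eventually.of_forall fun y => ?_)
  by_cases hy : y ∈ K <;> simp [hy]

theorem integrable_mul_coord {η : Eu N → ℝ} (hη : Continuous η) (hc : HasCompactSupport η)
    (i : Fin N) : Integrable (fun y => η y * y i) :=
  (hη.mul (by fun_prop)).integrable_of_hasCompactSupport hc.mul_right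

theorem exists_norm_le_of_ne_zero {η : Eu N → ℝ} (hc : HasCompactSupport η) :
    ∃ R : ℝ, ∀ y, η y ≠ 0 → ‖y‖ ≤ R := by
  obtain ⟨S, hS⟩ := hc.isCompact.isBounded.subset_closedBall (0 : Eu N)
  exact ⟨S, fun x hx => by simpa using hS (subset_tsupport η hx)⟩

theorem sum_coord_smul_single (y : Eu N) :
    ∑ i, y i • EuclideanSpace.single i (1 : ℝ) = y := by
  ext j
  simp [Finset.sum_apply, Pi.single_apply]

theorem integral_fderiv_segment {φ : Eu N → ℝ} (hφ : ContDiff ℝ 1 φ) (x y : Eu N) :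
    ∫ t in Set.Ioc (0 : ℝ) 1, fderiv ℝ φ (x - t • y) y = φ x - φ (x - y) := by
  rw [← intervalIntegral.integral_of_le zero_le_one]
  have hd : ∀ t : ℝ, HasDerivAt (fun t : ℝ => -φ (x - t • y)) (fderiv ℝ φ (x - t • y) y) t := by
    intro t
    have h1 : HasFDerivAt φ (fderiv ℝ φ (x - t • y)) (x - t • y) :=
      (hφ.differentiable one_ne_zero _).hasFDerivAt
    have h2 : HasDerivAt (fun t : ℝ => x - t • y) (-y) t := by
      simpa using ((hasDerivAt_id t).smul_const y).const_sub x
    have h3 := (h1.comp_hasDerivAt t h2).neg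
    rw [map_neg, neg_neg] at h3
    exact h3
  rw [intervalIntegral.integral_eq_sub_of_hasDerivAt (fun t _ => hd t)]
  · simp; ring
  · apply Continuous.intervalIntegrable
    exact ((hφ.continuous_fderiv one_ne_zero).comp (by fun_prop)).clm_apply continuous_const

/-- The divergence of the vector field `∫∫ η(y) y φ(x - ty) dy dt`. -/
theorem sum_fderiv_smear {η φ : Eu N → ℝ} (hη : Continuous η) (hηc : HasCompactSupport η)
    (hφ : ContDiff ℝ 1 φ) (hc : HasCompactSupport φ) (x : Eu N) :
    ∑ i, fderiv ℝ (smear (homot N) (fun z => η z.2 * z.2 i) (fun z => z.1 • z.2) φ) x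
        (EuclideanSpace.single i (1 : ℝ)) =
      (∫ y, η y) * φ x - smear volume η (fun y => y) φ x := by
  have hτ : AEMeasurable (fun z : ℝ × Eu N => z.1 • z.2) (homot N) :=
    measurable_smul_homot.aemeasurable
  have hηi : Integrable η := hη.integrable_of_hasCompactSupport hηc
  have hk : ∀ i : Fin N, Integrable (fun z : ℝ × Eu N => η z.2 * z.2 i) (homot N) :=
    fun i => integrable_comp_snd_homot (integrable_mul_coord hη hηc i)
  have hd : Continuous (fderiv ℝ φ) := hφ.continuous_fderiv one_ne_zero
  have hdc : HasCompactSupport (fderiv ℝ φ) := hc.fderiv (𝕜 := ℝ)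
  have hint : ∀ i : Fin N, Integrable (fun z : ℝ × Eu N =>
      (η z.2 * z.2 i) * fderiv ℝ φ (x - z.1 • z.2) (EuclideanSpace.single i 1)) (homot N) :=
    fun i => (integrable_smear_integrand (hk i) hτ hd hdc x).apply_continuousLinearMap
      (EuclideanSpace.single i 1)
  have hsum : ∀ z : ℝ × Eu N, ∑ i, (η z.2 * z.2 i) *
      fderiv ℝ φ (x - z.1 • z.2) (EuclideanSpace.single i 1) =
      η z.2 * fderiv ℝ φ (x - z.1 • z.2) z.2 := by
    intro z
    conv_rhs => rw [← sum_coord_smul_single z.2, map_sum, Finset.mul_sum]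
    simp only [sum_coord_smul_single, map_smul, smul_eq_mul, mul_assoc]
  have hint' : Integrable (fun z : ℝ × Eu N => η z.2 * fderiv ℝ φ (x - z.1 • z.2) z.2)
      (homot N) :=
    (integrable_finsetSum Finset.univ (fun i _ => hint i)).congr
      (Eventually.of_forall hsum)
  calc ∑ i, fderiv ℝ (smear (homot N) (fun z => η z.2 * z.2 i) (fun z => z.1 • z.2) φ) x
        (EuclideanSpace.single i (1 : ℝ))
      = ∑ i, ∫ z, (η z.2 * z.2 i) *
          fderiv ℝ φ (x - z.1 • z.2) (EuclideanSpace.single i 1) ∂(homot N) := by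
        refine Finset.sum_congr rfl fun i _ => ?_
        rw [(hasFDerivAt_smear (hk i) hτ hφ hc x).fderiv, smear,
          ContinuousLinearMap.integral_apply (integrable_smear_integrand (hk i) hτ hd hdc x)]
        rfl
    _ = ∫ z, η z.2 * fderiv ℝ φ (x - z.1 • z.2) z.2 ∂(homot N) := by
        rw [← integral_finsetSum _ (fun i _ => hint i)]
        simp_rw [hsum]
    -- Summing over the coordinates leaves the derivative of φ along the segment, which integrates
    -- exactly in t.
    _ = ∫ y, η y * (φ x - φ (x - y)) := by
        rw [homot, integral_prod_symm _ hint']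
        refine integral_congr_ae (Eventually.of_forall fun y => ?_)
        simp only
        rw [integral_const_mul, integral_fderiv_segment hφ]
    _ = _ := by
        have h2 := integrable_smear_integrand (τ := fun y : Eu N => y) hηi
          measurable_id.aemeasurable hφ.continuous hc x
        simp_rw [mul_sub]
        simp only [smul_eq_mul] at h2
        rw [integral_sub (hηi.mul_const _) h2, integral_mul_const]
        rfl

theorem lineDeriv_apply (φ : 𝓓((⊤ : Opens (Eu N)), ℝ)) (v x : Eu N) :
    (∂_{v} φ) x = fderiv ℝ φ x v := by
  rw [TestFunction.lineDerivOp_eq_lineDerivCLM (𝕜 := ℝ), TestFunction.lineDerivCLM_eq_fderivCLM]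
  simp

/-- The radial vector potential average `∑ᵢ ∫∫ η(y) yᵢ gᵢ(x + ty) dy dt`. -/
noncomputable def segPart (η : Eu N → ℝ) (g : Eu N → Eu N) (x : Eu N) : ℝ :=
  ∑ i, segAvg (fun y => η y * y i) (fun x => g x i) x

/-- The vector potential average `∑ᵢ yᵢ ∫∫ η(x) gᵢ(x + ty) dx dt`. -/
noncomputable def conePart (η : Eu N → ℝ) (g : Eu N → Eu N) (y : Eu N) : ℝ :=
  ∑ i, y i * coneAvg η (fun x => g x i) y

variable {u : Distr N} {g : Eu N → Eu N}

theorem locallyIntegrable_segPart (hg : ∀ i, LocallyIntegrable (fun x => g x i) volume)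
    {η : Eu N → ℝ} (hη : Continuous η) (hc : HasCompactSupport η) :
    LocallyIntegrable (segPart η g) volume := by
  obtain ⟨R, hR⟩ := exists_norm_le_of_ne_zero hc
  unfold segPart
  exact locallyIntegrable_finsetSum _ fun i _ => locallyIntegrable_segAvg (R := R)
    (integrable_mul_coord hη hc i) (fun y hy => hR y (left_ne_zero_of_mul hy)) (hg i)

theorem locallyIntegrable_conePart (hg : ∀ i, LocallyIntegrable (fun x => g x i) volume)
    {η : Eu N → ℝ} (hη : Continuous η) (hc : HasCompactSupport η) :
    LocallyIntegrable (conePart η g) volume := by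
  unfold conePart
  exact locallyIntegrable_finsetSum _ fun i _ => locallyIntegrable_mul_coneAvg
    (by fun_prop) (hg i) hη hc

theorem integrable_mul_test {f : Eu N → ℝ} (hf : LocallyIntegrable f volume)
    (φ : 𝓓((⊤ : Opens (Eu N)), ℝ)) : Integrable (fun x => f x * φ x) := by
  have := hf.integrable_smul_right_of_hasCompactSupport φ.continuous φ.hasCompactSupport
  exact this

/-- The convolution of two test functions. -/
noncomputable def convTest (η φ : 𝓓((⊤ : Opens (Eu N)), ℝ)) : 𝓓((⊤ : Opens (Eu N)), ℝ) :=
  smearTest (ν := volume) (k := η) (τ := fun y => y)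
    (R := (exists_norm_le_of_ne_zero η.hasCompactSupport).choose)
    (η.continuous.integrable_of_hasCompactSupport η.hasCompactSupport) measurable_id.aemeasurable
    (Eventually.of_forall (exists_norm_le_of_ne_zero η.hasCompactSupport).choose_spec) φ

theorem convTest_apply (η φ : 𝓓((⊤ : Opens (Eu N)), ℝ)) (x : Eu N) :
    convTest η φ x = ∫ y, η y * φ (x - y) := rfl

theorem convTest_comm (η φ : 𝓓((⊤ : Opens (Eu N)), ℝ)) : convTest η φ = convTest φ η := by
  ext x
  rw [convTest_apply, convTest_apply, ← integral_sub_left_eq_self _ volume x]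
  simp [mul_comm]

/-- The homotopy formula for a distribution with a locally integrable gradient. -/
theorem apply_mul_integral (hu : ∀ i, IsGivenBy (∂_{EuclideanSpace.single i (1 : ℝ)} u)
      (fun x => g x i)) (η φ : 𝓓((⊤ : Opens (Eu N)), ℝ)) :
    (∫ y, η y) * u φ = u (convTest η φ) - ∫ x, segPart η g x * φ x := by
  obtain ⟨R, hR⟩ := exists_norm_le_of_ne_zero η.hasCompactSupport
  have hω := fun i => integrable_mul_coord η.continuous η.hasCompactSupport i
  have hRi : ∀ (i : Fin N) y, η y * y i ≠ 0 → ‖y‖ ≤ R :=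
    fun i y hy => hR y (left_ne_zero_of_mul hy)
  let Φ : Fin N → 𝓓((⊤ : Opens (Eu N)), ℝ) := fun i =>
    smearTest (integrable_comp_snd_homot (hω i)) measurable_smul_homot.aemeasurable
      (ae_norm_smul_le (hRi i)) φ
  -- The `Φ i` form a test vector field, and u evaluated on its divergence depends on the gradient
  -- of u alone.
  have hΦ : ∑ i, ∂_{EuclideanSpace.single i (1 : ℝ)} (Φ i) =
      (∫ y, η y) • φ - convTest η φ := by
    ext x
    have h1 := sum_fderiv_smear η.continuous η.hasCompactSupport
      (φ.contDiff.of_le (by exact_mod_cast le_top)) φ.hasCompactSupport x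
    have h2 : (∑ i, ∂_{EuclideanSpace.single i (1 : ℝ)} (Φ i)) x =
        ∑ i, (∂_{EuclideanSpace.single i (1 : ℝ)} (Φ i)) x := by simp
    rw [h2]
    simp_rw [lineDeriv_apply]
    exact h1
  have h3 : ∑ i, u (∂_{EuclideanSpace.single i (1 : ℝ)} (Φ i)) =
      -∫ x, segPart η g x * φ x := by
    have h4 : ∀ i, u (∂_{EuclideanSpace.single i (1 : ℝ)} (Φ i)) =
        -∫ x, segAvg (fun y => η y * y i) (fun x => g x i) x * φ x := by
      intro i
      have h5 := (hu i).2 (Φ i)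
      rw [Distribution.lineDerivOp_apply_apply, map_neg] at h5
      rw [← neg_eq_iff_eq_neg, h5]
      exact integral_mul_smear_homot (hω i) (hRi i) (hu i).1 φ.continuous φ.hasCompactSupport
    simp_rw [h4]
    rw [Finset.sum_neg_distrib, ← integral_finsetSum]
    · simp_rw [segPart, Finset.sum_mul]
    · intro i _
      exact integrable_mul_test (locallyIntegrable_segAvg (hω i) (hRi i) (hu i).1) φ
  rw [← map_sum, hΦ, map_sub, map_smul, smul_eq_mul] at h3
  linarith

/-- This moves φ out of the averaging kernel, so that it appears as a test function integrated
against a fixed function. -/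
theorem integral_segPart_mul (hg : ∀ i, LocallyIntegrable (fun x => g x i) volume)
    (η φ : 𝓓((⊤ : Opens (Eu N)), ℝ)) :
    ∫ x, segPart φ g x * η x = ∫ y, conePart η g y * φ y := by
  obtain ⟨R, hR⟩ := exists_norm_le_of_ne_zero φ.hasCompactSupport
  have hω := fun i => integrable_mul_coord φ.continuous φ.hasCompactSupport i
  have hRi : ∀ (i : Fin N) y, φ y * y i ≠ 0 → ‖y‖ ≤ R :=
    fun i y hy => hR y (left_ne_zero_of_mul hy)
  simp_rw [segPart, conePart, Finset.sum_mul]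
  rw [integral_finsetSum, integral_finsetSum]
  · refine Finset.sum_congr rfl fun i _ => ?_
    rw [integral_segAvg_mul (hω i) (hRi i) (hg i) η.continuous η.hasCompactSupport]
    exact integral_congr_ae (Eventually.of_forall fun y => by simp only; ring)
  · intro i _
    exact integrable_mul_test (locallyIntegrable_mul_coneAvg (by fun_prop) (hg i)
      η.continuous η.hasCompactSupport) φ
  · intro i _
    exact integrable_mul_test (locallyIntegrable_segAvg (hω i) (hRi i) (hg i)) η

/-- A distribution with locally integrable gradient is a locally integrable function, given by
an explicit formula. -/
theorem isGivenBy_of_gradient (hu : ∀ i, IsGivenBy (∂_{EuclideanSpace.single i (1 : ℝ)} u)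
      (fun x => g x i)) (η : 𝓓((⊤ : Opens (Eu N)), ℝ)) (h1 : ∫ y, η y = 1) :
    IsGivenBy u (fun x => u η + conePart η g x - segPart η g x) := by
  have hg := fun i => (hu i).1
  have hA := locallyIntegrable_conePart hg η.continuous η.hasCompactSupport
  have hB := locallyIntegrable_segPart hg η.continuous η.hasCompactSupport
  refine ⟨((locallyIntegrable_const _).add hA).sub hB, fun φ => ?_⟩
  -- The homotopy formula is used twice, with η and φ exchanged. Convolution of test functions
  -- commutes, so the unknown term u(η∗φ) is common to both and can be eliminated.
  have e1 := apply_mul_integral hu η φ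
  have e2 := apply_mul_integral hu φ η
  rw [convTest_comm, integral_segPart_mul hg] at e2
  have iφ : Integrable (fun x => φ x) :=
    φ.continuous.integrable_of_hasCompactSupport φ.hasCompactSupport
  simp_rw [sub_mul, add_mul]
  rw [integral_sub, integral_add, integral_const_mul]
  · rw [h1] at e1; linarith
  · exact iφ.const_mul _
  · exact integrable_mul_test hA φ
  · exact (iφ.const_mul _).add (integrable_mul_test hA φ)
  · exact integrable_mul_test hB φ

theorem IsGivenBy.ae_eq {f f' : Eu N → ℝ} (hf : IsGivenBy u f) (hf' : IsGivenBy u f') :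
    f =ᵐ[volume] f' := by
  refine ae_eq_of_integral_contDiff_smul_eq hf.1 hf'.1 fun φ hφ hc => ?_
  let φ' : 𝓓((⊤ : Opens (Eu N)), ℝ) := ⟨φ, hφ, hc, by simp⟩
  have := (hf.2 φ').symm.trans (hf'.2 φ')
  simp_rw [smul_eq_mul, mul_comm (φ _)]
  exact this

/-- Once u is known to be f, the term u(η∗φ) of the homotopy formula is the integral of φ against
the η-average of f and need not be eliminated. For a mollifier of small support this identity is
local; the Morrey estimates start from it. -/
theorem IsGivenBy.ae_eq_average {f : Eu N → ℝ} (hf : IsGivenBy u f)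
    (hu : ∀ i, IsGivenBy (∂_{EuclideanSpace.single i (1 : ℝ)} u) (fun x => g x i))
    (η : 𝓓((⊤ : Opens (Eu N)), ℝ)) (h1 : ∫ y, η y = 1) :
    f =ᵐ[volume] fun x => (∫ y, η y * f (x + y)) - segPart η g x := by
  have hg := fun i => (hu i).1
  have hηi := η.continuous.integrable_of_hasCompactSupport (μ := volume) η.hasCompactSupport
  obtain ⟨R, hR⟩ := exists_norm_le_of_ne_zero η.hasCompactSupport
  have hA : LocallyIntegrable (fun x => ∫ y, η y * f (x + y)) volume :=
    locallyIntegrable_average (τ := fun y => y) hηi measurable_id (Eventually.of_forall hR) hf.1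
  have hB := locallyIntegrable_segPart hg η.continuous η.hasCompactSupport
  refine IsGivenBy.ae_eq hf ⟨hA.sub hB, fun φ => ?_⟩
  have e1 := apply_mul_integral hu η φ
  have e2 := integral_mul_smear (τ := fun y => y) hηi measurable_id (Eventually.of_forall hR) hf.1
    φ.continuous φ.hasCompactSupport
  simp_rw [sub_mul]
  rw [integral_sub (integrable_mul_test hA φ) (integrable_mul_test hB φ), ← e2]
  rw [h1, one_mul, hf.2 (convTest η φ)] at e1
  exact e1

end Representation

/-! ### Jensen's inequality for measures that are not normalised -/

section Jensen

variable {Θ : Type*} [MeasurableSpace Θ] {ν : Measure Θ} {p : ℝ}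

theorem lintegral_rpow_le (hp : 1 ≤ p) {v : Θ → ℝ≥0∞} (hv : Measurable v) :
    (∫⁻ θ, v θ ∂ν) ^ p ≤ ν Set.univ ^ (p - 1) * ∫⁻ θ, v θ ^ p ∂ν := by
  have h0 : 0 < p := by linarith
  have h := eLpNorm'_le_eLpNorm'_mul_rpow_measure_univ (μ := ν) (f := v) one_pos hp
    hv.aestronglyMeasurable
  simp only [eLpNorm', enorm_eq_self, ENNReal.rpow_one, div_one] at h
  have h2 := ENNReal.rpow_le_rpow h h0.le
  rw [ENNReal.mul_rpow_of_nonneg _ _ h0.le, ← ENNReal.rpow_mul, ← ENNReal.rpow_mul,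
    one_div_mul_cancel h0.ne', ENNReal.rpow_one, mul_comm] at h2
  have h3 : (1 - 1 / p) * p = p - 1 := by field_simp
  rwa [h3] at h2

/-- The preceding inequality for the measure with density k. -/
theorem lintegral_mul_rpow_le (hp : 1 ≤ p) {k v : Θ → ℝ≥0∞} (hk : Measurable k)
    (hv : Measurable v) :
    (∫⁻ θ, k θ * v θ ∂ν) ^ p ≤ (∫⁻ θ, k θ ∂ν) ^ (p - 1) * ∫⁻ θ, k θ * v θ ^ p ∂ν := by
  have h := lintegral_rpow_le (ν := ν.withDensity k) hp hv
  rw [lintegral_withDensity_eq_lintegral_mul _ hk hv,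
    lintegral_withDensity_eq_lintegral_mul _ hk (hv.pow_const p),
    withDensity_apply _ MeasurableSet.univ, Measure.restrict_univ] at h
  exact h

end Jensen

/-! ### The weights: slow variation, averages, Hardy's inequality -/

/-- The weight `(1 + |x|)^a`. -/
noncomputable def wt {N : ℕ} (a : ℝ) (x : Eu N) : ℝ≥0∞ := ENNReal.ofReal ((1 + ‖x‖) ^ a)

/-- The weighted integral `∫ (1 + |x|)^(-tp - N) v(x)^p dx`. -/
noncomputable def wInt {N : ℕ} (p t : ℝ) (v : Eu N → ℝ≥0∞) : ℝ≥0∞ :=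
  ∫⁻ x, wt (-(t * p) - N) x * v x ^ p

section Weights

variable {N : ℕ} {p t a b : ℝ} {x y : Eu N}

theorem one_add_norm_pos (x : Eu N) : 0 < 1 + ‖x‖ := by positivity

theorem measurable_wt : Measurable (wt a : Eu N → ℝ≥0∞) := by
  unfold wt; fun_prop

theorem wt_ne_top : wt a x ≠ ∞ := ENNReal.ofReal_ne_top

theorem wt_add : wt (a + b) x = wt a x * wt b x := by
  unfold wt
  rw [Real.rpow_add (one_add_norm_pos x), ENNReal.ofReal_mul (by positivity)]

theorem wt_rpow (hp : 0 ≤ p) : wt a x ^ p = wt (a * p) x := by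
  unfold wt
  rw [ENNReal.ofReal_rpow_of_nonneg (by positivity) hp, ← Real.rpow_mul (by positivity)]

theorem wt_mono (h : a ≤ b) : wt a x ≤ wt b x :=
  ENNReal.ofReal_le_ofReal (Real.rpow_le_rpow_of_exponent_le (by simp) h)

theorem wt_zero : wt 0 x = 1 := by simp [wt]

theorem enorm_le_wt_one : ‖x‖ₑ ≤ wt 1 x := by
  rw [wt, Real.rpow_one, ← ofReal_norm]
  exact ENNReal.ofReal_le_ofReal (by linarith)

/-- The two-sided comparison serves both signs of the exponent: `h1` is used when a ≥ 0 and `h2`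
when a ≤ 0. -/
theorem rpow_le_rpow_abs {c m m' : ℝ} (hc : 1 ≤ c) (hm : 0 < m) (hm' : 0 < m')
    (h1 : m ≤ c * m') (h2 : m' ≤ c * m) : m ^ a ≤ c ^ |a| * m' ^ a := by
  have hc0 : 0 < c := by linarith
  rcases le_total 0 a with h | h
  · rw [abs_of_nonneg h, ← Real.mul_rpow hc0.le hm'.le]
    exact Real.rpow_le_rpow hm.le h1 h
  · have h3 : (c * m) ^ a ≤ m' ^ a := Real.rpow_le_rpow_of_nonpos hm' h2 h
    rw [Real.mul_rpow hc0.le hm.le] at h3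
    have h4 : c ^ |a| * c ^ a = 1 := by
      rw [← Real.rpow_add hc0, abs_of_nonpos h]; simp
    calc m ^ a = c ^ |a| * (c ^ a * m ^ a) := by rw [← mul_assoc, h4, one_mul]
      _ ≤ _ := by gcongr

theorem wt_le_of_comparable {c : ℝ} (hc : 1 ≤ c) (h1 : 1 + ‖x‖ ≤ c * (1 + ‖y‖))
    (h2 : 1 + ‖y‖ ≤ c * (1 + ‖x‖)) : wt a x ≤ ENNReal.ofReal (c ^ |a|) * wt a y := by
  unfold wt
  rw [← ENNReal.ofReal_mul (by positivity)]
  exact ENNReal.ofReal_le_ofReal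
    (rpow_le_rpow_abs hc (one_add_norm_pos x) (one_add_norm_pos y) h1 h2)

/-- The weight varies slowly: a translation of length at most R changes 1 + |x| by at most the
factor 1 + R in either direction. -/
theorem wt_le_wt_add {R : ℝ} (hy : ‖y‖ ≤ R) :
    wt a x ≤ ENNReal.ofReal ((1 + R) ^ |a|) * wt a (x + y) := by
  have hR : 0 ≤ R := (norm_nonneg y).trans hy
  have h1 := norm_add_le x y
  have h2 : ‖x‖ ≤ ‖x + y‖ + ‖y‖ := by simpa using norm_sub_le (x + y) y
  have h3 := mul_nonneg hR (norm_nonneg (x + y))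
  have h4 := mul_nonneg hR (norm_nonneg x)
  refine wt_le_of_comparable (by linarith) ?_ ?_ <;> nlinarith

theorem wt_le_wt_of_norm_le {R : ℝ} (hx : ‖x‖ ≤ R) :
    wt a x ≤ ENNReal.ofReal ((1 + R) ^ |a|) ∧ 1 ≤ ENNReal.ofReal ((1 + R) ^ |a|) * wt a x := by
  have h0 : wt a (0 : Eu N) = 1 := by simp [wt]
  constructor
  · have := wt_le_wt_add (a := a) (x := x) (y := -x) (R := R) (by simpa)
    simpa [h0] using this
  · have := wt_le_wt_add (a := a) (x := (0 : Eu N)) (y := x) hx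
    simpa [h0] using this

theorem measurable_wt_mul {v : Eu N → ℝ≥0∞} (hv : Measurable v) :
    Measurable fun x => wt a x * v x ^ p := measurable_wt.mul (hv.pow_const p)

/-- Averages over bounded translations are bounded in weighted spaces. -/
theorem lintegral_wt_average_le {Θ : Type*} [MeasurableSpace Θ] {ν : Measure Θ} [SFinite ν]
    (hp : 1 ≤ p) {k : Θ → ℝ≥0∞} (hk : Measurable k) {τ : Θ → Eu N} (hτ : Measurable τ) {R : ℝ}
    (hR : ∀ᵐ θ ∂ν, k θ ≠ 0 → ‖τ θ‖ ≤ R) {v : Eu N → ℝ≥0∞} (hv : Measurable v) :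
    ∫⁻ x, wt a x * (∫⁻ θ, k θ * v (x + τ θ) ∂ν) ^ p ≤
      ((∫⁻ θ, k θ ∂ν) ^ p * ENNReal.ofReal ((1 + R) ^ |a|)) * ∫⁻ x, wt a x * v x ^ p := by
  set κ := ∫⁻ θ, k θ ∂ν
  set W := ENNReal.ofReal ((1 + R) ^ |a|)
  have hvt : Measurable (fun z : Eu N × Θ => v (z.1 + τ z.2)) :=
    hv.comp (measurable_fst.add (hτ.comp measurable_snd))
  calc ∫⁻ x, wt a x * (∫⁻ θ, k θ * v (x + τ θ) ∂ν) ^ p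
      ≤ ∫⁻ x, κ ^ (p - 1) * ∫⁻ θ, wt a x * (k θ * v (x + τ θ) ^ p) ∂ν := by
        refine lintegral_mono fun x => ?_
        have h := lintegral_mul_rpow_le (ν := ν) hp hk (v := fun θ => v (x + τ θ))
          (hv.comp (measurable_const.add hτ))
        rw [lintegral_const_mul']
        · calc _ ≤ wt a x * (κ ^ (p - 1) * ∫⁻ θ, k θ * v (x + τ θ) ^ p ∂ν) := by gcongr
            _ = _ := by ring
        · exact wt_ne_top
    _ = κ ^ (p - 1) * ∫⁻ θ, (∫⁻ x : Eu N, wt a x * (k θ * v (x + τ θ) ^ p)) ∂ν := by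
        have hm : Measurable (fun z : Eu N × Θ => wt a z.1 * (k z.2 * v (z.1 + τ z.2) ^ p)) :=
          (measurable_wt.comp measurable_fst).mul
            ((hk.comp measurable_snd).mul (hvt.pow_const p))
        rw [lintegral_const_mul _ hm.lintegral_prod_right',
          lintegral_lintegral_swap hm.aemeasurable]
    _ ≤ κ ^ (p - 1) * ∫⁻ θ, k θ * (W * ∫⁻ x, wt a x * v x ^ p) ∂ν := by
        gcongr κ ^ (p - 1) * ?_
        refine lintegral_mono_ae ?_
        filter_upwards [hR] with θ hθ
        by_cases h0 : k θ = 0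
        · simp [h0]
        calc ∫⁻ x, wt a x * (k θ * v (x + τ θ) ^ p)
            ≤ ∫⁻ x, k θ * W * (wt a (x + τ θ) * v (x + τ θ) ^ p) := by
              refine lintegral_mono fun x => ?_
              calc wt a x * (k θ * v (x + τ θ) ^ p)
                  ≤ (W * wt a (x + τ θ)) * (k θ * v (x + τ θ) ^ p) := by
                    gcongr; exact wt_le_wt_add (hθ h0)
                _ = _ := by ring
          _ = k θ * W * ∫⁻ x, wt a x * v x ^ p := by
              rw [lintegral_const_mul]
              · rw [lintegral_add_right_eq_self (fun x => wt a x * v x ^ p) (τ θ)]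
              · exact (measurable_wt_mul hv).comp (measurable_add_const _)
          _ = _ := by ring
    _ = _ := by
        rw [lintegral_mul_const _ hk]
        have : κ ^ p = κ ^ (p - 1) * κ := by
          have := ENNReal.rpow_add_of_nonneg (x := κ) (p - 1) 1 (by linarith) zero_le_one
          simpa using this
        rw [this]; ring

theorem lintegral_comp_smul_eq {r : ℝ} (hr : 0 < r) {F : Eu N → ℝ≥0∞} (hF : Measurable F) :
    ∫⁻ x, F (r • x) = ENNReal.ofReal (r ^ (-(N : ℝ))) * ∫⁻ x, F x := by
  rw [← lintegral_map hF (measurable_const_smul r), Measure.map_addHaar_smul _ hr.ne',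
    lintegral_smul_measure, smul_eq_mul]
  congr 2
  rw [finrank_euclideanSpace_fin, abs_of_nonneg (by positivity), Real.rpow_neg hr.le,
    Real.rpow_natCast]

theorem lintegral_Ioc_rpow {s : ℝ} (hs : -1 < s) :
    ∫⁻ r in Set.Ioc (0 : ℝ) 1, ENNReal.ofReal (r ^ s) = ENNReal.ofReal (1 / (s + 1)) := by
  rw [← ofReal_integral_eq_lintegral_ofReal]
  · rw [← intervalIntegral.integral_of_le zero_le_one, integral_rpow (Or.inl hs)]
    simp [Real.zero_rpow (show s + 1 ≠ 0 by linarith)]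
  · have := intervalIntegral.intervalIntegrable_rpow' (a := 0) (b := 1) hs
    rwa [intervalIntegrable_iff_integrableOn_Ioc_of_le zero_le_one] at this
  · filter_upwards [ae_restrict_mem measurableSet_Ioc] with r hr
    exact Real.rpow_nonneg hr.1.le _

/-- A Hardy inequality: averages along rays of functions vanishing in the unit ball. -/
theorem lintegral_ray_average_le {s : ℝ} (hs : -1 < s) (hp : 1 ≤ p) {V : Eu N → ℝ≥0∞}
    (hV : Measurable V) (h0 : ∀ z, ‖z‖ ≤ 1 → V z = 0) :
    ∫⁻ y, wt (-(s * p) - N) y * (∫⁻ r in Set.Ioc (0 : ℝ) 1, V (r • y)) ^ p ≤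
      ENNReal.ofReal ((1 / (s + 1)) ^ p * 2 ^ |-(s * p) - N|) * wInt p s V := by
  set a := -(s * p) - N with ha
  set κ := ENNReal.ofReal (1 / (s + 1))
  have hsc : Measurable fun z : Eu N × ℝ => V (z.2 • z.1) :=
    hV.comp (measurable_snd.smul measurable_fst)
  have hrpow : ∀ b : ℝ, Measurable fun r : ℝ => ENNReal.ofReal (r ^ b) := fun b => by fun_prop
  have hm : Measurable fun z : Eu N × ℝ =>
      wt a z.1 * (ENNReal.ofReal (z.2 ^ (s - s * p)) * V (z.2 • z.1) ^ p) :=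
    (measurable_wt.comp measurable_fst).mul
      (((hrpow _).comp measurable_snd).mul (hsc.pow_const p))
  calc ∫⁻ y, wt a y * (∫⁻ r in Set.Ioc (0 : ℝ) 1, V (r • y)) ^ p
      ≤ ∫⁻ y, κ ^ (p - 1) * ∫⁻ r in Set.Ioc (0 : ℝ) 1,
          wt a y * (ENNReal.ofReal (r ^ (s - s * p)) * V (r • y) ^ p) := by
        refine lintegral_mono fun y => ?_
        -- Write V(ry) = r^s · r^(-s) V(ry) and apply Jensen with density r^s, whose mass 1/(s + 1)
        -- is finite because s > -1.
        have h := lintegral_mul_rpow_le (ν := volume.restrict (Set.Ioc (0 : ℝ) 1)) hp (hrpow s)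
          (v := fun r => ENNReal.ofReal (r ^ (-s)) * V (r • y))
          ((hrpow _).mul (hV.comp (measurable_id.smul_const y)))
        rw [lintegral_Ioc_rpow hs] at h
        rw [lintegral_const_mul' _ _ wt_ne_top]
        have e1 : ∫⁻ r in Set.Ioc (0 : ℝ) 1, V (r • y) =
            ∫⁻ r in Set.Ioc (0 : ℝ) 1,
              ENNReal.ofReal (r ^ s) * (ENNReal.ofReal (r ^ (-s)) * V (r • y)) := by
          refine setLIntegral_congr_fun measurableSet_Ioc fun r hr => ?_
          have h1 : ENNReal.ofReal (r ^ s) * ENNReal.ofReal (r ^ (-s)) = 1 := by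
            rw [← ENNReal.ofReal_mul (Real.rpow_nonneg hr.1.le _), ← Real.rpow_add hr.1]; simp
          rw [← mul_assoc, h1, one_mul]
        have e2 : ∫⁻ r in Set.Ioc (0 : ℝ) 1,
            ENNReal.ofReal (r ^ s) * (ENNReal.ofReal (r ^ (-s)) * V (r • y)) ^ p =
            ∫⁻ r in Set.Ioc (0 : ℝ) 1, ENNReal.ofReal (r ^ (s - s * p)) * V (r • y) ^ p := by
          refine setLIntegral_congr_fun measurableSet_Ioc fun r hr => ?_
          rw [ENNReal.mul_rpow_of_nonneg _ _ (by linarith), ← mul_assoc,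
            ENNReal.ofReal_rpow_of_nonneg (Real.rpow_nonneg hr.1.le _) (by linarith),
            ← ENNReal.ofReal_mul (Real.rpow_nonneg hr.1.le _), ← Real.rpow_mul hr.1.le,
            ← Real.rpow_add hr.1]
          ring_nf
        rw [e1]
        rw [e2] at h
        calc _ ≤ wt a y * (κ ^ (p - 1) * ∫⁻ r in Set.Ioc (0 : ℝ) 1,
              ENNReal.ofReal (r ^ (s - s * p)) * V (r • y) ^ p) := by gcongr
          _ = _ := by ring
    _ = κ ^ (p - 1) * ∫⁻ r in Set.Ioc (0 : ℝ) 1, ∫⁻ y,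
          wt a y * (ENNReal.ofReal (r ^ (s - s * p)) * V (r • y) ^ p) := by
        rw [lintegral_const_mul _ hm.lintegral_prod_right',
          lintegral_lintegral_swap hm.aemeasurable]
    _ ≤ κ ^ (p - 1) * ∫⁻ r in Set.Ioc (0 : ℝ) 1,
          ENNReal.ofReal (r ^ s) * (ENNReal.ofReal (2 ^ |a|) * wInt p s V) := by
        gcongr κ ^ (p - 1) * ?_
        refine setLIntegral_mono' measurableSet_Ioc fun r hr => ?_
        have hpt : ∀ y : Eu N, wt a y * (ENNReal.ofReal (r ^ (s - s * p)) * V (r • y) ^ p) ≤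
            (ENNReal.ofReal (r ^ (s - s * p)) * (ENNReal.ofReal (2 ^ |a|) *
              ENNReal.ofReal (r ^ (-a)))) * (wt a (r • y) * V (r • y) ^ p) := by
          intro y
          -- If |ry| ≤ 1, then V vanishes at ry. Otherwise r ≤ 1 < r|y|, so r(1 + |y|) and 1 + r|y|
          -- agree up to a factor 2 and the weight behaves like a homogeneous function.
          rcases le_or_gt ‖r • y‖ 1 with h | h
          · have hp0 : 0 < p := by linarith
            simp [h0 _ h, ENNReal.zero_rpow_of_pos hp0]
          have hw : wt a y ≤ (ENNReal.ofReal (2 ^ |a|) * ENNReal.ofReal (r ^ (-a))) *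
              wt a (r • y) := by
            unfold wt
            rw [← ENNReal.ofReal_mul (by positivity),
              ← ENNReal.ofReal_mul (by have := Real.rpow_nonneg hr.1.le (-a); positivity)]
            refine ENNReal.ofReal_le_ofReal ?_
            rw [norm_smul, Real.norm_of_nonneg hr.1.le] at h ⊢
            have h5 := rpow_le_rpow_abs (a := a) (c := 2) (m := r * (1 + ‖y‖))
              (m' := 1 + r * ‖y‖) one_le_two (mul_pos hr.1 (one_add_norm_pos y))
              (by linarith) (by nlinarith [hr.2]) (by nlinarith [hr.1])
            rw [Real.mul_rpow hr.1.le (one_add_norm_pos y).le] at h5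
            have h6 : r ^ (-a) * r ^ a = 1 := by rw [← Real.rpow_add hr.1]; simp
            calc (1 + ‖y‖) ^ a = r ^ (-a) * (r ^ a * (1 + ‖y‖) ^ a) := by
                  rw [← mul_assoc, h6, one_mul]
              _ ≤ r ^ (-a) * (2 ^ |a| * (1 + r * ‖y‖) ^ a) := by
                  have := Real.rpow_nonneg hr.1.le (-a)
                  gcongr
              _ = _ := by ring
          calc _ ≤ ((ENNReal.ofReal (2 ^ |a|) * ENNReal.ofReal (r ^ (-a))) *
              wt a (r • y)) * (ENNReal.ofReal (r ^ (s - s * p)) * V (r • y) ^ p) := by gcongr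
            _ = _ := by ring
        calc _ ≤ ∫⁻ y, (ENNReal.ofReal (r ^ (s - s * p)) * (ENNReal.ofReal (2 ^ |a|) *
              ENNReal.ofReal (r ^ (-a)))) * (wt a (r • y) * V (r • y) ^ p) := lintegral_mono hpt
          _ = (ENNReal.ofReal (r ^ (s - s * p)) * (ENNReal.ofReal (2 ^ |a|) *
              ENNReal.ofReal (r ^ (-a)))) * (ENNReal.ofReal (r ^ (-(N : ℝ))) * wInt p s V) := by
              rw [lintegral_const_mul]
              · rw [lintegral_comp_smul_eq hr.1 (measurable_wt_mul hV)]; rfl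
              · exact (measurable_wt_mul hV).comp (measurable_const_smul r)
          _ = (ENNReal.ofReal (r ^ (s - s * p)) * ENNReal.ofReal (r ^ (-a)) *
              ENNReal.ofReal (r ^ (-(N : ℝ)))) * (ENNReal.ofReal (2 ^ |a|) * wInt p s V) := by
              ring
          _ = _ := by
              rw [← ENNReal.ofReal_mul (Real.rpow_nonneg hr.1.le _), ← Real.rpow_add hr.1,
                ← ENNReal.ofReal_mul (Real.rpow_nonneg hr.1.le _), ← Real.rpow_add hr.1]
              -- The powers of r from Jensen, from the weight and from the change of variables
              -- combine to r^s, which is integrable once more.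
              have : s - s * p + -a + -(N : ℝ) = s := by rw [ha]; ring
              rw [this]
    _ = κ ^ p * (ENNReal.ofReal (2 ^ |a|) * wInt p s V) := by
        rw [lintegral_mul_const _ (hrpow s), lintegral_Ioc_rpow hs, ← mul_assoc]
        have := ENNReal.rpow_add_of_nonneg (x := κ) (p - 1) 1 (by linarith) zero_le_one
        rw [sub_add_cancel, ENNReal.rpow_one] at this
        rw [this]
    _ = _ := by
        have h1 : 0 < s + 1 := by linarith
        rw [ENNReal.ofReal_rpow_of_nonneg (by positivity) (by linarith), ← mul_assoc,
          ← ENNReal.ofReal_mul (by positivity)]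

/-- The decay exponent exceeds the dimension. Hence constants have finite norm in every space of
positive growth; this is applied at growth s + 1. -/
theorem lintegral_wt_lt_top {s : ℝ} (hs : 0 < s) (hp : 0 < p) :
    ∫⁻ x : Eu N, wt (-(s * p) - N) x < ∞ := by
  have := finite_integral_one_add_norm (E := Eu N) (μ := volume) (r := s * p + N) (by
    rw [finrank_euclideanSpace_fin]; nlinarith [mul_pos hs hp])
  unfold wt
  convert! this using 5
  ring

end Weights

/-! ### Weighted L^p bounds for the two potentials and for the ball mean -/

section Potentials

variable {N : ℕ} {p s t : ℝ} {v w : Eu N → ℝ≥0∞}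

theorem wInt_mono (hp : 0 ≤ p) (h : ∀ᵐ x, v x ≤ w x) : wInt p t v ≤ wInt p t w := by
  refine lintegral_mono_ae ?_
  filter_upwards [h] with x hx
  gcongr

theorem wInt_const_mul (hp : 0 ≤ p) (c : ℝ≥0∞) (hv : Measurable v) :
    wInt p t (fun x => c * v x) = c ^ p * wInt p t v := by
  unfold wInt
  rw [← lintegral_const_mul _ (measurable_wt_mul hv)]
  refine lintegral_congr fun x => ?_
  rw [ENNReal.mul_rpow_of_nonneg _ _ hp]
  ring

theorem wInt_const (c : ℝ≥0∞) :
    wInt p t (fun _ : Eu N => c) = c ^ p * ∫⁻ x : Eu N, wt (-(t * p) - N) x := by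
  unfold wInt
  rw [lintegral_mul_const _ measurable_wt, mul_comm]

theorem wInt_add_le (hp : 1 ≤ p) (hv : AEMeasurable v) :
    wInt p t (fun x => v x + w x) ≤ 2 ^ (p - 1) * (wInt p t v + wInt p t w) := by
  unfold wInt
  have hm : AEMeasurable (fun x => wt (-(t * p) - N) x * v x ^ p) :=
    measurable_wt.aemeasurable.mul (hv.pow_const p)
  rw [← lintegral_add_left' hm,
    ← lintegral_const_mul' _ _ (by simp)]
  refine lintegral_mono fun x => ?_
  calc _ ≤ wt (-(t * p) - N) x * (2 ^ (p - 1) * (v x ^ p + w x ^ p)) := by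
        gcongr; exact ENNReal.rpow_add_le_mul_rpow_add_rpow _ _ hp
    _ = _ := by ring

theorem wInt_mono_growth (hp : 0 ≤ p) {t' : ℝ} (h : t ≤ t') : wInt p t' v ≤ wInt p t v := by
  refine lintegral_mono fun x => ?_
  gcongr
  refine wt_mono ?_
  nlinarith

variable {η : Eu N → ℝ} {g : Eu N → Eu N}

theorem enorm_coord_le (x : Eu N) (i : Fin N) : ‖x i‖ₑ ≤ ‖x‖ₑ := by
  rw [← ofReal_norm, ← ofReal_norm]
  exact ENNReal.ofReal_le_ofReal (PiLp.norm_apply_le x i)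

theorem enorm_segPart_le (x : Eu N) :
    ‖segPart η g x‖ₑ ≤
      N * ∫⁻ z, (‖η z.2‖ₑ * ‖z.2‖ₑ) * ‖g (x + z.1 • z.2)‖ₑ ∂(homot N) := by
  unfold segPart
  calc _ ≤ ∑ i, ‖segAvg (fun y => η y * y i) (fun x => g x i) x‖ₑ := enorm_sum_le _ _
    _ ≤ ∑ _i : Fin N, ∫⁻ z, (‖η z.2‖ₑ * ‖z.2‖ₑ) * ‖g (x + z.1 • z.2)‖ₑ ∂(homot N) := by
        refine Finset.sum_le_sum fun i _ => ?_
        refine (enorm_integral_le_lintegral_enorm _).trans (lintegral_mono fun z => ?_)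
        rw [enorm_mul, enorm_mul]
        gcongr
        · exact enorm_coord_le _ _
        · exact enorm_coord_le _ _
    _ = _ := by simp

theorem enorm_conePart_le (hη : Measurable η) (hg : Measurable g) (y : Eu N) :
    ‖conePart η g y‖ₑ ≤
      N * (‖y‖ₑ * ∫⁻ r in Set.Ioc (0 : ℝ) 1, ∫⁻ x, ‖η x‖ₑ * ‖g (r • y + x)‖ₑ) := by
  unfold conePart
  calc _ ≤ ∑ i, ‖y i * coneAvg η (fun x => g x i) y‖ₑ := enorm_sum_le _ _
    _ ≤ ∑ _i : Fin N, (‖y‖ₑ *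
          ∫⁻ r in Set.Ioc (0 : ℝ) 1, ∫⁻ x, ‖η x‖ₑ * ‖g (r • y + x)‖ₑ) := by
        refine Finset.sum_le_sum fun i _ => ?_
        rw [enorm_mul]
        gcongr
        · exact enorm_coord_le _ _
        refine (enorm_integral_le_lintegral_enorm _).trans ?_
        have hm : Measurable fun z : ℝ × Eu N => ‖η z.2‖ₑ * ‖g (z.1 • y + z.2)‖ₑ := by fun_prop
        rw [← lintegral_prod _ hm.aemeasurable]
        refine lintegral_mono fun z => ?_
        rw [enorm_mul, add_comm]
        gcongr
        exact enorm_coord_le _ _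
    _ = _ := by simp

theorem lintegral_homot_snd {k : Eu N → ℝ≥0∞} (hk : Measurable k) :
    ∫⁻ z, k z.2 ∂(homot N) = ∫⁻ y, k y := by
  have hm : Measurable fun z : ℝ × Eu N => k z.2 := hk.comp measurable_snd
  rw [homot, lintegral_prod _ hm.aemeasurable]
  simp

/-- Only translations of bounded length occur in `segPart`, so it satisfies the bound already with
growth s, which is stronger than growth s + 1. -/
theorem wInt_segPart_le (hp : 1 ≤ p) (hη : Measurable η) {R : ℝ} (hR : ∀ y, η y ≠ 0 → ‖y‖ ≤ R)
    (hg : Measurable g) :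
    wInt p (s + 1) (fun x => ‖segPart η g x‖ₑ) ≤
      ((N : ℝ≥0∞) ^ p * ((∫⁻ y, ‖η y‖ₑ * ‖y‖ₑ) ^ p * ENNReal.ofReal ((1 + R) ^ |-(s * p) - N|))) *
        wInt p s (fun x => ‖g x‖ₑ) := by
  have hk : Measurable fun y : Eu N => ‖η y‖ₑ * ‖y‖ₑ := by fun_prop
  have hm : Measurable fun z : Eu N × (ℝ × Eu N) =>
      (‖η z.2.2‖ₑ * ‖z.2.2‖ₑ) * ‖g (z.1 + z.2.1 • z.2.2)‖ₑ := by fun_prop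
  calc _ ≤ wInt p s (fun x => ‖segPart η g x‖ₑ) := wInt_mono_growth (by linarith) (by linarith)
    _ ≤ wInt p s (fun x => N * ∫⁻ z, (‖η z.2‖ₑ * ‖z.2‖ₑ) * ‖g (x + z.1 • z.2)‖ₑ ∂(homot N)) :=
        wInt_mono (by linarith) (Eventually.of_forall fun x => enorm_segPart_le x)
    _ = (N : ℝ≥0∞) ^ p *
          wInt p s (fun x => ∫⁻ z, (‖η z.2‖ₑ * ‖z.2‖ₑ) * ‖g (x + z.1 • z.2)‖ₑ ∂(homot N)) :=
        wInt_const_mul (by linarith) _ hm.lintegral_prod_right'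
    _ ≤ _ := by
        rw [mul_assoc, ← lintegral_homot_snd hk]
        gcongr
        refine lintegral_wt_average_le hp (k := fun z : ℝ × Eu N => ‖η z.2‖ₑ * ‖z.2‖ₑ)
          (by fun_prop) measurable_smul_homot ?_ hg.enorm
        filter_upwards [ae_norm_smul_le hR] with z hz h
        exact hz (by simpa using left_ne_zero_of_mul h)

/-- For bounded z the average sees v only on a fixed ball, where the weight is bounded below. This
controls the averages near the origin, the region excluded from the Hardy inequality. -/
theorem average_rpow_le_wInt (hp : 1 ≤ p) (hη : Measurable η) {R M : ℝ}
    (hR : ∀ y, η y ≠ 0 → ‖y‖ ≤ R) (hM : ∀ y, ‖η y‖ ≤ M) (hv : Measurable v) {z : Eu N} {S : ℝ}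
    (hz : ‖z‖ ≤ S) :
    (∫⁻ x, ‖η x‖ₑ * v (z + x)) ^ p ≤ ((∫⁻ x, ‖η x‖ₑ) ^ (p - 1) * (ENNReal.ofReal M *
      ENNReal.ofReal ((1 + (S + R)) ^ |-(s * p) - N|))) * wInt p s v := by
  have hS0 : 0 ≤ S := (norm_nonneg z).trans hz
  have h := lintegral_mul_rpow_le (ν := volume) hp hη.enorm (v := fun x => v (z + x))
    (hv.comp (measurable_const_add z))
  refine h.trans ?_
  rw [mul_assoc]
  gcongr
  calc ∫⁻ x, ‖η x‖ₑ * v (z + x) ^ p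
      ≤ ∫⁻ x, (ENNReal.ofReal M * ENNReal.ofReal ((1 + (S + R)) ^ |-(s * p) - N|)) *
          (wt (-(s * p) - N) (z + x) * v (z + x) ^ p) := by
        refine lintegral_mono fun x => ?_
        by_cases h0 : η x = 0
        · simp [h0]
        have h1 : ‖z + x‖ ≤ S + R := (norm_add_le _ _).trans (add_le_add hz (hR x h0))
        have h2 := (wt_le_wt_of_norm_le (a := -(s * p) - N) h1).2
        have h3 : ‖η x‖ₑ ≤ ENNReal.ofReal M := by
          rw [← ofReal_norm]; exact ENNReal.ofReal_le_ofReal (hM x)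
        calc ‖η x‖ₑ * v (z + x) ^ p ≤ (ENNReal.ofReal M *
              (ENNReal.ofReal ((1 + (S + R)) ^ |-(s * p) - N|) * wt (-(s * p) - N) (z + x))) *
                v (z + x) ^ p := by
              gcongr
              calc _ = ‖η x‖ₑ * 1 := (mul_one _).symm
                _ ≤ _ := by gcongr
          _ = _ := by ring
    _ = _ := by
        have hm : Measurable fun x => wt (-(s * p) - N) (z + x) * v (z + x) ^ p :=
          (measurable_wt_mul hv).comp (measurable_const_add z)
        rw [lintegral_const_mul _ hm,
          lintegral_add_left_eq_self (fun x => wt (-(s * p) - N) x * v x ^ p) z]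
        rfl

/-- The admissible r fill an interval of length at most 1/|y|, which the factor |y| compensates. -/
theorem norm_mul_lintegral_indicator_le (y : Eu N) :
    ‖y‖ₑ * ∫⁻ r in Set.Ioc (0 : ℝ) 1, {z : Eu N | ‖z‖ ≤ 1}.indicator 1 (r • y) ≤ (1 : ℝ≥0∞) := by
  by_cases hy : y = 0
  · simp [hy]
  have hy0 : 0 < ‖y‖ := norm_pos_iff.2 hy
  have h1 : ∫⁻ r in Set.Ioc (0 : ℝ) 1, {z : Eu N | ‖z‖ ≤ 1}.indicator (1 : Eu N → ℝ≥0∞) (r • y) ≤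
      ∫⁻ r : ℝ, (Set.Ioc (0 : ℝ) (‖y‖⁻¹)).indicator 1 r := by
    rw [← lintegral_indicator measurableSet_Ioc]
    refine lintegral_mono fun r => ?_
    by_cases hr : r ∈ Set.Ioc (0 : ℝ) 1
    · rw [Set.indicator_of_mem hr]
      by_cases h2 : ‖r • y‖ ≤ 1
      · rw [norm_smul, Real.norm_of_nonneg hr.1.le] at h2
        have : r ∈ Set.Ioc (0 : ℝ) (‖y‖⁻¹) := ⟨hr.1, by
          rwa [← one_div, le_div_iff₀ hy0]⟩
        rw [Set.indicator_of_mem this]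
        exact Set.indicator_le_self' (by simp) _
      · rw [Set.indicator_of_notMem (show r • y ∉ {z : Eu N | ‖z‖ ≤ 1} from h2)]
        exact zero_le
    · rw [Set.indicator_of_notMem hr]; exact zero_le
  rw [lintegral_indicator_one measurableSet_Ioc, Real.volume_Ioc, sub_zero] at h1
  calc _ ≤ ‖y‖ₑ * ENNReal.ofReal ‖y‖⁻¹ := by gcongr
    _ = 1 := by
      rw [← ofReal_norm, ← ENNReal.ofReal_mul hy0.le, mul_inv_cancel₀ hy0.ne', ENNReal.ofReal_one]

theorem lintegral_enorm_ne_top (hη : Continuous η) (hc : HasCompactSupport η) :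
    ∫⁻ x, ‖η x‖ₑ ≠ ∞ :=
  (hη.integrable_of_hasCompactSupport hc).2.ne

/-- The potential representing a function through its gradient is bounded in weighted spaces. -/
theorem exists_wInt_conePart_le (hs : -1 < s) (hp : 1 ≤ p) (hη : Continuous η)
    (hc : HasCompactSupport η) :
    ∃ C : ℝ≥0∞, C ≠ ∞ ∧ ∀ g : Eu N → Eu N, Measurable g →
      wInt p (s + 1) (fun x => ‖conePart η g x‖ₑ) ≤ C * wInt p s (fun x => ‖g x‖ₑ) := by
  have hp0 : 0 < p := by linarith
  obtain ⟨R₀, hR₀⟩ := exists_norm_le_of_ne_zero hc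
  set R := max R₀ 0
  have hR : ∀ y, η y ≠ 0 → ‖y‖ ≤ R := fun y hy => (hR₀ y hy).trans (le_max_left _ _)
  obtain ⟨M, hM⟩ := hc.exists_bound_of_continuous hη
  set κ := ∫⁻ x, ‖η x‖ₑ with hκ
  have hκt : κ ≠ ∞ := lintegral_enorm_ne_top hη hc
  set C₁ := κ ^ (p - 1) * (ENNReal.ofReal M *
      ENNReal.ofReal ((1 + (1 + R)) ^ |-(s * p) - N|))
  have hC₁ : C₁ ≠ ∞ := by
    refine ENNReal.mul_ne_top (ENNReal.rpow_ne_top_of_nonneg (by linarith) hκt) ?_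
    exact ENNReal.mul_ne_top ENNReal.ofReal_ne_top ENNReal.ofReal_ne_top
  set J := ∫⁻ x : Eu N, wt (-((s + 1) * p) - N) x
  have hJ : J ≠ ∞ := (lintegral_wt_lt_top (by linarith) hp0).ne
  set C₂ := ENNReal.ofReal ((1 / (s + 1)) ^ p * 2 ^ |-(s * p) - N|)
  set C₃ := κ ^ p * ENNReal.ofReal ((1 + R) ^ |-(s * p) - N|)
  have hC₃ : C₃ ≠ ∞ := ENNReal.mul_ne_top (ENNReal.rpow_ne_top_of_nonneg hp0.le hκt)
    ENNReal.ofReal_ne_top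
  refine ⟨(N : ℝ≥0∞) ^ p * (2 ^ (p - 1) * (C₁ * J + C₂ * C₃)), ?_, fun g hg => ?_⟩
  · refine ENNReal.mul_ne_top (ENNReal.rpow_ne_top_of_nonneg hp0.le (by simp)) ?_
    refine ENNReal.mul_ne_top (ENNReal.rpow_ne_top_of_nonneg (by linarith) (by simp)) ?_
    exact ENNReal.add_ne_top.2 ⟨ENNReal.mul_ne_top hC₁ hJ,
      ENNReal.mul_ne_top ENNReal.ofReal_ne_top hC₃⟩
  set X := wInt p s (fun x => ‖g x‖ₑ)
  let V : Eu N → ℝ≥0∞ := fun z => ∫⁻ x, ‖η x‖ₑ * ‖g (z + x)‖ₑ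
  have hVm : Measurable V := by
    have hηm := hη.measurable
    have hm : Measurable fun z : Eu N × Eu N => ‖η z.2‖ₑ * ‖g (z.1 + z.2)‖ₑ := by fun_prop
    exact hm.lintegral_prod_right'
  let D : Set (Eu N) := {z | ‖z‖ ≤ 1}
  have hD : MeasurableSet D := measurableSet_le measurable_norm measurable_const
  let V₁ : Eu N → ℝ≥0∞ := Dᶜ.indicator V
  have hV₁m : Measurable V₁ := hVm.indicator hD.compl
  -- `d` bounds V on the unit ball; the remainder `V₁` vanishes there, as the Hardy inequality
  -- requires.
  set d := (C₁ * X) ^ (1 / p)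
  have hdp : d ^ p = C₁ * X := by
    rw [← ENNReal.rpow_mul, one_div_mul_cancel hp0.ne', ENNReal.rpow_one]
  have hVd : ∀ z, V z ≤ d * D.indicator 1 z + V₁ z := by
    intro z
    by_cases hz : z ∈ D
    · have h1 : V z ^ p ≤ C₁ * X :=
        average_rpow_le_wInt hp hη.measurable hR hM hg.enorm hz
      have h2 : V z ≤ d := by
        rw [← hdp] at h1
        exact (ENNReal.rpow_le_rpow_iff hp0).1 h1
      have h3 : D.indicator (1 : Eu N → ℝ≥0∞) z = 1 := Set.indicator_of_mem hz _
      rw [h3, mul_one]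
      exact le_add_right h2
    · have : V₁ z = V z := Set.indicator_of_mem (show z ∈ Dᶜ from hz) _
      rw [this]; exact le_add_self
  have hy : ∀ y, ‖conePart η g y‖ₑ ≤
      N * (d + ‖y‖ₑ * ∫⁻ r in Set.Ioc (0 : ℝ) 1, V₁ (r • y)) := by
    intro y
    refine (enorm_conePart_le hη.measurable hg y).trans ?_
    gcongr
    have hm2 : Measurable fun r : ℝ => D.indicator (1 : Eu N → ℝ≥0∞) (r • y) :=
      (measurable_one.indicator hD).comp (measurable_id.smul_const y)
    calc ‖y‖ₑ * ∫⁻ r in Set.Ioc (0 : ℝ) 1, V (r • y)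
        ≤ ‖y‖ₑ * ∫⁻ r in Set.Ioc (0 : ℝ) 1, (d * D.indicator 1 (r • y) + V₁ (r • y)) := by
          gcongr; exact hVd _
      _ = d * (‖y‖ₑ * ∫⁻ r in Set.Ioc (0 : ℝ) 1, D.indicator 1 (r • y)) +
            ‖y‖ₑ * ∫⁻ r in Set.Ioc (0 : ℝ) 1, V₁ (r • y) := by
          rw [lintegral_add_left (hm2.const_mul d), lintegral_const_mul _ hm2]
          ring
      _ ≤ d * 1 + _ := by gcongr; exact norm_mul_lintegral_indicator_le y
      _ = _ := by rw [mul_one]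
  have hV₁r : Measurable fun y : Eu N => ∫⁻ r in Set.Ioc (0 : ℝ) 1, V₁ (r • y) := by
    have hm : Measurable fun z : Eu N × ℝ => V₁ (z.2 • z.1) :=
      hV₁m.comp (measurable_snd.smul measurable_fst)
    exact hm.lintegral_prod_right'
  calc wInt p (s + 1) (fun x => ‖conePart η g x‖ₑ)
      ≤ wInt p (s + 1) (fun y => N * (d + ‖y‖ₑ * ∫⁻ r in Set.Ioc (0 : ℝ) 1, V₁ (r • y))) :=
        wInt_mono hp0.le (Eventually.of_forall hy)
    _ = (N : ℝ≥0∞) ^ p *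
          wInt p (s + 1) (fun y => d + ‖y‖ₑ * ∫⁻ r in Set.Ioc (0 : ℝ) 1, V₁ (r • y)) :=
        wInt_const_mul hp0.le _ (by fun_prop)
    _ ≤ (N : ℝ≥0∞) ^ p * (2 ^ (p - 1) * (wInt p (s + 1) (fun _ : Eu N => d) +
          wInt p (s + 1) (fun y => ‖y‖ₑ * ∫⁻ r in Set.Ioc (0 : ℝ) 1, V₁ (r • y)))) := by
        gcongr
        exact wInt_add_le hp aemeasurable_const
    _ ≤ (N : ℝ≥0∞) ^ p * (2 ^ (p - 1) * (C₁ * X * J + C₂ * (C₃ * X))) := by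
        gcongr (N : ℝ≥0∞) ^ p * (2 ^ (p - 1) * (?_ + ?_))
        · rw [wInt_const, hdp]
        · calc wInt p (s + 1) (fun y => ‖y‖ₑ * ∫⁻ r in Set.Ioc (0 : ℝ) 1, V₁ (r • y))
              ≤ ∫⁻ y, wt (-(s * p) - N) y * (∫⁻ r in Set.Ioc (0 : ℝ) 1, V₁ (r • y)) ^ p := by
                refine lintegral_mono fun y => ?_
                rw [ENNReal.mul_rpow_of_nonneg _ _ hp0.le, ← mul_assoc]
                gcongr
                -- The factor |y|^p ≤ (1 + |y|)^p lowers the growth index from s + 1 to s.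
                calc _ ≤ wt (-((s + 1) * p) - N) y * wt (1 : ℝ) y ^ p := by
                      gcongr; exact enorm_le_wt_one
                  _ = _ := by rw [wt_rpow hp0.le, ← wt_add]; congr 1; ring
            _ ≤ C₂ * wInt p s V₁ := lintegral_ray_average_le hs hp hV₁m fun z hz =>
                Set.indicator_of_notMem (fun h : z ∈ Dᶜ => h hz) _
            _ ≤ C₂ * (C₃ * X) := by
                gcongr
                calc wInt p s V₁ ≤ wInt p s V := wInt_mono hp0.le
                      (Eventually.of_forall fun z => Set.indicator_le_self _ _ z)
                  _ ≤ _ := lintegral_wt_average_le (ν := volume) (τ := fun x => x) hp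
                      hη.measurable.enorm measurable_id
                      (Eventually.of_forall fun y hy => hR y (by simpa using hy)) hg.enorm
    _ = _ := by ring

theorem exists_wInt_segPart_le (hp : 1 ≤ p) (hη : Continuous η) (hc : HasCompactSupport η) :
    ∃ C : ℝ≥0∞, C ≠ ∞ ∧ ∀ g : Eu N → Eu N, Measurable g →
      wInt p (s + 1) (fun x => ‖segPart η g x‖ₑ) ≤ C * wInt p s (fun x => ‖g x‖ₑ) := by
  obtain ⟨R, hR⟩ := exists_norm_le_of_ne_zero hc
  refine ⟨_, ?_, fun g hg => wInt_segPart_le hp hη.measurable hR hg⟩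
  refine ENNReal.mul_ne_top (ENNReal.rpow_ne_top_of_nonneg (by linarith) (by simp)) ?_
  refine ENNReal.mul_ne_top (ENNReal.rpow_ne_top_of_nonneg (by linarith) ?_)
    ENNReal.ofReal_ne_top
  have := lintegral_enorm_ne_top (hη.mul continuous_norm) hc.mul_right
  convert this using 4 with y
  rw [Pi.mul_apply, enorm_mul, enorm_norm]

/-- Replacing a constant by the mean over a ball does not increase weighted norms by more than a
fixed factor. -/
theorem exists_wInt_sub_ballMean_le (ht : 0 < t) (hp : 1 ≤ p) {ρ : ℝ} (hρ : 0 < ρ) :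
    ∃ C : ℝ≥0∞, C ≠ ∞ ∧ ∀ f : Eu N → ℝ, LocallyIntegrable f volume → ∀ c : ℝ,
      wInt p t (fun x => ‖f x - ballMean ρ f‖ₑ) ≤ C * wInt p t (fun x => ‖f x - c‖ₑ) := by
  have hp0 : 0 < p := by linarith
  set B := Metric.ball (0 : Eu N) ρ
  set m := volume.real B
  have hm0 : 0 < m := by
    refine ENNReal.toReal_pos (Metric.measure_ball_pos volume _ hρ).ne' measure_ball_lt_top.ne
  have hBm : volume B = ENNReal.ofReal m :=
    (ENNReal.ofReal_toReal measure_ball_lt_top.ne).symm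
  set J := ∫⁻ x : Eu N, wt (-(t * p) - N) x
  have hJ : J ≠ ∞ := (lintegral_wt_lt_top ht hp0).ne
  set K := ENNReal.ofReal ((1 + ρ) ^ |-(t * p) - N|)
  set A := ENNReal.ofReal m⁻¹ ^ p * (ENNReal.ofReal m ^ (p - 1) * K)
  have hA : A ≠ ∞ := ENNReal.mul_ne_top
    (ENNReal.rpow_ne_top_of_nonneg hp0.le ENNReal.ofReal_ne_top) (ENNReal.mul_ne_top
    (ENNReal.rpow_ne_top_of_nonneg (by linarith) ENNReal.ofReal_ne_top) ENNReal.ofReal_ne_top)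
  refine ⟨2 ^ (p - 1) * (1 + A * J), ENNReal.mul_ne_top
    (ENNReal.rpow_ne_top_of_nonneg (by linarith) (by simp))
    (ENNReal.add_ne_top.2 ⟨by simp, ENNReal.mul_ne_top hA hJ⟩), fun f hf c => ?_⟩
  set X := wInt p t (fun x => ‖f x - c‖ₑ)
  have hfB : IntegrableOn f B :=
    (hf.integrableOn_isCompact (isCompact_closedBall (0 : Eu N) ρ)).mono_set
      Metric.ball_subset_closedBall
  -- The difference is the mean of c - f over the ball, where the weight is bounded below; Jensen
  -- bounds it by the weighted integral of f - c.
  have hc : ‖c - ballMean ρ f‖ₑ ^ p ≤ A * X := by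
    have h1 : c - ballMean ρ f = m⁻¹ * ∫ x in B, (c - f x) := by
      have hcB : IntegrableOn (fun _ : Eu N => c) B := integrableOn_const measure_ball_lt_top.ne
      rw [integral_sub hcB hfB, setIntegral_const, mul_sub,
        smul_eq_mul, ← mul_assoc, inv_mul_cancel₀ hm0.ne', one_mul]
      rfl
    have h2 : (∫⁻ x in B, ‖f x - c‖ₑ) ^ p ≤ ENNReal.ofReal m ^ (p - 1) *
        ∫⁻ x in B, ‖f x - c‖ₑ ^ p := by
      obtain ⟨f', hf', hff⟩ := hf.aestronglyMeasurable
      have h3 := lintegral_rpow_le (ν := volume.restrict B) hp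
        (v := fun x => ‖f' x - c‖ₑ) (hf'.measurable.sub_const c).enorm
      rw [Measure.restrict_apply_univ, hBm] at h3
      have hff' := ae_restrict_of_ae (s := B) hff
      have e1 : ∫⁻ x in B, ‖f x - c‖ₑ = ∫⁻ x in B, ‖f' x - c‖ₑ :=
        lintegral_congr_ae (by filter_upwards [hff'] with x hx; rw [hx])
      have e2 : ∫⁻ x in B, ‖f x - c‖ₑ ^ p = ∫⁻ x in B, ‖f' x - c‖ₑ ^ p :=
        lintegral_congr_ae (by filter_upwards [hff'] with x hx; rw [hx])
      rwa [e1, e2]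
    have h4 : ∫⁻ x in B, ‖f x - c‖ₑ ^ p ≤ K * X := by
      have hK : K ≠ ∞ := ENNReal.ofReal_ne_top
      change _ ≤ K * ∫⁻ x, wt (-(t * p) - N) x * ‖f x - c‖ₑ ^ p
      rw [← lintegral_const_mul' _ _ hK]
      refine (setLIntegral_mono' measurableSet_ball fun x hx => ?_).trans
        (setLIntegral_le_lintegral _ _)
      have hx' : ‖x‖ ≤ ρ := (mem_ball_zero_iff.1 hx).le
      have h5 := (wt_le_wt_of_norm_le (a := -(t * p) - N) hx').2
      calc ‖f x - c‖ₑ ^ p = 1 * ‖f x - c‖ₑ ^ p := (one_mul _).symm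
        _ ≤ (K * wt (-(t * p) - N) x) * ‖f x - c‖ₑ ^ p := by gcongr
        _ = _ := by ring
    rw [h1, enorm_mul, ENNReal.mul_rpow_of_nonneg _ _ hp0.le]
    have h6 : ‖m⁻¹‖ₑ = ENNReal.ofReal m⁻¹ := Real.enorm_of_nonneg (by positivity)
    have h7 : ‖∫ x in B, (c - f x)‖ₑ ≤ ∫⁻ x in B, ‖f x - c‖ₑ := by
      refine (enorm_integral_le_lintegral_enorm _).trans (le_of_eq ?_)
      exact lintegral_congr fun x => enorm_sub_rev _ _
    rw [h6]
    calc _ ≤ ENNReal.ofReal m⁻¹ ^ p * (ENNReal.ofReal m ^ (p - 1) * (K * X)) := by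
          gcongr
          calc _ ≤ (∫⁻ x in B, ‖f x - c‖ₑ) ^ p := by gcongr
            _ ≤ _ := h2.trans (by gcongr)
      _ = A * X := by ring
  calc wInt p t (fun x => ‖f x - ballMean ρ f‖ₑ)
      ≤ wInt p t (fun x => ‖f x - c‖ₑ + ‖c - ballMean ρ f‖ₑ) := by
        refine wInt_mono hp0.le (Eventually.of_forall fun x => ?_)
        calc ‖f x - ballMean ρ f‖ₑ = ‖(f x - c) + (c - ballMean ρ f)‖ₑ := by congr 1; ring
          _ ≤ _ := enorm_add_le _ _
    _ ≤ 2 ^ (p - 1) * (X + wInt p t (fun _ : Eu N => ‖c - ballMean ρ f‖ₑ)) :=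
        wInt_add_le hp (hf.aestronglyMeasurable.sub aestronglyMeasurable_const).enorm
    _ ≤ 2 ^ (p - 1) * (X + A * X * J) := by
        rw [wInt_const]; gcongr
    _ = _ := by ring

end Potentials

/-! ### Smooth dyadic shells -/

section Shells

variable {N : ℕ}

/-- The Japanese bracket `√(1 + |x|²)`. -/
noncomputable def bracket (x : Eu N) : ℝ := √(1 + ‖x‖ ^ 2)

theorem one_le_bracket (x : Eu N) : 1 ≤ bracket x := by
  rw [bracket, Real.one_le_sqrt]; nlinarith [norm_nonneg x]

theorem bracket_le (x : Eu N) : bracket x ≤ 1 + ‖x‖ := by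
  rw [bracket, Real.sqrt_le_left (by positivity)]; nlinarith [norm_nonneg x]

theorem norm_le_bracket (x : Eu N) : ‖x‖ ≤ bracket x :=
  Real.le_sqrt_of_sq_le (by linarith)

theorem le_two_bracket (x : Eu N) : 1 + ‖x‖ ≤ 2 * bracket x := by
  linarith [one_le_bracket x, norm_le_bracket x]

theorem contDiff_bracket {n : WithTop ℕ∞} : ContDiff ℝ n (bracket : Eu N → ℝ) := by
  refine ContDiff.sqrt (contDiff_const.add (contDiff_norm_sq ℝ)) fun x => ?_
  positivity

/-- The bracket is the Euclidean norm of (1, x), hence 1-Lipschitz. -/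
theorem norm_fderiv_bracket_le (x : Eu N) : ‖fderiv ℝ bracket x‖ ≤ 1 := by
  refine norm_fderiv_le_of_lipschitz ℝ (C := 1) (LipschitzWith.of_dist_le_mul fun x y => ?_)
  have key : ∀ x y : Eu N, bracket x ≤ bracket y + ‖x - y‖ := by
    intro x y
    have hb : 0 ≤ bracket y := by linarith [one_le_bracket y]
    rw [bracket, Real.sqrt_le_left (by positivity)]
    have h1 : bracket y ^ 2 = 1 + ‖y‖ ^ 2 := Real.sq_sqrt (by positivity)
    have h2 : ‖x‖ ≤ ‖y‖ + ‖x - y‖ := by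
      simpa using norm_add_le y (x - y)
    have h3 := norm_le_bracket y
    nlinarith [norm_nonneg x, norm_nonneg (x - y), norm_nonneg y,
      mul_le_mul_of_nonneg_right h3 (norm_nonneg (x - y)),
      mul_self_le_mul_self (norm_nonneg x) h2]
  rw [NNReal.coe_one, one_mul, Real.dist_eq, dist_eq_norm, abs_le]
  constructor
  · have := key y x; rw [norm_sub_rev] at this; linarith
  · have := key x y; linarith

/-- A smooth bump on the line, equal to `1` on `[1, 2]` and supported in `[1/2, 5/2]`. -/
noncomputable def shellBump : ContDiffBump (3 / 2 : ℝ) where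
  rIn := 1 / 2
  rOut := 1
  rIn_pos := by norm_num
  rIn_lt_rOut := by norm_num

/-- A smooth cutoff to the dyadic shell of order `k`. -/
noncomputable def shellCutoff (k : ℕ) (x : Eu N) : ℝ := shellBump (bracket x / 2 ^ k)

/-- The enlarged dyadic shell of order `k`. -/
def shell (N k : ℕ) : Set (Eu N) := {x | 2 ^ k / 2 ≤ bracket x ∧ bracket x ≤ 4 * 2 ^ k}

/-- The dyadic shell of order `k`. -/
def innerShell (N k : ℕ) : Set (Eu N) := {x | 2 ^ k ≤ bracket x ∧ bracket x ≤ 2 * 2 ^ k}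

theorem measurable_bracket : Measurable (bracket : Eu N → ℝ) :=
  (contDiff_bracket (n := 0)).continuous.measurable

theorem measurableSet_shell (k : ℕ) : MeasurableSet (shell N k) :=
  (measurableSet_le measurable_const measurable_bracket).inter
    (measurableSet_le measurable_bracket measurable_const)

theorem measurableSet_innerShell (k : ℕ) : MeasurableSet (innerShell N k) :=
  (measurableSet_le measurable_const measurable_bracket).inter
    (measurableSet_le measurable_bracket measurable_const)

theorem iUnion_innerShell : ⋃ k, innerShell N k = Set.univ := by
  rw [Set.eq_univ_iff_forall]
  intro x
  obtain ⟨k, h1, h2⟩ := exists_nat_pow_near (one_le_bracket x) one_lt_two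
  exact Set.mem_iUnion.2 ⟨k, h1, by rw [pow_succ] at h2; linarith⟩

theorem innerShell_subset_shell (k : ℕ) : innerShell N k ⊆ shell N k := by
  rintro x ⟨h1, h2⟩
  have : (0 : ℝ) < 2 ^ k := by positivity
  exact ⟨by linarith, by linarith⟩

theorem contDiff_shellCutoff (k : ℕ) : ContDiff ℝ 1 (shellCutoff k : Eu N → ℝ) :=
  shellBump.contDiff.comp (contDiff_bracket.div_const _)

theorem shellCutoff_le_one (k : ℕ) (x : Eu N) : ‖shellCutoff k x‖ ≤ 1 := by
  change ‖shellBump _‖ ≤ 1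
  rw [Real.norm_of_nonneg shellBump.nonneg]
  exact shellBump.le_one

theorem shellCutoff_eq_one {k : ℕ} {x : Eu N} (hx : x ∈ innerShell N k) :
    shellCutoff k x = 1 := by
  refine shellBump.one_of_mem_closedBall ?_
  obtain ⟨h1, h2⟩ := hx
  have h0 : (0 : ℝ) < 2 ^ k := by positivity
  have h3 : 1 ≤ bracket x / 2 ^ k := by rwa [one_le_div h0]
  have h4 : bracket x / 2 ^ k ≤ 2 := by rwa [div_le_iff₀ h0]
  change dist _ _ ≤ (1 / 2 : ℝ)
  rw [Real.dist_eq, abs_le]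
  constructor <;> linarith

theorem notMem_tsupport_shellBump {k : ℕ} {x : Eu N} (hx : x ∉ shell N k) :
    bracket x / 2 ^ k ∉ tsupport shellBump := by
  rw [shellBump.tsupport_eq]
  intro h
  change dist _ _ ≤ (1 : ℝ) at h
  rw [Real.dist_eq, abs_le] at h
  have h0 : (0 : ℝ) < 2 ^ k := by positivity
  refine hx ⟨?_, ?_⟩
  · have : 1 / 2 ≤ bracket x / 2 ^ k := by linarith [h.1]
    rw [le_div_iff₀ h0] at this; linarith
  · have : bracket x / 2 ^ k ≤ 4 := by linarith [h.2]
    rwa [div_le_iff₀ h0] at this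

theorem shellCutoff_eq_zero {k : ℕ} {x : Eu N} (hx : x ∉ shell N k) : shellCutoff k x = 0 :=
  image_eq_zero_of_notMem_tsupport (f := shellBump) (notMem_tsupport_shellBump hx)

theorem fderiv_shellCutoff (k : ℕ) (x : Eu N) : fderiv ℝ (shellCutoff k) x =
    (deriv shellBump (bracket x / 2 ^ k) * (2 ^ k)⁻¹) • fderiv ℝ bracket x := by
  have h1 : HasDerivAt shellBump (deriv shellBump (bracket x / 2 ^ k)) (bracket x / 2 ^ k) :=
    ((shellBump.contDiff (n := 1)).differentiable one_ne_zero _).hasDerivAt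
  have h2 : HasFDerivAt (fun x : Eu N => bracket x / 2 ^ k)
      (((2 : ℝ) ^ k)⁻¹ • fderiv ℝ bracket x) x := by
    have h3 : HasFDerivAt (bracket : Eu N → ℝ) (fderiv ℝ bracket x) x :=
      ((contDiff_bracket (n := 1)).differentiable one_ne_zero x).hasFDerivAt
    simpa [div_eq_mul_inv, mul_comm] using h3.const_mul ((2 : ℝ) ^ k)⁻¹
  rw [mul_smul]
  exact (h1.comp_hasFDerivAt x h2).fderiv

theorem fderiv_shellCutoff_eq_zero {k : ℕ} {x : Eu N} (hx : x ∉ shell N k) :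
    fderiv ℝ (shellCutoff k) x = 0 := by
  have : deriv shellBump (bracket x / 2 ^ k) = 0 := by
    by_contra h
    exact notMem_tsupport_shellBump hx (support_deriv_subset h)
  rw [fderiv_shellCutoff, this]; simp

/-- All cutoffs are rescalings of one bump, so M is the bound for its derivative and the rescaling
contributes 2^(-k). -/
theorem exists_norm_fderiv_shellCutoff_le (N : ℕ) :
    ∃ M : ℝ, ∀ (k : ℕ) (x : Eu N), ‖fderiv ℝ (shellCutoff k) x‖ ≤ M * (2 ^ k)⁻¹ := by
  have h1 : Continuous (deriv shellBump) :=
    (shellBump.contDiff (n := 1)).continuous_deriv le_rfl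
  obtain ⟨M, hM⟩ := (shellBump.hasCompactSupport.deriv).exists_bound_of_continuous h1
  refine ⟨M, fun k x => ?_⟩
  rw [fderiv_shellCutoff, norm_smul, norm_mul, norm_inv, Real.norm_of_nonneg
    (show (0 : ℝ) ≤ 2 ^ k by positivity)]
  have h2 := norm_fderiv_bracket_le x
  have h3 := hM (bracket x / 2 ^ k)
  have h4 : (0 : ℝ) ≤ (2 ^ k)⁻¹ := by positivity
  calc _ ≤ M * (2 ^ k)⁻¹ * 1 := by
        gcongr
        exact mul_nonneg ((norm_nonneg _).trans h3) h4
    _ = _ := mul_one _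

theorem shell_subset_closedBall (k : ℕ) :
    shell N k ⊆ Metric.closedBall (0 : Eu N) (4 * 2 ^ k) := fun x hx => by
  rw [mem_closedBall_zero_iff]; exact (norm_le_bracket x).trans hx.2

theorem hasCompactSupport_shellCutoff (k : ℕ) :
    HasCompactSupport (shellCutoff k : Eu N → ℝ) :=
  HasCompactSupport.intro (isCompact_closedBall (0 : Eu N) (4 * 2 ^ k)) fun _ hx =>
    shellCutoff_eq_zero fun h => hx (shell_subset_closedBall k h)

/-- The scale `2^k` of the shell of order `k`. -/
noncomputable def shellScale (k : ℕ) : ℝ≥0∞ := ENNReal.ofReal (2 ^ k)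

theorem shellScale_ne_zero (k : ℕ) : shellScale k ≠ 0 := by
  simp [shellScale]

theorem shellScale_ne_top (k : ℕ) : shellScale k ≠ ∞ := ENNReal.ofReal_ne_top

/-- On the shell, 2^k/2 ≤ ⟨x⟩ ≤ 4·2^k, while ⟨x⟩ ≤ 1 + |x| ≤ 2⟨x⟩; so 1 + |x| equals 2^k up to the
factor 8. -/
theorem wt_shell {a : ℝ} {k : ℕ} {x : Eu N} (hx : x ∈ shell N k) :
    wt a x ≤ ENNReal.ofReal (8 ^ |a|) * shellScale k ^ a ∧
      shellScale k ^ a ≤ ENNReal.ofReal (8 ^ |a|) * wt a x := by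
  obtain ⟨h1, h2⟩ := hx
  have h0 : (0 : ℝ) < 2 ^ k := by positivity
  have h3 := bracket_le x
  have h4 := le_two_bracket x
  unfold shellScale wt
  rw [ENNReal.ofReal_rpow_of_pos h0, ← ENNReal.ofReal_mul (by positivity),
    ← ENNReal.ofReal_mul (by positivity)]
  constructor
  · exact ENNReal.ofReal_le_ofReal (rpow_le_rpow_abs (by norm_num) (one_add_norm_pos x) h0
      (by linarith) (by linarith))
  · exact ENNReal.ofReal_le_ofReal (rpow_le_rpow_abs (by norm_num) h0 (one_add_norm_pos x)
      (by linarith) (by linarith))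

theorem exists_volume_shell_le (N : ℕ) : ∃ c : ℝ≥0∞, c ≠ ∞ ∧ ∀ k,
    volume (shell N k) ≤ c * shellScale k ^ (N : ℝ) := by
  refine ⟨ENNReal.ofReal (4 ^ N) * volume (Metric.ball (0 : Eu N) 1),
    ENNReal.mul_ne_top ENNReal.ofReal_ne_top measure_ball_lt_top.ne, fun k => ?_⟩
  refine (measure_mono (shell_subset_closedBall k)).trans (le_of_eq ?_)
  rw [Measure.addHaar_closedBall _ _ (by positivity), finrank_euclideanSpace_fin, mul_pow,
    ENNReal.ofReal_mul (by positivity), shellScale, ENNReal.rpow_natCast,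
    ENNReal.ofReal_pow (show (0 : ℝ) ≤ 2 ^ k by positivity)]
  ring

/-- If 2^j ≤ ⟨x⟩ < 2^(j+1), only the shells of orders j - 2 to j + 1 can contain x. Truncation of j
- 2 at zero only shortens this list. -/
theorem tsum_indicator_shell_le (x : Eu N) :
    ∑' k, (shell N k).indicator (1 : Eu N → ℝ≥0∞) x ≤ 4 := by
  obtain ⟨j, h1, h2⟩ := exists_nat_pow_near (one_le_bracket x) one_lt_two
  rw [tsum_eq_sum (s := Finset.Icc (j - 2) (j + 1))]
  · have hle : ∀ k, (shell N k).indicator (1 : Eu N → ℝ≥0∞) x ≤ 1 := fun k => by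
      by_cases hx : x ∈ shell N k <;> simp [hx]
    calc ∑ k ∈ Finset.Icc (j - 2) (j + 1), (shell N k).indicator (1 : Eu N → ℝ≥0∞) x
        ≤ ∑ _k ∈ Finset.Icc (j - 2) (j + 1), (1 : ℝ≥0∞) := Finset.sum_le_sum fun k _ => hle k
      _ ≤ 4 := by
          simp only [Finset.sum_const, Nat.card_Icc, nsmul_eq_mul, mul_one]
          have : j + 1 + 1 - (j - 2) ≤ 4 := by omega
          exact_mod_cast this
  · intro k hk
    refine Set.indicator_of_notMem (fun hx => hk ?_) _
    rw [Finset.mem_Icc]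
    have h3 : (2 : ℝ) ^ k < 2 ^ (j + 2) := by
      have := hx.1; rw [pow_add] at h2 ⊢; linarith
    have h4 : (2 : ℝ) ^ j ≤ 2 ^ (k + 2) := by
      have := hx.2; rw [pow_add]; linarith
    have h5 := (pow_lt_pow_iff_right₀ (one_lt_two (α := ℝ))).1 h3
    have h6 := (pow_le_pow_iff_right₀ (one_lt_two (α := ℝ))).1 h4
    omega

theorem tsum_setLIntegral_shell_le {F : Eu N → ℝ≥0∞} (hF : Measurable F) :
    ∑' k, ∫⁻ x in shell N k, F x ≤ 4 * ∫⁻ x, F x := by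
  calc ∑' k, ∫⁻ x in shell N k, F x
      = ∑' k, ∫⁻ x, (shell N k).indicator 1 x * F x := by
        refine tsum_congr fun k => ?_
        rw [← lintegral_indicator (measurableSet_shell k)]
        refine lintegral_congr fun x => ?_
        by_cases hx : x ∈ shell N k <;> simp [hx]
    _ = ∫⁻ x, (∑' k, (shell N k).indicator 1 x) * F x := by
        have hm : ∀ k, AEMeasurable fun x => (shell N k).indicator (1 : Eu N → ℝ≥0∞) x * F x :=
          fun k => ((measurable_one.indicator (measurableSet_shell k)).mul hF).aemeasurable
        rw [← lintegral_tsum hm]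
        simp_rw [ENNReal.tsum_mul_right]
    _ ≤ ∫⁻ x, 4 * F x := lintegral_mono fun x => by gcongr; exact tsum_indicator_shell_le x
    _ = _ := lintegral_const_mul _ hF

end Shells

/-- The embedding ℓ¹ ⊂ ℓ^q: each term is at most the total sum. It lets the shell inequalities be
added when the target exponent is at least p. -/
theorem tsum_rpow_le {q : ℝ} (hq : 1 ≤ q) (a : ℕ → ℝ≥0∞) : ∑' k, a k ^ q ≤ (∑' k, a k) ^ q := by
  have e : ∀ b : ℝ≥0∞, b ^ q = b ^ (q - 1) * b := fun b => by
    have := ENNReal.rpow_add_of_nonneg (x := b) (q - 1) 1 (by linarith) zero_le_one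
    simpa using this
  calc ∑' k, a k ^ q ≤ ∑' k, (∑' k, a k) ^ (q - 1) * a k := by
        refine ENNReal.tsum_le_tsum fun k => ?_
        rw [e]
        exact mul_le_mul' (ENNReal.rpow_le_rpow (ENNReal.le_tsum k) (by linarith)) le_rfl
    _ = _ := by rw [ENNReal.tsum_mul_left, ← e]

theorem eLpNorm_ofReal {α F : Type*} [MeasurableSpace α] [NormedAddCommGroup F] {μ : Measure α}
    {q : ℝ} (hq : 0 < q) (f : α → F) :
    eLpNorm f (ENNReal.ofReal q) μ = (∫⁻ x, ‖f x‖ₑ ^ q ∂μ) ^ (1 / q) := by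
  rw [eLpNorm_eq_lintegral_rpow_enorm_toReal (by simpa using hq) ENNReal.ofReal_ne_top,
    ENNReal.toReal_ofReal hq.le]

/-! ### Weighted Sobolev inequality for C¹ functions -/

section Sobolev

variable {N : ℕ} {p q r s : ℝ}

theorem enorm_fderiv_shellCutoff_mul_le {M : ℝ} (hM : ∀ (k : ℕ) (x : Eu N),
    ‖fderiv ℝ (shellCutoff k) x‖ ≤ M * (2 ^ k)⁻¹) {h : Eu N → ℝ} (hh : ContDiff ℝ 1 h) (k : ℕ)
    (x : Eu N) : ‖fderiv ℝ (fun x => shellCutoff k x * h x) x‖ₑ ≤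
      ‖fderiv ℝ h x‖ₑ + ENNReal.ofReal M * (shellScale k ^ (-1 : ℝ) * ‖h x‖ₑ) := by
  have h1 := ((contDiff_shellCutoff (N := N) k).differentiable one_ne_zero x)
  have h2 := hh.differentiable one_ne_zero x
  have h0 : (0 : ℝ) < 2 ^ k := by positivity
  rw [fderiv_fun_mul h1 h2]
  refine (enorm_add_le (shellCutoff k x • fderiv ℝ h x) _).trans ?_
  rw [enorm_smul, enorm_smul]
  have h3 : ‖shellCutoff k x‖ₑ ≤ 1 := by
    rw [← ofReal_norm, ← ENNReal.ofReal_one]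
    exact ENNReal.ofReal_le_ofReal (shellCutoff_le_one k x)
  have h4 : ‖fderiv ℝ (shellCutoff k) x‖ₑ ≤ ENNReal.ofReal M * shellScale k ^ (-1 : ℝ) := by
    rw [shellScale, ENNReal.ofReal_rpow_of_pos h0, Real.rpow_neg_one, ← ENNReal.ofReal_mul'
      (by positivity), ← ofReal_norm]
    exact ENNReal.ofReal_le_ofReal (hM k x)
  calc _ ≤ 1 * ‖fderiv ℝ h x‖ₑ + ‖h x‖ₑ * (ENNReal.ofReal M * shellScale k ^ (-1 : ℝ)) := by
        gcongr
    _ = _ := by ring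

/-- The local energy on a dyadic shell. -/
noncomputable def shellEnergy (p s : ℝ) (v w : Eu N → ℝ≥0∞) (k : ℕ) : ℝ≥0∞ :=
  ∫⁻ x in shell N k, (wt (-(s * p) - N) x * v x ^ p + wt (-((s + 1) * p) - N) x * w x ^ p)

/-- On the shell, 2^(k(sp+N)) times the weight of the gradient is comparable to 1, and times the
weight of h to 2^(-kp). These are the sizes of the two terms in the product rule for the cut-off
function. -/
theorem exists_setLIntegral_shell_le (N : ℕ) (s : ℝ) (hp : 1 ≤ p) :
    ∃ D : ℝ≥0∞, D ≠ ∞ ∧ ∀ (h : Eu N → ℝ), ContDiff ℝ 1 h → ∀ k,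
      ∫⁻ x in shell N k, ‖fderiv ℝ (fun x => shellCutoff k x * h x) x‖ₑ ^ p ≤
        D * (shellScale k ^ (s * p + N) *
          shellEnergy p s (fun x => ‖fderiv ℝ h x‖ₑ) (fun x => ‖h x‖ₑ) k) := by
  have hp0 : 0 < p := by linarith
  obtain ⟨M, hM⟩ := exists_norm_fderiv_shellCutoff_le N
  set c₁ := ENNReal.ofReal (8 ^ |-(s * p) - (N : ℝ)|)
  set c₂ := ENNReal.ofReal M ^ p * ENNReal.ofReal (8 ^ |-((s + 1) * p) - (N : ℝ)|)
  have hc₁ : c₁ ≠ ∞ := ENNReal.ofReal_ne_top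
  have hc₂ : c₂ ≠ ∞ := ENNReal.mul_ne_top
    (ENNReal.rpow_ne_top_of_nonneg hp0.le ENNReal.ofReal_ne_top) ENNReal.ofReal_ne_top
  have h2 : (2 : ℝ≥0∞) ^ (p - 1) ≠ ∞ := ENNReal.rpow_ne_top_of_nonneg (by linarith) (by simp)
  refine ⟨2 ^ (p - 1) * (c₁ + c₂), ENNReal.mul_ne_top h2 (ENNReal.add_ne_top.2 ⟨hc₁, hc₂⟩),
    fun h hh k => ?_⟩
  set L := shellScale k
  have hL0 : L ≠ 0 := shellScale_ne_zero k
  have hLt : L ≠ ∞ := shellScale_ne_top k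
  have hLp : L ^ (s * p + N) ≠ ∞ := ENNReal.rpow_ne_top_of_ne_zero hL0 hLt
  unfold shellEnergy
  rw [← mul_assoc, ← lintegral_const_mul' _ _ (ENNReal.mul_ne_top
    (ENNReal.mul_ne_top h2 (ENNReal.add_ne_top.2 ⟨hc₁, hc₂⟩)) hLp)]
  refine setLIntegral_mono' (measurableSet_shell k) fun x hx => ?_
  set v := ‖fderiv ℝ h x‖ₑ
  set w := ‖h x‖ₑ
  have b1 : (1 : ℝ≥0∞) ≤ L ^ (s * p + N) * (c₁ * wt (-(s * p) - N) x) := by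
    have h3 := (wt_shell (a := -(s * p) - N) hx).2
    calc (1 : ℝ≥0∞) = L ^ (s * p + N) * L ^ (-(s * p) - N) := by
          rw [← ENNReal.rpow_add _ _ hL0 hLt]; ring_nf; simp
      _ ≤ _ := by gcongr
  have b2 : ENNReal.ofReal M ^ p * (L ^ (-1 : ℝ)) ^ p ≤
      L ^ (s * p + N) * (c₂ * wt (-((s + 1) * p) - N) x) := by
    have h3 := (wt_shell (a := -((s + 1) * p) - N) hx).2
    calc ENNReal.ofReal M ^ p * (L ^ (-1 : ℝ)) ^ p =
          ENNReal.ofReal M ^ p * (L ^ (s * p + N) * L ^ (-((s + 1) * p) - N)) := by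
          rw [← ENNReal.rpow_add _ _ hL0 hLt, ← ENNReal.rpow_mul]; ring_nf
      _ ≤ ENNReal.ofReal M ^ p * (L ^ (s * p + N) *
          (ENNReal.ofReal (8 ^ |-((s + 1) * p) - (N : ℝ)|) * wt (-((s + 1) * p) - N) x)) := by
          gcongr
      _ = _ := by ring
  calc ‖fderiv ℝ (fun x => shellCutoff k x * h x) x‖ₑ ^ p
      ≤ (v + ENNReal.ofReal M * (L ^ (-1 : ℝ) * w)) ^ p := by
        gcongr; exact enorm_fderiv_shellCutoff_mul_le hM hh k x
    _ ≤ 2 ^ (p - 1) * (v ^ p + (ENNReal.ofReal M * (L ^ (-1 : ℝ) * w)) ^ p) :=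
        ENNReal.rpow_add_le_mul_rpow_add_rpow _ _ hp
    _ = 2 ^ (p - 1) * (1 * v ^ p + (ENNReal.ofReal M ^ p * (L ^ (-1 : ℝ)) ^ p) * w ^ p) := by
        rw [ENNReal.mul_rpow_of_nonneg _ _ hp0.le, ENNReal.mul_rpow_of_nonneg _ _ hp0.le]; ring
    _ ≤ 2 ^ (p - 1) * ((L ^ (s * p + N) * (c₁ * wt (-(s * p) - N) x)) * v ^ p +
          (L ^ (s * p + N) * (c₂ * wt (-((s + 1) * p) - N) x)) * w ^ p) := by gcongr
    _ ≤ 2 ^ (p - 1) * ((L ^ (s * p + N) * ((c₁ + c₂) * wt (-(s * p) - N) x)) * v ^ p +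
          (L ^ (s * p + N) * ((c₁ + c₂) * wt (-((s + 1) * p) - N) x)) * w ^ p) := by
        gcongr
        · exact le_self_add
        · exact le_add_self
    _ = _ := by ring

/-- The Sobolev inequality on a dyadic shell, with constants independent of the shell. -/
theorem exists_shell_sobolev (hN : 1 ≤ N) (s : ℝ) (hq : 1 ≤ q) (hqp : q ≤ p) (hr : 0 < r)
    (hrq : r⁻¹ = q⁻¹ - (N : ℝ)⁻¹) :
    ∃ C : ℝ≥0∞, C ≠ ∞ ∧ ∀ (h : Eu N → ℝ), ContDiff ℝ 1 h → ∀ k,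
      ∫⁻ x in innerShell N k, wt (-((s + 1) * r) - N) x * ‖h x‖ₑ ^ r ≤
        C * shellEnergy p s (fun x => ‖fderiv ℝ h x‖ₑ) (fun x => ‖h x‖ₑ) k ^ (r / p) := by
  have hq0 : 0 < q := by linarith
  have hp : 1 ≤ p := hq.trans hqp
  have hp0 : 0 < p := by linarith
  have hN0 : (0 : ℝ) < N := by exact_mod_cast hN
  obtain ⟨D, hD, hDk⟩ := exists_setLIntegral_shell_le N s hp
  obtain ⟨c, hc, hck⟩ := exists_volume_shell_le N
  set K : ℝ≥0∞ := (SNormLESNormFDerivOfEqConst ℝ (volume : Measure (Eu N)) (q.toNNReal : ℝ) :)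
  have hK : K ≠ ∞ := ENNReal.coe_ne_top
  have hδ : 0 ≤ 1 / q - 1 / p := by
    rw [sub_nonneg]; exact one_div_le_one_div_of_le hq0 hqp
  set c' := ENNReal.ofReal (8 ^ |-((s + 1) * r) - (N : ℝ)|)
  refine ⟨c' * (K ^ r * (D ^ (r / p) * c ^ ((1 / q - 1 / p) * r))), ?_, fun h hh k => ?_⟩
  · refine ENNReal.mul_ne_top ENNReal.ofReal_ne_top (ENNReal.mul_ne_top
      (ENNReal.rpow_ne_top_of_nonneg hr.le hK) (ENNReal.mul_ne_top
      (ENNReal.rpow_ne_top_of_nonneg (by positivity) hD)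
      (ENNReal.rpow_ne_top_of_nonneg (mul_nonneg hδ hr.le) hc)))
  set L := shellScale k
  have hL0 : L ≠ 0 := shellScale_ne_zero k
  have hLt : L ≠ ∞ := shellScale_ne_top k
  set I := shellEnergy p s (fun x => ‖fderiv ℝ h x‖ₑ) (fun x => ‖h x‖ₑ) k
  let H : Eu N → ℝ := fun x => shellCutoff k x * h x
  have hH : ContDiff ℝ 1 H := (contDiff_shellCutoff k).mul hh
  have hHc : HasCompactSupport H := (hasCompactSupport_shellCutoff k).mul_right
  have e1 : eLpNorm H (ENNReal.ofReal r) volume ≤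
      K * eLpNorm (fderiv ℝ H) (ENNReal.ofReal q) volume := by
    refine eLpNorm_le_eLpNorm_fderiv_of_eq volume hH hHc (p := q.toNNReal) (p' := r.toNNReal)
      ?_ ?_ ?_
    · rwa [← NNReal.coe_le_coe, Real.coe_toNNReal _ hq0.le]
    · rw [finrank_euclideanSpace_fin]; exact hN
    · rw [finrank_euclideanSpace_fin, NNReal.coe_inv, Real.coe_toNNReal _ hr.le,
        Real.coe_toNNReal _ hq0.le, hrq]
  have hsup : Function.support (fderiv ℝ H) ⊆ shell N k := by
    intro x hx
    by_contra hn
    apply hx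
    have h1 := ((contDiff_shellCutoff (N := N) k).differentiable one_ne_zero x)
    have h2 := hh.differentiable one_ne_zero x
    change fderiv ℝ (fun x => shellCutoff k x * h x) x = 0
    rw [fderiv_fun_mul h1 h2, shellCutoff_eq_zero hn, fderiv_shellCutoff_eq_zero hn]
    simp
  have e2 : eLpNorm (fderiv ℝ H) (ENNReal.ofReal q) volume ≤
      (D * (L ^ (s * p + N) * I)) ^ (1 / p) * (c * L ^ (N : ℝ)) ^ (1 / q - 1 / p) := by
    rw [← eLpNorm_restrict_eq_of_support_subset (f := fderiv ℝ H) (p := ENNReal.ofReal q)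
      (μ := volume) hsup]
    -- Hölder on the shell passes from L^q to L^p for the gradient, at the cost of a power of the
    -- shell's volume.
    have h3 := eLpNorm_le_eLpNorm_mul_rpow_measure_univ (μ := volume.restrict (shell N k))
      (ENNReal.ofReal_le_ofReal hqp)
      (hH.continuous_fderiv one_ne_zero).aestronglyMeasurable.restrict
    rw [ENNReal.toReal_ofReal hq0.le, ENNReal.toReal_ofReal hp0.le,
      Measure.restrict_apply_univ, eLpNorm_ofReal hp0] at h3
    refine h3.trans ?_
    gcongr
    · exact hDk h hh k
    · exact hck k
  have e3 : ∫⁻ x, ‖H x‖ₑ ^ r ≤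
      (K * ((D * (L ^ (s * p + N) * I)) ^ (1 / p) *
        (c * L ^ (N : ℝ)) ^ (1 / q - 1 / p))) ^ r := by
    have h4 := ENNReal.rpow_le_rpow (e1.trans (mul_le_mul' le_rfl e2)) hr.le (z := r)
    rwa [eLpNorm_ofReal hr, ← ENNReal.rpow_mul, one_div_mul_cancel hr.ne', ENNReal.rpow_one] at h4
  have e4 : (K * ((D * (L ^ (s * p + N) * I)) ^ (1 / p) *
        (c * L ^ (N : ℝ)) ^ (1 / q - 1 / p))) ^ r =
      (K ^ r * (D ^ (r / p) * c ^ ((1 / q - 1 / p) * r))) *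
        (L ^ ((s + 1) * r + N) * I ^ (r / p)) := by
    have hpr : (1 / p) * r = r / p := by ring
    rw [ENNReal.mul_rpow_of_nonneg _ _ hr.le, ENNReal.mul_rpow_of_nonneg _ _ hr.le,
      ← ENNReal.rpow_mul, ← ENNReal.rpow_mul, hpr,
      ENNReal.mul_rpow_of_nonneg _ _ (by positivity : 0 ≤ r / p),
      ENNReal.mul_rpow_of_nonneg _ _ (by positivity : 0 ≤ r / p),
      ENNReal.mul_rpow_of_nonneg _ _ (mul_nonneg hδ hr.le), ← ENNReal.rpow_mul,
      ← ENNReal.rpow_mul]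
    -- Scale invariance: since 1/q = 1/r + 1/N, the powers of 2^k sum to the inverse of the weight
    -- of the left-hand side, and the constant is free of k.
    have hexp : (s * p + N) * (r / p) + N * ((1 / q - 1 / p) * r) = (s + 1) * r + N := by
      have : 1 / q = 1 / r + 1 / N := by
        rw [one_div, one_div, one_div]; linarith
      rw [this]; field_simp; ring
    rw [← hexp, ENNReal.rpow_add _ _ hL0 hLt]
    ring
  calc ∫⁻ x in innerShell N k, wt (-((s + 1) * r) - N) x * ‖h x‖ₑ ^ r
      ≤ ∫⁻ x in innerShell N k, (c' * L ^ (-((s + 1) * r) - N)) * ‖H x‖ₑ ^ r := by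
        refine setLIntegral_mono' (measurableSet_innerShell k) fun x hx => ?_
        have h5 : H x = h x := by simp [H, shellCutoff_eq_one hx]
        rw [h5]
        gcongr
        exact (wt_shell (innerShell_subset_shell k hx)).1
    _ ≤ ∫⁻ x, (c' * L ^ (-((s + 1) * r) - N)) * ‖H x‖ₑ ^ r := setLIntegral_le_lintegral _ _
    _ = (c' * L ^ (-((s + 1) * r) - N)) * ∫⁻ x, ‖H x‖ₑ ^ r :=
        lintegral_const_mul' _ _ (ENNReal.mul_ne_top ENNReal.ofReal_ne_top
          (ENNReal.rpow_ne_top_of_ne_zero hL0 hLt))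
    _ ≤ (c' * L ^ (-((s + 1) * r) - N)) *
        ((K ^ r * (D ^ (r / p) * c ^ ((1 / q - 1 / p) * r))) *
          (L ^ ((s + 1) * r + N) * I ^ (r / p))) := by
        rw [← e4]; gcongr
    _ = (L ^ (-((s + 1) * r) - N) * L ^ ((s + 1) * r + N)) *
        (c' * (K ^ r * (D ^ (r / p) * c ^ ((1 / q - 1 / p) * r))) * I ^ (r / p)) := by ring
    _ = _ := by
        rw [← ENNReal.rpow_add _ _ hL0 hLt]
        have : -((s + 1) * r) - (N : ℝ) + ((s + 1) * r + N) = 0 := by ring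
        rw [this, ENNReal.rpow_zero, one_mul]

/-- The weighted Sobolev inequality for continuously differentiable functions. -/
theorem exists_wInt_le_of_contDiff (hN : 1 ≤ N) (s : ℝ) (hq : 1 ≤ q) (hqp : q ≤ p) (hpr : p ≤ r)
    (hrq : r⁻¹ = q⁻¹ - (N : ℝ)⁻¹) :
    ∃ C : ℝ≥0∞, C ≠ ∞ ∧ ∀ (h : Eu N → ℝ), ContDiff ℝ 1 h →
      wInt r (s + 1) (fun x => ‖h x‖ₑ) ≤
        C * (wInt p s (fun x => ‖fderiv ℝ h x‖ₑ) + wInt p (s + 1) (fun x => ‖h x‖ₑ)) ^ (r / p) := by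
  have hp : 1 ≤ p := hq.trans hqp
  have hp0 : 0 < p := by linarith
  have hrp : 1 ≤ r / p := by rwa [one_le_div hp0]
  obtain ⟨C, hC, hCk⟩ := exists_shell_sobolev hN s hq hqp (by linarith : 0 < r) hrq
  refine ⟨C * 4 ^ (r / p), ENNReal.mul_ne_top hC
    (ENNReal.rpow_ne_top_of_nonneg (by linarith) (by simp)), fun h hh => ?_⟩
  have hm1 : Measurable fun x => wt (-(s * p) - N) x * ‖fderiv ℝ h x‖ₑ ^ p :=
    measurable_wt_mul (hh.continuous_fderiv one_ne_zero).measurable.enorm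
  have hm2 : Measurable fun x => wt (-((s + 1) * p) - N) x * ‖h x‖ₑ ^ p :=
    measurable_wt_mul hh.continuous.measurable.enorm
  calc wInt r (s + 1) (fun x => ‖h x‖ₑ)
      = ∫⁻ x in ⋃ k, innerShell N k, wt (-((s + 1) * r) - N) x * ‖h x‖ₑ ^ r := by
        rw [iUnion_innerShell, Measure.restrict_univ]; rfl
    _ ≤ ∑' k, ∫⁻ x in innerShell N k, wt (-((s + 1) * r) - N) x * ‖h x‖ₑ ^ r :=
        lintegral_iUnion_le _ _
    _ ≤ ∑' k, C * shellEnergy p s (fun x => ‖fderiv ℝ h x‖ₑ) (fun x => ‖h x‖ₑ) k ^ (r / p) :=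
        ENNReal.tsum_le_tsum fun k => hCk h hh k
    _ ≤ C * (∑' k, shellEnergy p s (fun x => ‖fderiv ℝ h x‖ₑ) (fun x => ‖h x‖ₑ) k) ^ (r / p) := by
        rw [ENNReal.tsum_mul_left]; gcongr; exact tsum_rpow_le hrp _
    _ ≤ C * (4 * (wInt p s (fun x => ‖fderiv ℝ h x‖ₑ) +
          wInt p (s + 1) (fun x => ‖h x‖ₑ))) ^ (r / p) := by
        gcongr
        refine (tsum_setLIntegral_shell_le (hm1.add hm2)).trans (le_of_eq ?_)
        simp only [Pi.add_apply]
        rw [lintegral_add_left hm1]; rfl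
    _ = _ := by rw [ENNReal.mul_rpow_of_nonneg _ _ (by linarith)]; ring

end Sobolev

/-! ### Mollification and passage to weak gradients -/

section Mollify

variable {N : ℕ} {p q r s a : ℝ}

/-- The average `∫ η(y) f(x + y) dy`. -/
noncomputable def moll (η f : Eu N → ℝ) (x : Eu N) : ℝ := ∫ y, η y * f (x + y)

theorem moll_eq_convolution (η f : Eu N → ℝ) :
    moll η f = convolution f (fun t => η (-t)) (ContinuousLinearMap.lsmul ℝ ℝ) volume := by
  ext x
  rw [convolution_lsmul, moll]
  conv_rhs => rw [← integral_add_left_eq_self _ x]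
  refine integral_congr_ae (Eventually.of_forall fun y => ?_)
  simp only [smul_eq_mul, sub_add_cancel_left, neg_neg]
  exact mul_comm _ _

variable {η f : Eu N → ℝ} {g : Eu N → Eu N} {u : Distr N} {c : ℝ}

theorem contDiff_moll (hη : ContDiff ℝ 1 η) (hc : HasCompactSupport η)
    (hf : LocallyIntegrable f volume) : ContDiff ℝ 1 (moll η f) := by
  rw [moll_eq_convolution]
  exact HasCompactSupport.contDiff_convolution_right (n := 1) _
    (hc.comp_homeomorph (Homeomorph.neg (Eu N))) hf (hη.comp contDiff_neg)

/-- The average at x is u tested against the translate η(· - x). Differentiating in x puts a minus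
derivative on the test function, which is the weak derivative of u. -/
theorem fderiv_moll_apply (hf : IsGivenBy u f)
    (hu : ∀ i, IsGivenBy (∂_{EuclideanSpace.single i (1 : ℝ)} u) (fun x => g x i))
    (η : 𝓓((⊤ : Opens (Eu N)), ℝ)) (x : Eu N) (i : Fin N) :
    fderiv ℝ (moll η f) x (EuclideanSpace.single i (1 : ℝ)) = moll η (fun x => g x i) x := by
  set e := EuclideanSpace.single i (1 : ℝ)
  let ηn : Eu N → ℝ := fun t => η (-t)
  have hη1 : ContDiff ℝ 1 η := η.contDiff.of_le (by exact_mod_cast le_top)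
  have hηn : ContDiff ℝ 1 ηn := hη1.comp contDiff_neg
  have hηnc : HasCompactSupport ηn := η.hasCompactSupport.comp_homeomorph (Homeomorph.neg (Eu N))
  let ψ : 𝓓((⊤ : Opens (Eu N)), ℝ) :=
    ⟨fun w => η (w - x), η.contDiff.comp (contDiff_id.sub contDiff_const),
      η.hasCompactSupport.comp_homeomorph (Homeomorph.subRight x), by simp⟩
  have hψ : ∀ w, (∂_{e} ψ) w = -fderiv ℝ ηn (x - w) e := by
    intro w
    rw [lineDeriv_apply]
    have h1 : HasFDerivAt ηn (fderiv ℝ ηn (x - w)) (x - w) :=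
      (hηn.differentiable one_ne_zero _).hasFDerivAt
    have h2 : HasFDerivAt (fun w : Eu N => x - w) (-ContinuousLinearMap.id ℝ (Eu N)) w :=
      (hasFDerivAt_id w).const_sub x
    have h3 := (h1.comp w h2).fderiv
    have h4 : ηn ∘ (fun w : Eu N => x - w) = ψ := by
      ext w; change η (-(x - w)) = η (w - x); rw [neg_sub]
    rw [h4] at h3
    rw [h3]; simp
  have hd := HasCompactSupport.hasFDerivAt_convolution_right
    (ContinuousLinearMap.lsmul ℝ ℝ) hηnc hf.1 hηn (μ := volume) x
  rw [moll_eq_convolution, hd.fderiv, convolution_precompR_apply _ hf.1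
    (hηnc.fderiv (𝕜 := ℝ)) (hηn.continuous_fderiv one_ne_zero), convolution_lsmul]
  have h5 := (hu i).2 ψ
  rw [Distribution.lineDerivOp_apply_apply, map_neg, hf.2] at h5
  have h6 : ∫ w, f w * (∂_{e} ψ) w = -∫ w, f w • fderiv ℝ ηn (x - w) e := by
    rw [← integral_neg]
    refine integral_congr_ae (Eventually.of_forall fun w => ?_)
    simp only [hψ, smul_eq_mul]; ring
  rw [h6, neg_neg] at h5
  rw [h5, moll, ← integral_add_left_eq_self _ x]
  refine integral_congr_ae (Eventually.of_forall fun y => ?_)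
  change g (x + y) i * η (x + y - x) = _
  rw [add_sub_cancel_left, mul_comm]

theorem enorm_le_sum_apply_single (L : Eu N →L[ℝ] ℝ) :
    ‖L‖ₑ ≤ ∑ i, ‖L (EuclideanSpace.single i (1 : ℝ))‖ₑ := by
  have h : ‖L‖ ≤ ∑ i, ‖L (EuclideanSpace.single i (1 : ℝ))‖ := by
    refine L.opNorm_le_bound (by positivity) fun y => ?_
    calc ‖L y‖ = ‖∑ i, y i * L (EuclideanSpace.single i (1 : ℝ))‖ := by
          conv_lhs => rw [← sum_coord_smul_single y, map_sum]
          simp only [map_smul, smul_eq_mul]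
      _ ≤ ∑ i, ‖y i * L (EuclideanSpace.single i (1 : ℝ))‖ := norm_sum_le _ _
      _ ≤ ∑ i, ‖L (EuclideanSpace.single i (1 : ℝ))‖ * ‖y‖ := by
          refine Finset.sum_le_sum fun i _ => ?_
          rw [norm_mul, mul_comm]
          gcongr
          exact PiLp.norm_apply_le y i
      _ = _ := by rw [Finset.sum_mul]
  calc ‖L‖ₑ = ENNReal.ofReal ‖L‖ := (ofReal_norm L).symm
    _ ≤ ENNReal.ofReal (∑ i, ‖L (EuclideanSpace.single i (1 : ℝ))‖) := ENNReal.ofReal_le_ofReal h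
    _ = _ := by
      rw [ENNReal.ofReal_sum_of_nonneg fun i _ => norm_nonneg _]
      exact Finset.sum_congr rfl fun i _ => ofReal_norm _

theorem enorm_fderiv_moll_le (hf : IsGivenBy u f)
    (hu : ∀ i, IsGivenBy (∂_{EuclideanSpace.single i (1 : ℝ)} u) (fun x => g x i))
    (η : 𝓓((⊤ : Opens (Eu N)), ℝ)) (x : Eu N) :
    ‖fderiv ℝ (moll η f) x‖ₑ ≤ N * ∫⁻ y, ‖η y‖ₑ * ‖g (x + y)‖ₑ := by
  refine (enorm_le_sum_apply_single _).trans ?_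
  calc _ ≤ ∑ _i : Fin N, ∫⁻ y, ‖η y‖ₑ * ‖g (x + y)‖ₑ := by
        refine Finset.sum_le_sum fun i _ => ?_
        rw [fderiv_moll_apply hf hu]
        refine (enorm_integral_le_lintegral_enorm _).trans (lintegral_mono fun y => ?_)
        rw [enorm_mul]
        gcongr
        exact enorm_coord_le _ _
    _ = _ := by simp

theorem integrable_mul_translate (hη : Continuous η) (hc : HasCompactSupport η)
    (hf : LocallyIntegrable f volume) (x : Eu N) : Integrable (fun y => η y * f (x + y)) := by
  have h1 : LocallyIntegrable (fun y => f (x + y)) volume := by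
    rw [locallyIntegrable_iff]
    intro K hK
    have h2 := hf.integrableOn_isCompact (hK.image (continuous_const_add x))
    have h3 := (measurePreserving_add_left volume x).integrableOn_comp_preimage
      (measurableEmbedding_addLeft x) (f := f) (s := (fun y => x + y) '' K)
    rw [Set.preimage_image_eq _ (add_right_injective x)] at h3
    exact h3.2 h2
  exact (h1.integrable_smul_left_of_hasCompactSupport hη hc)

theorem enorm_moll_sub_le (hη : Continuous η) (hc : HasCompactSupport η) (h1 : ∫ y, η y = 1)
    (hf : LocallyIntegrable f volume) (c : ℝ) (x : Eu N) :
    ‖moll η f x - c‖ₑ ≤ ∫⁻ y, ‖η y‖ₑ * ‖f (x + y) - c‖ₑ := by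
  have h2 : moll η f x - c = ∫ y, η y * (f (x + y) - c) := by
    simp_rw [mul_sub]
    rw [integral_sub (integrable_mul_translate hη hc hf x)
      ((hη.integrable_of_hasCompactSupport hc).mul_const c), integral_mul_const, h1, one_mul]
    rfl
  rw [h2]
  refine (enorm_integral_le_lintegral_enorm _).trans (lintegral_mono fun y => ?_)
  rw [enorm_mul]

/-- The standard bump function of radius `R`. -/
noncomputable def bumpOf (R : ℝ) (hR : 0 < R) : ContDiffBump (0 : Eu N) where
  rIn := R / 2
  rOut := R
  rIn_pos := by positivity
  rIn_lt_rOut := by linarith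

/-- The standard mollifier of radius `R`, as a test function. -/
noncomputable def mollifier (N : ℕ) (R : ℝ) (hR : 0 < R) : 𝓓((⊤ : Opens (Eu N)), ℝ) where
  toFun := (bumpOf R hR).normed volume
  contDiff' := (bumpOf R hR).contDiff_normed
  hasCompactSupport' := (bumpOf R hR).hasCompactSupport_normed
  tsupport_subset' := by simp

variable {R : ℝ} {hR : 0 < R}

theorem integral_mollifier : ∫ y, mollifier N R hR y = 1 := (bumpOf R hR).integral_normed

theorem mollifier_nonneg (y : Eu N) : 0 ≤ mollifier N R hR y := (bumpOf R hR).nonneg_normed y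

theorem norm_lt_of_mollifier_ne_zero {y : Eu N} (h : mollifier N R hR y ≠ 0) : ‖y‖ < R := by
  have : y ∈ Function.support ((bumpOf R hR).normed volume) := h
  rw [ContDiffBump.support_normed_eq] at this
  exact mem_ball_zero_iff.1 this

theorem lintegral_enorm_mollifier : ∫⁻ y, ‖mollifier N R hR y‖ₑ = 1 := by
  rw [← ENNReal.ofReal_one, ← integral_mollifier (hR := hR), ofReal_integral_eq_lintegral_ofReal]
  · exact lintegral_congr fun y => Real.enorm_of_nonneg (mollifier_nonneg y)
  · exact (mollifier N R hR).continuous.integrable_of_hasCompactSupport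
      (mollifier N R hR).hasCompactSupport
  · exact Eventually.of_forall mollifier_nonneg

theorem wInt_average_mollifier_le (hp : 1 ≤ p) (hR1 : R ≤ 1) {v : Eu N → ℝ≥0∞}
    (hv : Measurable v) :
    wInt p s (fun x => ∫⁻ y, ‖mollifier N R hR y‖ₑ * v (x + y)) ≤
      ENNReal.ofReal ((1 + 1) ^ |-(s * p) - N|) * wInt p s v := by
  refine (lintegral_wt_average_le (ν := volume) (τ := fun x => x) (R := 1) hp
    (mollifier N R hR).continuous.measurable.enorm measurable_id
    (Eventually.of_forall fun y hy =>
      (norm_lt_of_mollifier_ne_zero (by simpa using hy)).le.trans hR1) hv).trans ?_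
  rw [lintegral_enorm_mollifier, ENNReal.one_rpow, one_mul]
  rfl

/-- The mollifiers of radius `1/(n+1)`. -/
noncomputable def mollSeq (N n : ℕ) : 𝓓((⊤ : Opens (Eu N)), ℝ) :=
  mollifier N (1 / ((n : ℝ) + 1)) Nat.one_div_pos_of_nat

/-- Lebesgue differentiation; the inner and outer radii of the bumps keep the fixed ratio 2. -/
theorem ae_tendsto_moll (hf : LocallyIntegrable f volume) :
    ∀ᵐ x, Tendsto (fun n => moll (mollSeq N n) f x) atTop (𝓝 (f x)) := by
  have h := ContDiffBump.ae_convolution_tendsto_right_of_locallyIntegrable (μ := volume)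
    (φ := fun n : ℕ => (bumpOf (1 / ((n : ℝ) + 1)) Nat.one_div_pos_of_nat :
      ContDiffBump (0 : Eu N))) (l := atTop) (K := 2) (g := f)
    tendsto_one_div_add_atTop_nhds_zero_nat
    (Eventually.of_forall fun n => by simp only [bumpOf]; linarith) hf
  filter_upwards [h] with x hx
  refine hx.congr fun n => ?_
  rw [convolution_lsmul, moll, ← integral_neg_eq_self]
  refine integral_congr_ae (Eventually.of_forall fun y => ?_)
  simp only [smul_eq_mul, sub_neg_eq_add]
  congr 1
  exact ContDiffBump.normed_neg _ y

/-- The weighted Sobolev inequality for functions with a weak gradient. -/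
theorem exists_wInt_sobolev (hN : 1 ≤ N) (s : ℝ) (hq : 1 ≤ q) (hqp : q ≤ p) (hpr : p ≤ r)
    (hrq : r⁻¹ = q⁻¹ - (N : ℝ)⁻¹) :
    ∃ C : ℝ≥0∞, C ≠ ∞ ∧ ∀ (u : Distr N) (f : Eu N → ℝ) (g : Eu N → Eu N), IsGivenBy u f →
      (∀ i, IsGivenBy (∂_{EuclideanSpace.single i (1 : ℝ)} u) (fun x => g x i)) →
      Measurable f → Measurable g → ∀ c : ℝ,
      wInt r (s + 1) (fun x => ‖f x - c‖ₑ) ≤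
        C * (wInt p s (fun x => ‖g x‖ₑ) + wInt p (s + 1) (fun x => ‖f x - c‖ₑ)) ^ (r / p) := by
  have hp : 1 ≤ p := hq.trans hqp
  have hp0 : 0 < p := by linarith
  have hr0 : 0 < r := by linarith
  have hrp0 : 0 ≤ r / p := by positivity
  obtain ⟨C, hC, hCh⟩ := exists_wInt_le_of_contDiff hN s hq hqp hpr hrq
  set c₁ := (N : ℝ≥0∞) ^ p * ENNReal.ofReal ((1 + 1) ^ |-(s * p) - (N : ℝ)|)
  set c₂ := ENNReal.ofReal ((1 + 1) ^ |-((s + 1) * p) - (N : ℝ)|)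
  have hc₁ : c₁ ≠ ∞ := ENNReal.mul_ne_top (ENNReal.rpow_ne_top_of_nonneg hp0.le (by simp))
    ENNReal.ofReal_ne_top
  refine ⟨C * (c₁ + c₂) ^ (r / p), ENNReal.mul_ne_top hC (ENNReal.rpow_ne_top_of_nonneg hrp0
    (ENNReal.add_ne_top.2 ⟨hc₁, ENNReal.ofReal_ne_top⟩)), fun u f g hf hu hfm hgm c => ?_⟩
  set X := wInt p s (fun x => ‖g x‖ₑ)
  set Y := wInt p (s + 1) (fun x => ‖f x - c‖ₑ)
  set T := C * (c₁ + c₂) ^ (r / p) * (X + Y) ^ (r / p)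
  have hR1 : ∀ n : ℕ, 1 / ((n : ℝ) + 1) ≤ 1 := fun n => by
    rw [div_le_one (by positivity)]; linarith [n.cast_nonneg (α := ℝ)]
  have hη : ∀ n, ContDiff ℝ 1 (mollSeq N n) := fun n =>
    (mollSeq N n).contDiff.of_le (by exact_mod_cast le_top)
  have hF : ∀ n, ContDiff ℝ 1 (moll (mollSeq N n) f) := fun n =>
    contDiff_moll (hη n) (mollSeq N n).hasCompactSupport hf.1
  -- The C¹ inequality applies to the mollification. Radii at most 1 distort the weights by a
  -- bounded factor, so the right-hand side is controlled uniformly in n.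
  have hmain : ∀ n, wInt r (s + 1) (fun x => ‖moll (mollSeq N n) f x - c‖ₑ) ≤ T := by
    intro n
    have h1 := hCh (fun x => moll (mollSeq N n) f x - c) ((hF n).sub contDiff_const)
    have hm : Measurable fun z : Eu N × Eu N => ‖mollSeq N n z.2‖ₑ * ‖g (z.1 + z.2)‖ₑ := by
      have := (mollSeq N n).continuous.measurable
      fun_prop
    have h2 : wInt p s (fun x => ‖fderiv ℝ (fun x => moll (mollSeq N n) f x - c) x‖ₑ) ≤
        c₁ * X := by
      calc _ ≤ wInt p s (fun x => N * ∫⁻ y, ‖mollSeq N n y‖ₑ * ‖g (x + y)‖ₑ) := by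
            refine wInt_mono hp0.le (Eventually.of_forall fun x => ?_)
            rw [fderiv_sub_const]
            exact enorm_fderiv_moll_le hf hu _ x
        _ = (N : ℝ≥0∞) ^ p * wInt p s (fun x => ∫⁻ y, ‖mollSeq N n y‖ₑ * ‖g (x + y)‖ₑ) :=
            wInt_const_mul hp0.le _ hm.lintegral_prod_right'
        _ ≤ _ := by
            rw [mul_assoc]
            gcongr
            exact wInt_average_mollifier_le hp (hR1 n) hgm.enorm
    have h3 : wInt p (s + 1) (fun x => ‖moll (mollSeq N n) f x - c‖ₑ) ≤ c₂ * Y := by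
      calc _ ≤ wInt p (s + 1) (fun x => ∫⁻ y, ‖mollSeq N n y‖ₑ * ‖f (x + y) - c‖ₑ) :=
            wInt_mono hp0.le (Eventually.of_forall fun x => enorm_moll_sub_le
              (mollSeq N n).continuous (mollSeq N n).hasCompactSupport integral_mollifier hf.1 c x)
        _ ≤ _ := wInt_average_mollifier_le hp (hR1 n) (v := fun x => ‖f x - c‖ₑ)
              (hfm.sub_const c).enorm
    refine h1.trans ?_
    calc _ ≤ C * (c₁ * X + c₂ * Y) ^ (r / p) := by gcongr
      _ ≤ C * ((c₁ + c₂) * (X + Y)) ^ (r / p) := by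
          gcongr
          rw [add_mul]
          gcongr
          · exact le_self_add
          · exact le_add_self
      _ = T := by rw [ENNReal.mul_rpow_of_nonneg _ _ hrp0, ← mul_assoc]
  have hFm : ∀ n, Measurable fun x => wt (-((s + 1) * r) - N) x *
      ‖moll (mollSeq N n) f x - c‖ₑ ^ r := fun n =>
    measurable_wt_mul ((hF n).continuous.measurable.sub_const c).enorm
  -- Almost everywhere convergence of the mollifications and Fatou's lemma.
  calc wInt r (s + 1) (fun x => ‖f x - c‖ₑ)
      = ∫⁻ x, liminf (fun n => wt (-((s + 1) * r) - N) x *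
          ‖moll (mollSeq N n) f x - c‖ₑ ^ r) atTop := by
        refine lintegral_congr_ae ?_
        filter_upwards [ae_tendsto_moll hf.1] with x hx
        refine (Tendsto.liminf_eq ?_).symm
        refine ENNReal.Tendsto.const_mul ?_ (Or.inr wt_ne_top)
        exact ((ENNReal.continuous_rpow_const.tendsto _).comp
          ((continuous_enorm.tendsto _).comp (hx.sub_const c)))
    _ ≤ liminf (fun n => wInt r (s + 1) (fun x => ‖moll (mollSeq N n) f x - c‖ₑ)) atTop :=
        lintegral_liminf_le hFm
    _ ≤ T := liminf_le_of_le (by isBoundedDefault) fun b hb => by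
        obtain ⟨n, hn⟩ := hb.exists
        exact hn.trans (hmain n)

end Mollify

/-! ### Morrey estimates for the segment potential -/

section Morrey

variable {N : ℕ} {p s a : ℝ}

theorem volume_ball_eq {R : ℝ} (hR : 0 < R) (x : Eu N) : volume (Metric.ball x R) =
    ENNReal.ofReal R ^ (N : ℝ) * volume (Metric.ball (0 : Eu N) 1) := by
  rw [Measure.addHaar_ball_of_pos _ _ hR, finrank_euclideanSpace_fin, ENNReal.rpow_natCast,
    ENNReal.ofReal_pow hR.le]

/-- The normalised bump is at most the inverse volume of its inner ball, of radius R/2; hence the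
factor 2^N. -/
theorem exists_enorm_mollifier_le (N : ℕ) : ∃ c : ℝ≥0∞, c ≠ ∞ ∧
    ∀ (R : ℝ) (hR : 0 < R) (y : Eu N),
      ‖mollifier N R hR y‖ₑ ≤ c * ENNReal.ofReal R ^ (-(N : ℝ)) := by
  set b := (volume (Metric.ball (0 : Eu N) 1)).toReal
  have hb : 0 < b := ENNReal.toReal_pos
    (Metric.measure_ball_pos volume _ one_pos).ne' measure_ball_lt_top.ne
  refine ⟨ENNReal.ofReal (2 ^ N * b⁻¹), ENNReal.ofReal_ne_top, fun R hR y => ?_⟩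
  have h := (bumpOf R hR : ContDiffBump (0 : Eu N)).normed_le_div_measure_closedBall_rIn
    (μ := volume) y
  have h1 : volume.real (Metric.closedBall (0 : Eu N) (R / 2)) = (R / 2) ^ N * b := by
    rw [Measure.real, Measure.addHaar_closedBall _ _ (by positivity), finrank_euclideanSpace_fin,
      ENNReal.toReal_mul, ENNReal.toReal_ofReal (by positivity)]
  have h2 : mollifier N R hR y ≤ 1 / ((R / 2) ^ N * b) := by rw [← h1]; exact h
  rw [ENNReal.ofReal_rpow_of_pos hR, ← ENNReal.ofReal_mul (by positivity),
    Real.enorm_of_nonneg (mollifier_nonneg y)]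
  refine ENNReal.ofReal_le_ofReal (h2.trans (le_of_eq ?_))
  rw [Real.rpow_neg hR.le, Real.rpow_natCast, div_pow]
  field_simp

theorem setLIntegral_ball_translate (F : Eu N → ℝ≥0∞) (x : Eu N) (R : ℝ) :
    ∫⁻ w in Metric.ball (0 : Eu N) R, F (x + w) = ∫⁻ z in Metric.ball x R, F z := by
  rw [← lintegral_indicator measurableSet_ball, ← lintegral_indicator measurableSet_ball]
  conv_rhs => rw [← lintegral_add_left_eq_self _ x]
  refine lintegral_congr fun w => ?_
  by_cases hw : w ∈ Metric.ball (0 : Eu N) R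
  · have : x + w ∈ Metric.ball x R := by simpa using hw
    rw [Set.indicator_of_mem hw, Set.indicator_of_mem this]
  · have : x + w ∉ Metric.ball x R := by simpa using hw
    rw [Set.indicator_of_notMem hw, Set.indicator_of_notMem this]

theorem enorm_segPart_mollifier_le {c : ℝ≥0∞} {R : ℝ} {hR : 0 < R}
    (hc : ∀ y : Eu N, ‖mollifier N R hR y‖ₑ ≤ c * ENNReal.ofReal R ^ (-(N : ℝ)))
    {g : Eu N → Eu N} (hg : Measurable g) (x : Eu N) :
    ‖segPart (mollifier N R hR) g x‖ₑ ≤ N * (c * ENNReal.ofReal R ^ (-(N : ℝ))) *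
      ∫⁻ t in Set.Ioc (0 : ℝ) 1, ∫⁻ z in Metric.ball (0 : Eu N) R,
        ‖z‖ₑ * ‖g (x + t • z)‖ₑ := by
  have hηm := (mollifier N R hR).continuous.measurable
  have hm : Measurable fun z : ℝ × Eu N =>
      (‖mollifier N R hR z.2‖ₑ * ‖z.2‖ₑ) * ‖g (x + z.1 • z.2)‖ₑ := by fun_prop
  have hm2 : Measurable fun z : ℝ × Eu N => ‖z.2‖ₑ * ‖g (x + z.1 • z.2)‖ₑ := by fun_prop
  refine (enorm_segPart_le x).trans ?_
  rw [mul_assoc]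
  gcongr
  rw [homot, lintegral_prod _ hm.aemeasurable, ← lintegral_const_mul]
  · refine lintegral_mono fun t => ?_
    have hmt : Measurable fun z : Eu N => ‖z‖ₑ * ‖g (x + t • z)‖ₑ := by fun_prop
    rw [← lintegral_const_mul _ hmt,
      ← lintegral_indicator measurableSet_ball]
    refine lintegral_mono fun z => ?_
    by_cases hz : mollifier N R hR z = 0
    · simp [hz]
    · have : z ∈ Metric.ball (0 : Eu N) R := by
        simpa using norm_lt_of_mollifier_ne_zero hz
      rw [Set.indicator_of_mem this]
      rw [mul_assoc]
      gcongr
      exact hc z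
  · exact hm2.lintegral_prod_right'

/-- The Morrey estimate above the critical exponent. -/
theorem lintegral_segment_le_of_lt (hp : 1 ≤ p) (hNp : (N : ℝ) < p) {g : Eu N → Eu N}
    (hg : Measurable g) {R : ℝ} (hR : 0 < R) (x : Eu N) :
    ∫⁻ t in Set.Ioc (0 : ℝ) 1, ∫⁻ z in Metric.ball (0 : Eu N) R, ‖z‖ₑ * ‖g (x + t • z)‖ₑ ≤
      (ENNReal.ofReal (1 / (-(N / p) + 1)) *
        volume (Metric.ball (0 : Eu N) 1) ^ (1 - 1 / p)) *
        (ENNReal.ofReal R ^ (N + (1 - N / p)) *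
          (∫⁻ z in Metric.ball x R, ‖g z‖ₑ ^ p) ^ (1 / p)) := by
  have hp0 : 0 < p := by linarith
  set A := ∫⁻ z in Metric.ball x R, ‖g z‖ₑ ^ p with hA
  set B := Metric.ball (0 : Eu N) R
  set ω := volume (Metric.ball (0 : Eu N) 1)
  have hL0 : ENNReal.ofReal R ≠ 0 := by simpa using hR
  have hNp1 : (N : ℝ) / p < 1 := by rwa [div_lt_one hp0]
  have hp1 : 0 ≤ 1 - 1 / p := by
    rw [sub_nonneg, div_le_one hp0]; exact hp
  have hgm : ∀ t : ℝ, Measurable fun z => ‖g (x + t • z)‖ₑ := fun t => by fun_prop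
  -- For fixed t, Hölder on the ball and the substitution w = tz cost t^(-N/p), which is integrable
  -- over (0, 1] because N < p.
  have hinner : ∀ t ∈ Set.Ioc (0 : ℝ) 1, ∫⁻ z in B, ‖z‖ₑ * ‖g (x + t • z)‖ₑ ≤
      ENNReal.ofReal (t ^ (-(N / p))) * (ENNReal.ofReal R * ((volume B) ^ (1 - 1 / p) *
        A ^ (1 / p))) := by
    intro t ht
    have h1 : (∫⁻ z in B, ‖g (x + t • z)‖ₑ) ^ p ≤
        volume B ^ (p - 1) * (ENNReal.ofReal (t ^ (-(N : ℝ))) * A) := by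
      refine (lintegral_rpow_le hp (hgm t)).trans ?_
      rw [Measure.restrict_apply_univ]
      gcongr
      let F : Eu N → ℝ≥0∞ := B.indicator fun w => ‖g (x + w)‖ₑ ^ p
      have hF : Measurable F := by
        refine Measurable.indicator ?_ measurableSet_ball
        fun_prop
      calc ∫⁻ z in B, ‖g (x + t • z)‖ₑ ^ p ≤ ∫⁻ z, F (t • z) := by
            rw [← lintegral_indicator measurableSet_ball]
            refine lintegral_mono fun z => ?_
            by_cases hz : z ∈ B
            · have : t • z ∈ B := by
                rw [mem_ball_zero_iff] at hz ⊢
                rw [norm_smul, Real.norm_of_nonneg ht.1.le]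
                exact (mul_le_of_le_one_left (norm_nonneg _) ht.2).trans_lt hz
              rw [Set.indicator_of_mem hz, show F (t • z) = _ from
                Set.indicator_of_mem this _]
            · rw [Set.indicator_of_notMem hz]; exact zero_le
        _ = ENNReal.ofReal (t ^ (-(N : ℝ))) * ∫⁻ z, F z := lintegral_comp_smul_eq ht.1 hF
        _ = _ := by
            rw [lintegral_indicator measurableSet_ball,
              setLIntegral_ball_translate (fun z => ‖g z‖ₑ ^ p)]
    have h2 : ∫⁻ z in B, ‖g (x + t • z)‖ₑ ≤
        volume B ^ (1 - 1 / p) * (ENNReal.ofReal (t ^ (-(N / p))) * A ^ (1 / p)) := by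
      have h3 := ENNReal.rpow_le_rpow h1 (by positivity : 0 ≤ 1 / p)
      rw [← ENNReal.rpow_mul, mul_one_div_cancel hp0.ne', ENNReal.rpow_one,
        ENNReal.mul_rpow_of_nonneg _ _ (by positivity : 0 ≤ 1 / p),
        ENNReal.mul_rpow_of_nonneg _ _ (by positivity : 0 ≤ 1 / p), ← ENNReal.rpow_mul,
        ENNReal.ofReal_rpow_of_nonneg (Real.rpow_nonneg ht.1.le _) (by positivity),
        ← Real.rpow_mul ht.1.le] at h3
      have e1 : (p - 1) * (1 / p) = 1 - 1 / p := by field_simp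
      have e2 : -(N : ℝ) * (1 / p) = -(N / p) := by ring
      rwa [e1, e2] at h3
    calc ∫⁻ z in B, ‖z‖ₑ * ‖g (x + t • z)‖ₑ
        ≤ ∫⁻ z in B, ENNReal.ofReal R * ‖g (x + t • z)‖ₑ := by
          refine setLIntegral_mono' measurableSet_ball fun z hz => ?_
          gcongr
          rw [← ofReal_norm]
          exact ENNReal.ofReal_le_ofReal (mem_ball_zero_iff.1 hz).le
      _ = ENNReal.ofReal R * ∫⁻ z in B, ‖g (x + t • z)‖ₑ := lintegral_const_mul _ (hgm t)
      _ ≤ ENNReal.ofReal R * (volume B ^ (1 - 1 / p) *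
          (ENNReal.ofReal (t ^ (-(N / p))) * A ^ (1 / p))) := by gcongr
      _ = _ := by ring
  calc _ ≤ ∫⁻ t in Set.Ioc (0 : ℝ) 1, ENNReal.ofReal (t ^ (-(N / p))) *
        (ENNReal.ofReal R * ((volume B) ^ (1 - 1 / p) * A ^ (1 / p))) :=
        setLIntegral_mono' measurableSet_Ioc hinner
    _ = ENNReal.ofReal (1 / (-(N / p) + 1)) *
        (ENNReal.ofReal R * ((volume B) ^ (1 - 1 / p) * A ^ (1 / p))) := by
        rw [lintegral_mul_const _ (by fun_prop), lintegral_Ioc_rpow (by linarith)]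
    _ = _ := by
        rw [volume_ball_eq hR, ENNReal.mul_rpow_of_nonneg _ _ hp1, ← ENNReal.rpow_mul]
        have e : (N : ℝ) + (1 - N / p) = 1 + N * (1 - 1 / p) := by ring
        rw [e, ENNReal.rpow_add _ _ hL0 ENNReal.ofReal_ne_top, ENNReal.rpow_one]
        ring

theorem lintegral_Ioc_rpow_neg_two_le {b : ℝ} (hb : 0 < b) :
    ∫⁻ t in Set.Ioc b 1, ENNReal.ofReal (t ^ (-2 : ℝ)) ≤ ENNReal.ofReal b⁻¹ := by
  have hi := integrableOn_Ioi_rpow_of_lt (show (-2 : ℝ) < -1 by norm_num) hb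
  calc _ ≤ ∫⁻ t in Set.Ioi b, ENNReal.ofReal (t ^ (-2 : ℝ)) :=
        lintegral_mono_set Set.Ioc_subset_Ioi_self
    _ = ENNReal.ofReal (∫ t in Set.Ioi b, t ^ (-2 : ℝ)) := by
        rw [ofReal_integral_eq_lintegral_ofReal hi]
        filter_upwards [ae_restrict_mem measurableSet_Ioi] with t ht
        exact Real.rpow_nonneg (hb.le.trans (le_of_lt ht)) _
    _ = _ := by
        rw [integral_Ioi_rpow_of_lt (by norm_num) hb]
        norm_num
        rw [Real.rpow_neg_one]

/-- The Morrey estimate on the line with exponent one. -/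
theorem lintegral_segment_le_one {g : Eu 1 → Eu 1} (hg : Measurable g) {R : ℝ} (hR : 0 < R)
    (x : Eu 1) :
    ∫⁻ t in Set.Ioc (0 : ℝ) 1, ∫⁻ z in Metric.ball (0 : Eu 1) R, ‖z‖ₑ * ‖g (x + t • z)‖ₑ ≤
      ENNReal.ofReal R * ∫⁻ z in Metric.ball x R, ‖g z‖ₑ := by
  -- Here t^(-N/p) = 1/t is not integrable, so the t-integral is done first after substituting w =
  -- tz. One power of 1/t comes from |z| = |w|/t and one from the Jacobian, which explains t^(-2) in
  -- `F`; `S` is the image of the ball.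
  let S : Set (ℝ × Eu 1) := {z | ‖z.2‖ < z.1 * R}
  have hS : MeasurableSet S :=
    measurableSet_lt measurable_snd.norm (measurable_fst.mul_const R)
  let F : ℝ × Eu 1 → ℝ≥0∞ := S.indicator fun z =>
    ENNReal.ofReal (z.1 ^ (-2 : ℝ)) * (‖z.2‖ₑ * ‖g (x + z.2)‖ₑ)
  have hF : Measurable F := by
    refine Measurable.indicator ?_ hS
    fun_prop
  have hinner : ∀ t ∈ Set.Ioc (0 : ℝ) 1,
      ∫⁻ z in Metric.ball (0 : Eu 1) R, ‖z‖ₑ * ‖g (x + t • z)‖ₑ = ∫⁻ w, F (t, w) := by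
    intro t ht
    have hFt : Measurable fun w => ENNReal.ofReal t * F (t, w) :=
      (hF.comp measurable_prodMk_left).const_mul _
    have e1 : ∫⁻ z in Metric.ball (0 : Eu 1) R, ‖z‖ₑ * ‖g (x + t • z)‖ₑ =
        ∫⁻ z, ENNReal.ofReal t * F (t, t • z) := by
      rw [← lintegral_indicator measurableSet_ball]
      refine lintegral_congr fun z => ?_
      have hiff : (t, t • z) ∈ S ↔ z ∈ Metric.ball (0 : Eu 1) R := by
        change ‖t • z‖ < t * R ↔ _
        rw [norm_smul, Real.norm_of_nonneg ht.1.le, mem_ball_zero_iff, mul_lt_mul_iff_right₀ ht.1]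
      by_cases hz : z ∈ Metric.ball (0 : Eu 1) R
      · rw [Set.indicator_of_mem hz, show F (t, t • z) = _ from
          Set.indicator_of_mem (hiff.2 hz) _]
        simp only
        rw [enorm_smul, Real.enorm_of_nonneg ht.1.le]
        have : ENNReal.ofReal t * (ENNReal.ofReal (t ^ (-2 : ℝ)) * ENNReal.ofReal t) = 1 := by
          rw [← ENNReal.ofReal_mul (Real.rpow_nonneg ht.1.le _), ← ENNReal.ofReal_mul ht.1.le]
          rw [Real.rpow_neg ht.1.le, Real.rpow_two]
          have := ht.1.ne'
          field_simp
          simp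
        calc ‖z‖ₑ * ‖g (x + t • z)‖ₑ = (ENNReal.ofReal t * (ENNReal.ofReal (t ^ (-2 : ℝ)) *
              ENNReal.ofReal t)) * (‖z‖ₑ * ‖g (x + t • z)‖ₑ) := by rw [this, one_mul]
          _ = _ := by ring
      · rw [Set.indicator_of_notMem hz, show F (t, t • z) = 0 from
          Set.indicator_of_notMem (fun h => hz (hiff.1 h)) _, mul_zero]
    have hFt' : Measurable fun w => F (t, w) := hF.comp measurable_prodMk_left
    rw [e1, lintegral_comp_smul_eq ht.1 hFt, lintegral_const_mul _ hFt',
      ← mul_assoc, ← ENNReal.ofReal_mul (Real.rpow_nonneg ht.1.le _)]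
    have : t ^ (-((1 : ℕ) : ℝ)) * t = 1 := by
      rw [Nat.cast_one, Real.rpow_neg_one, inv_mul_cancel₀ ht.1.ne']
    rw [this, ENNReal.ofReal_one, one_mul]
  rw [setLIntegral_congr_fun measurableSet_Ioc hinner,
    lintegral_lintegral_swap (f := fun t w => F (t, w)) hF.aemeasurable, ← setLIntegral_ball_translate,
    ← lintegral_const_mul _ (by fun_prop), ← lintegral_indicator measurableSet_ball]
  refine lintegral_mono fun w => ?_
  by_cases hw0 : w = 0
  · have : ∀ t, F (t, w) = 0 := fun t => by
      by_cases h : (t, w) ∈ S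
      · rw [show F (t, w) = _ from Set.indicator_of_mem h _]; simp [hw0]
      · exact Set.indicator_of_notMem h _
    simp [this]
  have hw : 0 < ‖w‖ := norm_pos_iff.2 hw0
  have hb : 0 < ‖w‖ / R := by positivity
  -- For fixed w the constraint reads t > |w|/R. The integral of t^(-2) is then at most R/|w|,
  -- cancelling the factor |w|.
  have hle : ∫⁻ t in Set.Ioc (0 : ℝ) 1, F (t, w) ≤
      ∫⁻ t in Set.Ioc (‖w‖ / R) 1, ENNReal.ofReal (t ^ (-2 : ℝ)) * (‖w‖ₑ * ‖g (x + w)‖ₑ) := by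
    rw [← lintegral_indicator measurableSet_Ioc, ← lintegral_indicator measurableSet_Ioc]
    refine lintegral_mono fun t => ?_
    by_cases h : t ∈ Set.Ioc (0 : ℝ) 1 ∧ (t, w) ∈ S
    · have h1 : t ∈ Set.Ioc (‖w‖ / R) 1 := ⟨by rw [div_lt_iff₀ hR]; exact h.2, h.1.2⟩
      rw [Set.indicator_of_mem h.1, Set.indicator_of_mem h1,
        show F (t, w) = _ from Set.indicator_of_mem h.2 _]
    · have : (Set.Ioc (0 : ℝ) 1).indicator (fun t => F (t, w)) t = 0 := by
        by_cases h1 : t ∈ Set.Ioc (0 : ℝ) 1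
        · rw [Set.indicator_of_mem h1]
          exact Set.indicator_of_notMem (fun h2 => h ⟨h1, h2⟩) _
        · exact Set.indicator_of_notMem h1 _
      rw [this]; exact zero_le
  by_cases hwR : w ∈ Metric.ball (0 : Eu 1) R
  · rw [Set.indicator_of_mem hwR]
    refine hle.trans ?_
    rw [lintegral_mul_const _ (by fun_prop)]
    calc _ ≤ ENNReal.ofReal (‖w‖ / R)⁻¹ * (‖w‖ₑ * ‖g (x + w)‖ₑ) := by
          gcongr; exact lintegral_Ioc_rpow_neg_two_le hb
      _ = _ := by
          rw [← mul_assoc, ← ofReal_norm w, ← ENNReal.ofReal_mul (by positivity)]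
          congr 2
          field_simp
  · rw [mem_ball_zero_iff, not_lt] at hwR
    have h1 : Set.Ioc (‖w‖ / R) 1 = ∅ := Set.Ioc_eq_empty (by
      rw [not_lt, one_le_div hR]; exact hwR)
    rw [h1] at hle
    simpa using hle.trans (by simp)

/-- The exponents for which functions with gradient in `L^p` are continuous. -/
def Supercritical (N : ℕ) (p : ℝ) : Prop := (N : ℝ) < p ∨ (p = N ∧ N = 1)

/-- The kernel bound R^(-N) meets R^(N + 1 - N/p) from the segment estimate. In the case N = p = 1
the powers cancel completely, in agreement with 1 - N/p = 0. -/
theorem exists_enorm_segPart_mollifier_le (hp : 1 ≤ p) (hNp : Supercritical N p) :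
    ∃ C : ℝ≥0∞, C ≠ ∞ ∧ ∀ (R : ℝ) (hR : 0 < R) (g : Eu N → Eu N), Measurable g → ∀ x,
      ‖segPart (mollifier N R hR) g x‖ₑ ≤ C * (ENNReal.ofReal R ^ (1 - N / p) *
        (∫⁻ z in Metric.ball x R, ‖g z‖ₑ ^ p) ^ (1 / p)) := by
  obtain ⟨c, hc, hcR⟩ := exists_enorm_mollifier_le N
  have hp0 : 0 < p := by linarith
  rcases hNp with hlt | ⟨hpN, rfl⟩
  · have hp1 : 0 ≤ 1 - 1 / p := by
      rw [sub_nonneg, div_le_one hp0]; exact hp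
    refine ⟨N * c * (ENNReal.ofReal (1 / (-(N / p) + 1)) *
        volume (Metric.ball (0 : Eu N) 1) ^ (1 - 1 / p)), ?_, fun R hR g hg x => ?_⟩
    · exact ENNReal.mul_ne_top (ENNReal.mul_ne_top (by simp) hc)
        (ENNReal.mul_ne_top ENNReal.ofReal_ne_top
          (ENNReal.rpow_ne_top_of_nonneg hp1 measure_ball_lt_top.ne))
    · have hL0 : ENNReal.ofReal R ≠ 0 := by simpa using hR
      refine (enorm_segPart_mollifier_le (hcR R hR) hg x).trans ?_
      refine (mul_le_mul' le_rfl (lintegral_segment_le_of_lt hp hlt hg hR x)).trans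
        (le_of_eq ?_)
      rw [ENNReal.rpow_add _ _ hL0 ENNReal.ofReal_ne_top]
      have : ENNReal.ofReal R ^ (-(N : ℝ)) * ENNReal.ofReal R ^ (N : ℝ) = 1 := by
        rw [← ENNReal.rpow_add _ _ hL0 ENNReal.ofReal_ne_top]; simp
      calc _ = (ENNReal.ofReal R ^ (-(N : ℝ)) * ENNReal.ofReal R ^ (N : ℝ)) *
            (N * c * (ENNReal.ofReal (1 / (-(N / p) + 1)) *
            volume (Metric.ball (0 : Eu N) 1) ^ (1 - 1 / p)) * (ENNReal.ofReal R ^ (1 - N / p) *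
            (∫⁻ z in Metric.ball x R, ‖g z‖ₑ ^ p) ^ (1 / p))) := by ring
        _ = _ := by rw [this, one_mul]
  · have hp1 : p = 1 := by rw [hpN]; simp
    subst hp1
    refine ⟨c, hc, fun R hR g hg x => ?_⟩
    have hL0 : ENNReal.ofReal R ≠ 0 := by simpa using hR
    refine (enorm_segPart_mollifier_le (hcR R hR) hg x).trans ?_
    refine (mul_le_mul' le_rfl (lintegral_segment_le_one hg hR x)).trans (le_of_eq ?_)
    simp only [Nat.cast_one, one_mul, div_one, sub_self, ENNReal.rpow_zero, ENNReal.rpow_one,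
      ENNReal.rpow_neg_one]
    rw [mul_assoc, ← mul_assoc (ENNReal.ofReal R)⁻¹,
      ENNReal.inv_mul_cancel hL0 ENNReal.ofReal_ne_top, one_mul]

end Morrey

/-! ### Pointwise growth bounds by exterior integrals -/

section Pointwise

variable {N : ℕ} {p s : ℝ}

theorem enorm_moll_sub_rpow_le (hp : 1 ≤ p) {c : ℝ≥0∞} {R : ℝ} {hR : 0 < R}
    (hc : ∀ y : Eu N, ‖mollifier N R hR y‖ₑ ≤ c * ENNReal.ofReal R ^ (-(N : ℝ)))
    {f : Eu N → ℝ} (hf : LocallyIntegrable f volume) (hfm : Measurable f) (k : ℝ) (x : Eu N) :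
    ‖moll (mollifier N R hR) f x - k‖ₑ ^ p ≤ c * (ENNReal.ofReal R ^ (-(N : ℝ)) *
      ∫⁻ z in Metric.ball x R, ‖f z - k‖ₑ ^ p) := by
  have hp0 : 0 < p := by linarith
  have hηm := (mollifier N R hR).continuous.measurable
  calc _ ≤ (∫⁻ y, ‖mollifier N R hR y‖ₑ * ‖f (x + y) - k‖ₑ) ^ p := by
        gcongr
        exact enorm_moll_sub_le (mollifier N R hR).continuous (mollifier N R hR).hasCompactSupport
          integral_mollifier hf k x
    _ ≤ ∫⁻ y, ‖mollifier N R hR y‖ₑ * ‖f (x + y) - k‖ₑ ^ p := by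
        have hm1 : Measurable fun y => ‖mollifier N R hR y‖ₑ := by fun_prop
        have hm2 : Measurable fun y => ‖f (x + y) - k‖ₑ := by fun_prop
        have h := lintegral_mul_rpow_le (ν := volume) hp hm1 hm2
        rwa [lintegral_enorm_mollifier, ENNReal.one_rpow, one_mul] at h
    _ ≤ ∫⁻ y in Metric.ball (0 : Eu N) R,
          c * ENNReal.ofReal R ^ (-(N : ℝ)) * ‖f (x + y) - k‖ₑ ^ p := by
        rw [← lintegral_indicator measurableSet_ball]
        refine lintegral_mono fun z => ?_
        by_cases hz : mollifier N R hR z = 0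
        · simp [hz]
        · have : z ∈ Metric.ball (0 : Eu N) R := by
            simpa using norm_lt_of_mollifier_ne_zero hz
          rw [Set.indicator_of_mem this]
          gcongr
          exact hc z
    _ = _ := by
        rw [lintegral_const_mul _ (by fun_prop),
          setLIntegral_ball_translate (fun z => ‖f z - k‖ₑ ^ p), mul_assoc]

theorem ofReal_rpow_le_wt {R a : ℝ} {y : Eu N} (hR : 0 < R) (h1 : R ≤ (1 + ‖y‖) / 2)
    (h2 : (1 + ‖y‖) / 4 ≤ R) :
    ENNReal.ofReal R ^ a ≤ ENNReal.ofReal (4 ^ |a|) * wt a y := by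
  have hy := one_add_norm_pos y
  rw [ENNReal.ofReal_rpow_of_pos hR, wt, ← ENNReal.ofReal_mul (by positivity)]
  exact ENNReal.ofReal_le_ofReal
    (rpow_le_rpow_abs (by norm_num) hR hy (by linarith) (by linarith))

/-- For R comparable to 1 + |y| and at most half of it, 1 + |z| is comparable to 1 + |y| on B(y, R),
so powers of R become weights at z. The ball lies in an exterior region that recedes with y, which
later gives decay. -/
theorem ofReal_rpow_mul_setLIntegral_le {R a b : ℝ} {y : Eu N} (hR : 0 < R)
    (h1 : R ≤ (1 + ‖y‖) / 2) (h2 : (1 + ‖y‖) / 4 ≤ R) {v : Eu N → ℝ≥0∞} (hv : Measurable v) :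
    wt b y * (ENNReal.ofReal R ^ a * ∫⁻ z in Metric.ball y R, v z) ≤
      (ENNReal.ofReal (4 ^ |a|) * ENNReal.ofReal (2 ^ |b + a|)) *
        ∫⁻ z in {z | (1 + ‖y‖) / 2 ≤ 1 + ‖z‖}, wt (b + a) z * v z := by
  have hb : ∀ z ∈ Metric.ball y R,
      1 + ‖y‖ ≤ 2 * (1 + ‖z‖) ∧ 1 + ‖z‖ ≤ 2 * (1 + ‖y‖) := by
    intro z hz
    rw [mem_ball_iff_norm] at hz
    have h3 := norm_sub_norm_le z y
    have h4 := norm_sub_norm_le y z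
    rw [norm_sub_rev] at h4
    constructor <;> linarith [norm_nonneg y]
  have hm : Measurable fun z => wt (b + a) z * v z := measurable_wt.mul hv
  calc _ ≤ wt b y * (ENNReal.ofReal (4 ^ |a|) * wt a y * ∫⁻ z in Metric.ball y R, v z) := by
        gcongr; exact ofReal_rpow_le_wt hR h1 h2
    _ = ENNReal.ofReal (4 ^ |a|) * ∫⁻ z in Metric.ball y R, wt (b + a) y * v z := by
        rw [lintegral_const_mul _ hv, wt_add]; ring
    _ ≤ ENNReal.ofReal (4 ^ |a|) * ∫⁻ z in Metric.ball y R,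
          ENNReal.ofReal (2 ^ |b + a|) * (wt (b + a) z * v z) := by
        gcongr ENNReal.ofReal _ * ?_
        refine setLIntegral_mono' measurableSet_ball fun z hz => ?_
        rw [← mul_assoc]
        gcongr
        exact wt_le_of_comparable (by norm_num) (hb z hz).1 (hb z hz).2
    _ = (ENNReal.ofReal (4 ^ |a|) * ENNReal.ofReal (2 ^ |b + a|)) *
          ∫⁻ z in Metric.ball y R, wt (b + a) z * v z := by
        rw [lintegral_const_mul _ hm, mul_assoc]
    _ ≤ _ := by
        gcongr
        intro z hz
        have := (hb z hz).1
        change (1 + ‖y‖) / 2 ≤ 1 + ‖z‖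
        linarith

/-- Pointwise growth estimate above the critical exponent. -/
theorem exists_wt_mul_enorm_sub_le (hp : 1 ≤ p) (hNp : Supercritical N p) (s : ℝ) :
    ∃ C : ℝ≥0∞, C ≠ ∞ ∧ ∀ (u : Distr N) (f : Eu N → ℝ) (g : Eu N → Eu N), IsGivenBy u f →
      (∀ i, IsGivenBy (∂_{EuclideanSpace.single i (1 : ℝ)} u) (fun x => g x i)) →
      Measurable f → Measurable g → ∀ k : ℝ, ∀ᵐ y,
        (wt (-(s + 1)) y * ‖f y - k‖ₑ) ^ p ≤ C * ∫⁻ z in {z | (1 + ‖y‖) / 2 ≤ 1 + ‖z‖},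
          (wt (-(s * p) - N) z * ‖g z‖ₑ ^ p + wt (-((s + 1) * p) - N) z * ‖f z - k‖ₑ ^ p) := by
  have hp0 : 0 < p := by linarith
  obtain ⟨c, hc, hcR⟩ := exists_enorm_mollifier_le N
  obtain ⟨C, hC, hCR⟩ := exists_enorm_segPart_mollifier_le (N := N) hp hNp
  set b := -(s + 1) * p
  set K₁ := ENNReal.ofReal (4 ^ |-(N : ℝ)|) * ENNReal.ofReal (2 ^ |b + -(N : ℝ)|)
  set K₂ := ENNReal.ofReal (4 ^ |p - N|) * ENNReal.ofReal (2 ^ |b + (p - N)|)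
  have hK₁ : K₁ ≠ ∞ := ENNReal.mul_ne_top ENNReal.ofReal_ne_top ENNReal.ofReal_ne_top
  have hK₂ : K₂ ≠ ∞ := ENNReal.mul_ne_top ENNReal.ofReal_ne_top ENNReal.ofReal_ne_top
  have h2p : (2 : ℝ≥0∞) ^ (p - 1) ≠ ∞ := ENNReal.rpow_ne_top_of_nonneg (by linarith) (by simp)
  refine ⟨2 ^ (p - 1) * (c * K₁ + C ^ p * K₂), ENNReal.mul_ne_top h2p (ENNReal.add_ne_top.2
    ⟨ENNReal.mul_ne_top hc hK₁, ENNReal.mul_ne_top (ENNReal.rpow_ne_top_of_nonneg hp0.le hC) hK₂⟩),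
    fun u f g hf hu hfm hgm k => ?_⟩
  -- The averaging identity holds off a null set depending on the radius. Dyadic radii leave
  -- countably many null sets and still contain one comparable to 1 + |y|.
  have hR : ∀ n : ℕ, (0 : ℝ) < 2 ^ n / 2 := fun n => by positivity
  have hae : ∀ n : ℕ, ∀ᵐ y, f y = moll (mollifier N (2 ^ n / 2) (hR n)) f y -
      segPart (mollifier N (2 ^ n / 2) (hR n)) g y := fun n =>
    IsGivenBy.ae_eq_average hf hu _ integral_mollifier
  rw [← ae_all_iff] at hae
  filter_upwards [hae] with y hy
  obtain ⟨n, hn1, hn2⟩ := exists_nat_pow_near (show (1 : ℝ) ≤ 1 + ‖y‖ by simp) one_lt_two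
  set R : ℝ := 2 ^ n / 2 with hRdef
  have h1 : R ≤ (1 + ‖y‖) / 2 := by linarith
  have h2 : (1 + ‖y‖) / 4 ≤ R := by rw [pow_succ] at hn2; linarith
  set J := ∫⁻ z in {z | (1 + ‖y‖) / 2 ≤ 1 + ‖z‖},
          (wt (-(s * p) - N) z * ‖g z‖ₑ ^ p + wt (-((s + 1) * p) - N) z * ‖f z - k‖ₑ ^ p) with hJ
  -- With b = -(s + 1)p, the factors R^(-N) and R^(p-N) produce exactly the weights of f - k at
  -- growth s + 1 and of g at growth s.
  have e1 : b + -(N : ℝ) = -((s + 1) * p) - N := by simp only [b]; ring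
  have e2 : b + (p - N) = -(s * p) - N := by simp only [b]; ring
  have hA := ofReal_rpow_mul_setLIntegral_le (a := -(N : ℝ)) (b := b) (hR n) h1 h2
    (v := fun z => ‖f z - k‖ₑ ^ p) (by fun_prop)
  have hB := ofReal_rpow_mul_setLIntegral_le (a := p - N) (b := b) (hR n) h1 h2
    (v := fun z => ‖g z‖ₑ ^ p) (by fun_prop)
  have hA' : ∫⁻ z in {z | (1 + ‖y‖) / 2 ≤ 1 + ‖z‖}, wt (b + -(N : ℝ)) z * ‖f z - k‖ₑ ^ p ≤ J := by
    rw [e1]; exact lintegral_mono fun z => le_add_self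
  have hB' : ∫⁻ z in {z | (1 + ‖y‖) / 2 ≤ 1 + ‖z‖}, wt (b + (p - N)) z * ‖g z‖ₑ ^ p ≤ J := by
    rw [e2]; exact lintegral_mono fun z => le_self_add
  have hm := enorm_moll_sub_rpow_le hp (hcR R (hR n)) hf.1 hfm k y
  have hs : ‖segPart (mollifier N R (hR n)) g y‖ₑ ^ p ≤ C ^ p * (ENNReal.ofReal R ^ (p - N) *
      ∫⁻ z in Metric.ball y R, ‖g z‖ₑ ^ p) := by
    refine (ENNReal.rpow_le_rpow (hCR R (hR n) g hgm y) hp0.le).trans (le_of_eq ?_)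
    rw [ENNReal.mul_rpow_of_nonneg _ _ hp0.le, ENNReal.mul_rpow_of_nonneg _ _ hp0.le,
      ← ENNReal.rpow_mul, ← ENNReal.rpow_mul, one_div_mul_cancel hp0.ne', ENNReal.rpow_one]
    congr 4
    field_simp
  have hsplit : ‖f y - k‖ₑ ^ p ≤ 2 ^ (p - 1) * (‖moll (mollifier N R (hR n)) f y - k‖ₑ ^ p +
      ‖segPart (mollifier N R (hR n)) g y‖ₑ ^ p) := by
    refine le_trans ?_ (ENNReal.rpow_add_le_mul_rpow_add_rpow _ _ hp)
    gcongr
    have : f y - k = (moll (mollifier N R (hR n)) f y - k) -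
        segPart (mollifier N R (hR n)) g y := by rw [hy n]; ring
    rw [this]
    exact enorm_sub_le
  rw [ENNReal.mul_rpow_of_nonneg _ _ hp0.le, wt_rpow hp0.le]
  calc wt b y * ‖f y - k‖ₑ ^ p
      ≤ wt b y * (2 ^ (p - 1) * (c * (ENNReal.ofReal R ^ (-(N : ℝ)) *
          ∫⁻ z in Metric.ball y R, ‖f z - k‖ₑ ^ p) + C ^ p * (ENNReal.ofReal R ^ (p - N) *
          ∫⁻ z in Metric.ball y R, ‖g z‖ₑ ^ p))) := by
        gcongr
        exact hsplit.trans (by gcongr)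
    _ = 2 ^ (p - 1) * (c * (wt b y * (ENNReal.ofReal R ^ (-(N : ℝ)) *
          ∫⁻ z in Metric.ball y R, ‖f z - k‖ₑ ^ p)) + C ^ p * (wt b y *
          (ENNReal.ofReal R ^ (p - N) * ∫⁻ z in Metric.ball y R, ‖g z‖ₑ ^ p))) := by ring
    _ ≤ 2 ^ (p - 1) * (c * (K₁ * J) + C ^ p * (K₂ * J)) := by
        have hA2 := hA.trans (mul_le_mul_right hA' _)
        have hB2 := hB.trans (mul_le_mul_right hB' _)
        exact mul_le_mul_right (add_le_add (mul_le_mul_right hA2 _) (mul_le_mul_right hB2 _)) _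
    _ = _ := by ring

end Pointwise

/-! ### Continuous representative and decay at infinity -/

section Continuity

variable {N : ℕ} {p s : ℝ}

/-- A violation would persist on a nonempty open set, which has positive measure. -/
theorem forall_le_of_ae_le {h : Eu N → ℝ} (hh : Continuous h) {U : Set (Eu N)} (hU : IsOpen U)
    {ε : ℝ} (hae : ∀ᵐ y, y ∈ U → h y ≤ ε) : ∀ y ∈ U, h y ≤ ε := by
  intro y hy
  by_contra! hlt
  have ho : IsOpen (U ∩ {z | ε < h z}) := hU.inter (isOpen_lt continuous_const hh)
  refine (ho.measure_pos volume ⟨y, hy, hlt⟩).ne' (measure_mono_null ?_ (ae_iff.1 hae))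
  rintro z ⟨hz1, hz2⟩ hz3
  exact absurd (hz3 hz1) (not_le.2 hz2)

/-- Closeness to f almost everywhere makes `F n` and `F m` close almost everywhere, hence everywhere
by continuity. The sequence is then uniformly Cauchy on balls and its limit is continuous. -/
theorem exists_continuous_ae_eq {F : ℕ → Eu N → ℝ} (hF : ∀ n, Continuous (F n)) {f : Eu N → ℝ}
    (hlim : ∀ᵐ y, Tendsto (fun n => F n y) atTop (𝓝 (f y)))
    (h : ∀ R : ℝ, 0 < R → ∀ ε : ℝ, 0 < ε →
      ∀ᶠ n in atTop, ∀ᵐ y, y ∈ Metric.ball (0 : Eu N) R → |f y - F n y| ≤ ε) :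
    ∃ f₀ : Eu N → ℝ, Continuous f₀ ∧ f =ᵐ[volume] f₀ := by
  have hcau : ∀ R : ℝ, 0 < R → UniformCauchySeqOn F atTop (Metric.ball (0 : Eu N) R) := by
    intro R hR
    rw [Metric.uniformCauchySeqOn_iff]
    intro ε hε
    obtain ⟨n₀, hn₀⟩ := eventually_atTop.1 (h R hR (ε / 3) (by positivity))
    refine ⟨n₀, fun m hm n hn x hx => ?_⟩
    have hmn : |F m x - F n x| ≤ 2 * (ε / 3) := by
      refine forall_le_of_ae_le (((hF m).sub (hF n)).abs) Metric.isOpen_ball ?_ x hx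
      filter_upwards [hn₀ m hm, hn₀ n hn] with y h1 h2 hy
      have h1 := abs_le.1 (h1 hy)
      have h2 := abs_le.1 (h2 hy)
      change |F m y - F n y| ≤ _
      exact abs_le.2 ⟨by linarith, by linarith⟩
    rw [Real.dist_eq]
    linarith
  have hex : ∀ x : Eu N, ∃ l, Tendsto (fun n => F n x) atTop (𝓝 l) := fun x =>
    cauchySeq_tendsto_of_complete ((hcau (‖x‖ + 1) (by positivity)).cauchySeq (by simp))
  choose f₀ hf₀ using hex
  refine ⟨f₀, ?_, ?_⟩
  · refine continuous_iff_continuousAt.2 fun x => ?_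
    have hu := (hcau (‖x‖ + 1) (by positivity)).tendstoUniformlyOn_of_tendsto
      fun y _ => hf₀ y
    have hc : ContinuousOn f₀ (Metric.ball (0 : Eu N) (‖x‖ + 1)) :=
      hu.continuousOn (Frequently.of_forall fun n => (hF n).continuousOn)
    exact hc.continuousAt (Metric.isOpen_ball.mem_nhds (by simp))
  · filter_upwards [hlim] with y hy
    exact tendsto_nhds_unique hy (hf₀ y)

theorem setLIntegral_ball_ne_top_of_wInt {v : Eu N → ℝ≥0∞} (h : wInt p s v ≠ ∞)
    (R : ℝ) : ∫⁻ z in Metric.ball (0 : Eu N) R, v z ^ p ≠ ∞ := by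
  set K := ENNReal.ofReal ((1 + R) ^ |-(s * p) - (N : ℝ)|)
  have h1 : ∫⁻ z in Metric.ball (0 : Eu N) R, v z ^ p ≤ K * wInt p s v := by
    calc _ ≤ ∫⁻ z in Metric.ball (0 : Eu N) R, K * (wt (-(s * p) - N) z * v z ^ p) := by
          refine setLIntegral_mono' measurableSet_ball fun z hz => ?_
          rw [← mul_assoc]
          exact le_mul_of_one_le_left zero_le
            (wt_le_wt_of_norm_le (mem_ball_zero_iff.1 hz).le).2
      _ = K * ∫⁻ z in Metric.ball (0 : Eu N) R, wt (-(s * p) - N) z * v z ^ p :=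
          lintegral_const_mul' _ _ ENNReal.ofReal_ne_top
      _ ≤ _ := by
          gcongr
          exact setLIntegral_le_lintegral _ _
  exact (h1.trans_lt (ENNReal.mul_lt_top ENNReal.ofReal_lt_top h.lt_top)).ne

/-- The error of mollification is a `segPart`, so the Morrey estimate makes the convergence locally
uniform. -/
theorem exists_continuous_representative (hN : 1 ≤ N) (hp : 1 ≤ p) (hNp : Supercritical N p)
    {u : Distr N} {f : Eu N → ℝ} {g : Eu N → Eu N} (hf : IsGivenBy u f)
    (hu : ∀ i, IsGivenBy (∂_{EuclideanSpace.single i (1 : ℝ)} u) (fun x => g x i))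
    (hgm : Measurable g) (hg : wInt p s (fun x => ‖g x‖ₑ) ≠ ∞) :
    ∃ f₀ : Eu N → ℝ, Continuous f₀ ∧ f =ᵐ[volume] f₀ := by
  have hp0 : 0 < p := by linarith
  obtain ⟨C, hC, hCR⟩ := exists_enorm_segPart_mollifier_le (N := N) hp hNp
  have hη : ∀ n, ContDiff ℝ 1 (mollSeq N n) := fun n =>
    (mollSeq N n).contDiff.of_le (by exact_mod_cast le_top)
  refine exists_continuous_ae_eq (F := fun n => moll (mollSeq N n) f)
    (fun n => (contDiff_moll (hη n) (mollSeq N n).hasCompactSupport hf.1).continuous)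
    (ae_tendsto_moll hf.1) fun R hR ε hε => ?_
  have hNp1 : 0 ≤ 1 - N / p := by
    rw [sub_nonneg, div_le_one hp0]
    rcases hNp with h | h
    · exact h.le
    · exact h.1.ge
  obtain ⟨κ, hκ, hκε⟩ : ∃ κ : ℝ≥0∞, κ ≠ 0 ∧ C * κ ^ (1 / p) ≤ ENNReal.ofReal ε := by
    refine ⟨(ENNReal.ofReal ε / (C + 1)) ^ p, ?_, ?_⟩
    · rw [Ne, ENNReal.rpow_eq_zero_iff_of_pos hp0, ENNReal.div_eq_zero_iff]
      simp [hC, hε]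
    · rw [← ENNReal.rpow_mul, mul_one_div_cancel hp0.ne', ENNReal.rpow_one]
      calc _ ≤ (C + 1) * (ENNReal.ofReal ε / (C + 1)) := by gcongr; exact le_self_add
        _ ≤ _ := ENNReal.mul_div_le
  -- Smallness comes from absolute continuity of the integral of |g|^p over small balls, as the
  -- power R^(1 - N/p) gives none when N = p = 1.
  obtain ⟨δ, hδ, hδκ⟩ := exists_pos_setLIntegral_lt_of_measure_lt
    (setLIntegral_ball_ne_top_of_wInt hg (R + 1)) hκ
  have hvol : Tendsto (fun n : ℕ => ENNReal.ofReal (1 / ((n : ℝ) + 1)) ^ (N : ℝ) *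
      volume (Metric.ball (0 : Eu N) 1)) atTop (𝓝 0) := by
    have h1 : Tendsto (fun n : ℕ => ENNReal.ofReal (1 / ((n : ℝ) + 1))) atTop (𝓝 0) := by
      simpa using ENNReal.tendsto_ofReal (tendsto_one_div_add_atTop_nhds_zero_nat (𝕜 := ℝ))
    have h2 := (ENNReal.continuous_rpow_const (y := (N : ℝ))).tendsto 0 |>.comp h1
    rw [ENNReal.zero_rpow_of_pos (by exact_mod_cast hN)] at h2
    simpa using ENNReal.Tendsto.mul_const h2 (Or.inr measure_ball_lt_top.ne)
  filter_upwards [hvol.eventually_lt_const hδ] with n hn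
  filter_upwards [IsGivenBy.ae_eq_average hf hu (mollSeq N n) integral_mollifier] with y hy hyR
  have hRn : 0 < 1 / ((n : ℝ) + 1) := by positivity
  have hRn1 : 1 / ((n : ℝ) + 1) ≤ 1 := by
    rw [div_le_one (by positivity)]; linarith [n.cast_nonneg (α := ℝ)]
  have hsub : Metric.ball y (1 / ((n : ℝ) + 1)) ⊆ Metric.ball (0 : Eu N) (R + 1) := by
    refine Metric.ball_subset_ball' ?_
    rw [dist_zero_right]
    linarith [mem_ball_zero_iff.1 hyR]
  have hsm : ∫⁻ z in Metric.ball y (1 / ((n : ℝ) + 1)), ‖g z‖ₑ ^ p ≤ κ := by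
    have := hδκ (Metric.ball y (1 / ((n : ℝ) + 1))) (by
      rw [Measure.restrict_apply measurableSet_ball]
      refine (measure_mono Set.inter_subset_left).trans_lt ?_
      rwa [volume_ball_eq hRn])
    rw [Measure.restrict_restrict measurableSet_ball, Set.inter_eq_left.2 hsub] at this
    exact this.le
  have hle : ‖segPart (mollSeq N n) g y‖ₑ ≤ ENNReal.ofReal ε := by
    refine (hCR _ hRn g hgm y).trans (le_trans ?_ hκε)
    gcongr
    calc _ ≤ 1 * κ ^ (1 / p) := by
          gcongr
          exact ENNReal.rpow_le_one (ENNReal.ofReal_le_one.2 hRn1) hNp1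
      _ = _ := one_mul _
  have : f y - moll (mollSeq N n) f y = -segPart (mollSeq N n) g y := by
    rw [hy]; simp [moll]
  change |f y - moll (mollSeq N n) f y| ≤ ε
  rw [this, abs_neg]
  rw [← ofReal_norm, ENNReal.ofReal_le_ofReal_iff hε.le] at hle
  exact hle

theorem tendsto_setLIntegral_exterior {G : Eu N → ℝ≥0∞} (hG : ∫⁻ z, G z ≠ ∞) :
    Tendsto (fun n : ℕ => ∫⁻ z in {z : Eu N | (n : ℝ) ≤ 1 + ‖z‖}, G z) atTop (𝓝 0) := by
  have hmeas : ∀ n : ℕ, MeasurableSet {z : Eu N | (n : ℝ) ≤ 1 + ‖z‖} := fun n =>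
    measurableSet_le measurable_const (by fun_prop)
  have hfin : IsFiniteMeasure (volume.withDensity G) :=
    ⟨by rw [withDensity_apply _ MeasurableSet.univ, Measure.restrict_univ]; exact hG.lt_top⟩
  have h := tendsto_measure_iInter_atTop (μ := volume.withDensity G)
    (s := fun n : ℕ => {z : Eu N | (n : ℝ) ≤ 1 + ‖z‖}) (fun n => (hmeas n).nullMeasurableSet)
    (fun m n hmn z hz => le_trans (Nat.cast_le.2 hmn) (show (n : ℝ) ≤ 1 + ‖z‖ from hz)) ⟨0, measure_ne_top _ _⟩
  have he : ⋂ n : ℕ, {z : Eu N | (n : ℝ) ≤ 1 + ‖z‖} = ∅ := by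
    refine Set.eq_empty_of_forall_notMem fun z hz => ?_
    obtain ⟨n, hn⟩ := exists_nat_gt (1 + ‖z‖)
    exact absurd (Set.mem_iInter.1 hz n) (not_le.2 hn)
  rw [he, measure_empty] at h
  exact h.congr fun n => withDensity_apply _ (hmeas n)

/-- The pointwise bound is by the tail of a convergent integral, and it holds at every point by
continuity. The constant k is negligible because s + 1 > 0. -/
theorem tendsto_of_continuous_representative (hs : -1 < s) (hp : 1 ≤ p)
    (hNp : Supercritical N p) {u : Distr N} {f : Eu N → ℝ} {g : Eu N → Eu N} (hf : IsGivenBy u f)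
    (hu : ∀ i, IsGivenBy (∂_{EuclideanSpace.single i (1 : ℝ)} u) (fun x => g x i))
    (hfc : Continuous f) (hgm : Measurable g) (hg : wInt p s (fun x => ‖g x‖ₑ) ≠ ∞) {k : ℝ}
    (hk : wInt p (s + 1) (fun x => ‖f x - k‖ₑ) ≠ ∞) :
    Tendsto (fun x => ‖x‖ ^ (-(s + 1)) * f x) (Bornology.cobounded (Eu N)) (𝓝 0) := by
  have hp0 : 0 < p := by linarith
  obtain ⟨C, hC, hCf⟩ := exists_wt_mul_enorm_sub_le (N := N) hp hNp s
  have hbd := hCf u f g hf hu hfc.measurable hgm k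
  set G : Eu N → ℝ≥0∞ := fun z =>
    wt (-(s * p) - N) z * ‖g z‖ₑ ^ p + wt (-((s + 1) * p) - N) z * ‖f z - k‖ₑ ^ p
  have hG : ∫⁻ z, G z ≠ ∞ := by
    rw [lintegral_add_left (measurable_wt_mul hgm.enorm)]
    exact ENNReal.add_ne_top.2 ⟨hg, hk⟩
  have ht : Tendsto (fun n : ℕ => C * ∫⁻ z in {z : Eu N | (n : ℝ) ≤ 1 + ‖z‖}, G z)
      atTop (𝓝 0) := by
    simpa using ENNReal.Tendsto.const_mul (tendsto_setLIntegral_exterior hG) (Or.inr hC)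
  let h : Eu N → ℝ := fun y => (1 + ‖y‖) ^ (-(s + 1)) * |f y - k|
  have hh0 : ∀ y, 0 ≤ h y := fun y => by positivity
  have hhc : Continuous h := by
    refine Continuous.mul ?_ (hfc.sub continuous_const).abs
    exact (continuous_const.add continuous_norm).rpow_const fun x =>
      Or.inl (one_add_norm_pos x).ne'
  have hlim : Tendsto h (Bornology.cobounded (Eu N)) (𝓝 0) := by
    rw [Metric.tendsto_nhds]
    intro ε hε
    have hεp : 0 < ENNReal.ofReal (ε / 2) ^ p :=
      ENNReal.rpow_pos (by simpa using hε) ENNReal.ofReal_ne_top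
    obtain ⟨n, hn⟩ := (ht.eventually_lt_const hεp).exists
    have hU : IsOpen {y : Eu N | 2 * (n : ℝ) < ‖y‖} := isOpen_lt continuous_const continuous_norm
    have hall := forall_le_of_ae_le hhc hU (ε := ε / 2) (by
      filter_upwards [hbd] with y hy hyn
      have h1 : (wt (-(s + 1)) y * ‖f y - k‖ₑ) ^ p ≤ ENNReal.ofReal (ε / 2) ^ p := by
        refine hy.trans (le_trans ?_ hn.le)
        refine mul_le_mul_right (lintegral_mono_set fun z hz => ?_) _
        change (1 + ‖y‖) / 2 ≤ 1 + ‖z‖ at hz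
        change 2 * (n : ℝ) < ‖y‖ at hyn
        change (n : ℝ) ≤ 1 + ‖z‖
        linarith
      rw [ENNReal.rpow_le_rpow_iff hp0, wt, ← ofReal_norm, Real.norm_eq_abs,
        ← ENNReal.ofReal_mul (by positivity),
        ENNReal.ofReal_le_ofReal_iff (by positivity)] at h1
      exact h1)
    have hev : ∀ᶠ y in Bornology.cobounded (Eu N), 2 * (n : ℝ) < ‖y‖ :=
      tendsto_norm_cobounded_atTop.eventually_gt_atTop _
    filter_upwards [hev] with y hy
    rw [Real.dist_0_eq_abs, abs_of_nonneg (hh0 y)]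
    linarith [hall y hy]
  have hneg : Tendsto (fun y : Eu N => ‖y‖ ^ (-(s + 1)) * |k|) (Bornology.cobounded (Eu N))
      (𝓝 0) := by
    have := ((tendsto_rpow_neg_atTop (show 0 < s + 1 by linarith)).comp
      (tendsto_norm_cobounded_atTop (E := Eu N))).mul_const |k|
    simpa using this
  have hsum : Tendsto (fun y => 2 ^ (s + 1) * h y + ‖y‖ ^ (-(s + 1)) * |k|)
      (Bornology.cobounded (Eu N)) (𝓝 0) := by
    simpa only [mul_zero, add_zero] using (hlim.const_mul (2 ^ (s + 1))).add hneg
  refine squeeze_zero_norm' ?_ hsum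
  filter_upwards [tendsto_norm_cobounded_atTop.eventually_ge_atTop 1] with y hy
  have hy0 : 0 < ‖y‖ := by linarith
  -- Since |y| ≥ 1, one has 1 + |y| ≤ 2|y|, so the two weights are interchangeable.
  have hw : ‖y‖ ^ (-(s + 1)) ≤ 2 ^ (s + 1) * (1 + ‖y‖) ^ (-(s + 1)) := by
    rw [Real.rpow_neg hy0.le, Real.rpow_neg (by positivity), ← div_eq_mul_inv,
      inv_eq_one_div, div_le_div_iff₀ (by positivity) (by positivity), one_mul,
      ← Real.mul_rpow (by norm_num) hy0.le]
    exact Real.rpow_le_rpow (by positivity) (by linarith) (by linarith)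
  rw [norm_mul, Real.norm_of_nonneg (by positivity), Real.norm_eq_abs]
  have h3 : |f y| ≤ |f y - k| + |k| := by simpa using abs_add_le (f y - k) k
  calc ‖y‖ ^ (-(s + 1)) * |f y| ≤ ‖y‖ ^ (-(s + 1)) * (|f y - k| + |k|) := by gcongr
    _ = ‖y‖ ^ (-(s + 1)) * |f y - k| + ‖y‖ ^ (-(s + 1)) * |k| := by ring
    _ ≤ 2 ^ (s + 1) * (1 + ‖y‖) ^ (-(s + 1)) * |f y - k| + ‖y‖ ^ (-(s + 1)) * |k| := by gcongr
    _ = _ := by simp only [h]; rw [mul_assoc]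

end Continuity

/-! ### Gradient bounds for all admissible exponents -/

section Interpolation

variable {N : ℕ} {p q r s t ρ : ℝ} {v : Eu N → ℝ≥0∞}

/-- Hölder's inequality in Lyapunov form; the exponent of the weight is affine in q, so weights
interpolate exactly. -/
theorem wInt_le_rpow_mul_rpow {θ : ℝ} (hθ : 0 ≤ θ) (hθ1 : θ ≤ 1) (hp : 0 ≤ p) (hr : 0 ≤ r)
    (hq : q = θ * p + (1 - θ) * r) (hv : Measurable v) :
    wInt q t v ≤ wInt p t v ^ θ * wInt r t v ^ (1 - θ) := by
  have hθ2 : 0 ≤ 1 - θ := by linarith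
  refine le_trans (le_of_eq (lintegral_congr fun x => ?_))
    (ENNReal.lintegral_mul_norm_pow_le (measurable_wt_mul hv).aemeasurable
      (measurable_wt_mul hv).aemeasurable hθ hθ2 (by ring))
  rw [ENNReal.mul_rpow_of_nonneg _ _ hθ, ENNReal.mul_rpow_of_nonneg _ _ hθ2, wt_rpow hθ,
    wt_rpow hθ2, ← ENNReal.rpow_mul, ← ENNReal.rpow_mul]
  rw [show -(t * q) - (N : ℝ) = (-(t * p) - N) * θ + (-(t * r) - N) * (1 - θ) by rw [hq]; ring,
    wt_add, hq, mul_comm θ, mul_comm (1 - θ),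
    ENNReal.rpow_add_of_nonneg _ _ (mul_nonneg hp hθ) (mul_nonneg hr hθ2)]
  ring

/-- Interpolation with the endpoint ∞: the power q is split into q - p, bounded pointwise, and p,
integrated. -/
theorem wInt_le_of_ae_le (hp : 0 ≤ p) (hpq : p ≤ q) (hv : Measurable v) {B : ℝ≥0∞}
    (hB : ∀ᵐ x, wt (-t) x * v x ≤ B) : wInt q t v ≤ B ^ (q - p) * wInt p t v := by
  have hqp : 0 ≤ q - p := by linarith
  unfold wInt
  rw [← lintegral_const_mul _ (measurable_wt_mul hv)]
  refine lintegral_mono_ae ?_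
  filter_upwards [hB] with x hx
  calc wt (-(t * q) - N) x * v x ^ q
      = (wt (-t) x * v x) ^ (q - p) * (wt (-(t * p) - N) x * v x ^ p) := by
        rw [ENNReal.mul_rpow_of_nonneg _ _ hqp, wt_rpow hqp,
          show -(t * q) - (N : ℝ) = -t * (q - p) + (-(t * p) - N) by ring, wt_add]
        have e : v x ^ q = v x ^ (q - p) * v x ^ p := by
          rw [← ENNReal.rpow_add_of_nonneg _ _ hqp hp, sub_add_cancel]
        rw [e]
        ring
    _ ≤ _ := by gcongr

/-- The deviation from the mean is bounded by the gradient, with exponent `q` on the left. -/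
def GradientBound (N : ℕ) (p s ρ q : ℝ) : Prop :=
  ∃ C : ℝ≥0∞, C ≠ ∞ ∧ ∀ (u : Distr N) (f : Eu N → ℝ) (g : Eu N → Eu N), IsGivenBy u f →
    (∀ i, IsGivenBy (∂_{EuclideanSpace.single i (1 : ℝ)} u) (fun x => g x i)) →
    Measurable f → Measurable g →
    wInt q (s + 1) (fun x => ‖f x - ballMean ρ f‖ₑ) ≤ C * wInt p s (fun x => ‖g x‖ₑ) ^ (q / p)

/-- The deviation from the mean is bounded by the gradient, in the supremum norm. -/
def GradientBoundTop (N : ℕ) (p s ρ : ℝ) : Prop :=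
  ∃ C : ℝ≥0∞, C ≠ ∞ ∧ ∀ (u : Distr N) (f : Eu N → ℝ) (g : Eu N → Eu N), IsGivenBy u f →
    (∀ i, IsGivenBy (∂_{EuclideanSpace.single i (1 : ℝ)} u) (fun x => g x i)) →
    Measurable f → Measurable g →
    ∀ᵐ x, wt (-(s + 1)) x * ‖f x - ballMean ρ f‖ₑ ≤ C * wInt p s (fun x => ‖g x‖ₑ) ^ (1 / p)

/-- The representation formula bounds the deviation from u(η) by the two potentials, and u(η) is
then replaced by the mean over the ball. -/
theorem gradientBound_self (hs : -1 < s) (hp : 1 ≤ p) (hρ : 0 < ρ) : GradientBound N p s ρ p := by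
  have hp0 : 0 < p := by linarith
  set η := mollifier N 1 one_pos
  obtain ⟨C₁, hC₁, h₁⟩ := exists_wInt_conePart_le (s := s) hs hp η.continuous η.hasCompactSupport
  obtain ⟨C₂, hC₂, h₂⟩ := exists_wInt_segPart_le (s := s) hp η.continuous η.hasCompactSupport
  obtain ⟨C₃, hC₃, h₃⟩ := exists_wInt_sub_ballMean_le (N := N) (show 0 < s + 1 by linarith) hp hρ
  have h2p : (2 : ℝ≥0∞) ^ (p - 1) ≠ ∞ := ENNReal.rpow_ne_top_of_nonneg (by linarith) (by simp)
  refine ⟨C₃ * (2 ^ (p - 1) * (C₁ + C₂)), ENNReal.mul_ne_top hC₃ (ENNReal.mul_ne_top h2p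
    (ENNReal.add_ne_top.2 ⟨hC₁, hC₂⟩)), fun u f g hf hu hfm hgm => ?_⟩
  have hrep := isGivenBy_of_gradient hu η integral_mollifier
  have hae := IsGivenBy.ae_eq hf hrep
  rw [div_self hp0.ne', ENNReal.rpow_one]
  refine (h₃ f hf.1 (u η)).trans ?_
  rw [mul_assoc]
  gcongr
  have hcm : AEMeasurable (fun x => ‖conePart η g x‖ₑ) := by
    have : AEMeasurable (conePart η g) :=
      (locallyIntegrable_conePart (fun i => (hu i).1) η.continuous η.hasCompactSupport).aestronglyMeasurable.aemeasurable
    exact this.enorm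
  calc wInt p (s + 1) (fun x => ‖f x - u η‖ₑ)
      ≤ wInt p (s + 1) (fun x => ‖conePart η g x‖ₑ + ‖segPart η g x‖ₑ) := by
        refine wInt_mono hp0.le ?_
        filter_upwards [hae] with x hx
        have : f x - u η = conePart η g x - segPart η g x := by rw [hx]; ring
        rw [this]
        exact enorm_sub_le
    _ ≤ 2 ^ (p - 1) * (wInt p (s + 1) (fun x => ‖conePart η g x‖ₑ) +
          wInt p (s + 1) (fun x => ‖segPart η g x‖ₑ)) := wInt_add_le hp hcm
    _ ≤ 2 ^ (p - 1) * (C₁ * wInt p s (fun x => ‖g x‖ₑ) + C₂ * wInt p s (fun x => ‖g x‖ₑ)) := by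
        gcongr
        · exact h₁ g hgm
        · exact h₂ g hgm
    _ = _ := by ring

theorem gradientBound_sobolev (hN : 1 ≤ N) (hs : -1 < s) (hρ : 0 < ρ) (hq : 1 ≤ q) (hqp : q ≤ p)
    (hpr : p ≤ r) (hrq : r⁻¹ = q⁻¹ - (N : ℝ)⁻¹) : GradientBound N p s ρ r := by
  have hp : 1 ≤ p := hq.trans hqp
  have hp0 : 0 < p := by linarith
  have hrp : 0 ≤ r / p := div_nonneg (by linarith) hp0.le
  obtain ⟨C, hC, h⟩ := gradientBound_self (N := N) hs hp hρ
  obtain ⟨C', hC', h'⟩ := exists_wInt_sobolev hN s hq hqp hpr hrq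
  refine ⟨C' * (1 + C) ^ (r / p), ENNReal.mul_ne_top hC' (ENNReal.rpow_ne_top_of_nonneg hrp
    (ENNReal.add_ne_top.2 ⟨ENNReal.one_ne_top, hC⟩)), fun u f g hf hu hfm hgm => ?_⟩
  have h1 := h u f g hf hu hfm hgm
  rw [div_self hp0.ne', ENNReal.rpow_one] at h1
  refine (h' u f g hf hu hfm hgm (ballMean ρ f)).trans ?_
  rw [mul_assoc, ← ENNReal.mul_rpow_of_nonneg _ _ hrp, add_mul, one_mul]
  gcongr

/-- The exterior integral is enlarged to the whole space, where the L^p bound already controls f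
minus its mean. -/
theorem gradientBoundTop (hs : -1 < s) (hρ : 0 < ρ) (hp : 1 ≤ p) (hNp : Supercritical N p) :
    GradientBoundTop N p s ρ := by
  have hp0 : 0 < p := by linarith
  have hp1 : 0 ≤ 1 / p := by positivity
  obtain ⟨C, hC, h⟩ := gradientBound_self (N := N) hs hp hρ
  obtain ⟨C', hC', h'⟩ := exists_wt_mul_enorm_sub_le (N := N) hp hNp s
  refine ⟨(C' * (1 + C)) ^ (1 / p), ENNReal.rpow_ne_top_of_nonneg hp1
    (ENNReal.mul_ne_top hC' (ENNReal.add_ne_top.2 ⟨ENNReal.one_ne_top, hC⟩)),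
    fun u f g hf hu hfm hgm => ?_⟩
  have h1 := h u f g hf hu hfm hgm
  rw [div_self hp0.ne', ENNReal.rpow_one] at h1
  filter_upwards [h' u f g hf hu hfm hgm (ballMean ρ f)] with x hx
  rw [← ENNReal.mul_rpow_of_nonneg _ _ hp1, ← ENNReal.rpow_le_rpow_iff hp0, ← ENNReal.rpow_mul,
    one_div_mul_cancel hp0.ne', ENNReal.rpow_one]
  refine hx.trans ?_
  rw [mul_assoc C']
  gcongr C' * ?_
  refine (setLIntegral_le_lintegral _ _).trans ?_
  rw [lintegral_add_left (measurable_wt_mul hgm.enorm), add_mul 1 C, one_mul]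
  exact add_le_add le_rfl h1

theorem GradientBound.interpolate (h : GradientBound N p s ρ p) (h' : GradientBound N p s ρ r)
    (hp : 0 < p) (hpq : p ≤ q) (hqr : q ≤ r) : GradientBound N p s ρ q := by
  -- The case p = r is separated because θ has the denominator r - p.
  rcases eq_or_lt_of_le (hpq.trans hqr) with rfl | hpr
  · rwa [le_antisymm hqr hpq]
  obtain ⟨C, hC, h⟩ := h
  obtain ⟨C', hC', h'⟩ := h'
  have hrp : 0 < r - p := by linarith
  set θ := (r - q) / (r - p)
  have hθ : 0 ≤ θ := div_nonneg (by linarith) hrp.le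
  have hθ1 : θ ≤ 1 := by rw [div_le_one hrp]; linarith
  have hθ2 : 0 ≤ 1 - θ := by linarith
  have hr : 0 ≤ r / p := div_nonneg (by linarith) hp.le
  have hq : q = θ * p + (1 - θ) * r := by simp only [θ]; field_simp; ring
  refine ⟨C ^ θ * C' ^ (1 - θ), ENNReal.mul_ne_top (ENNReal.rpow_ne_top_of_nonneg hθ hC)
    (ENNReal.rpow_ne_top_of_nonneg hθ2 hC'), fun u f g hf hu hfm hgm => ?_⟩
  have h1 := h u f g hf hu hfm hgm
  rw [div_self hp.ne', ENNReal.rpow_one] at h1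
  calc _ ≤ _ := wInt_le_rpow_mul_rpow hθ hθ1 hp.le (by linarith) hq (hfm.sub_const _).enorm
    _ ≤ (C * wInt p s (fun x => ‖g x‖ₑ)) ^ θ *
        (C' * wInt p s (fun x => ‖g x‖ₑ) ^ (r / p)) ^ (1 - θ) := by
        gcongr
        exact h' u f g hf hu hfm hgm
    _ = _ := by
        rw [ENNReal.mul_rpow_of_nonneg _ _ hθ, ENNReal.mul_rpow_of_nonneg _ _ hθ2,
          ← ENNReal.rpow_mul, show q / p = θ + r / p * (1 - θ) by
            rw [div_eq_iff hp.ne']; nth_rewrite 1 [hq]; field_simp,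
          ENNReal.rpow_add_of_nonneg _ _ hθ (mul_nonneg hr hθ2)]
        ring

theorem GradientBoundTop.interpolate (h : GradientBound N p s ρ p)
    (h' : GradientBoundTop N p s ρ) (hp : 0 < p) (hpq : p ≤ q) : GradientBound N p s ρ q := by
  obtain ⟨C, hC, h⟩ := h
  obtain ⟨C', hC', h'⟩ := h'
  have hqp : 0 ≤ q - p := by linarith
  refine ⟨C' ^ (q - p) * C, ENNReal.mul_ne_top (ENNReal.rpow_ne_top_of_nonneg hqp hC') hC,
    fun u f g hf hu hfm hgm => ?_⟩
  have h1 := h u f g hf hu hfm hgm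
  rw [div_self hp.ne', ENNReal.rpow_one] at h1
  calc _ ≤ _ := wInt_le_of_ae_le hp.le hpq (hfm.sub_const _).enorm (h' u f g hf hu hfm hgm)
    _ ≤ (C' * wInt p s (fun x => ‖g x‖ₑ) ^ (1 / p)) ^ (q - p) *
        (C * wInt p s (fun x => ‖g x‖ₑ)) := by gcongr
    _ = _ := by
        rw [ENNReal.mul_rpow_of_nonneg _ _ hqp, ← ENNReal.rpow_mul,
          show q / p = 1 / p * (q - p) + 1 by field_simp; ring,
          ENNReal.rpow_add_of_nonneg _ _ (by positivity) zero_le_one, ENNReal.rpow_one]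
        ring

/-- For p = N > 1, Sobolev reaches each finite q directly; for p < N, interpolate between p and p*;
otherwise, between p and ∞. -/
theorem gradientBound_of_mem_exponentRange (hN : 1 ≤ N) (hs : -1 < s) (hp : 1 ≤ p) (hρ : 0 < ρ)
    (hq0 : 0 ≤ q) (hq : ENNReal.ofReal q ∈ exponentRange N p) : GradientBound N p s ρ q := by
  have hp0 : 0 < p := by linarith
  have hself := gradientBound_self (N := N) hs hp hρ
  have hN0 : (0 : ℝ) < N := by exact_mod_cast hN
  unfold exponentRange at hq
  split_ifs at hq with hc
  · have hpq : p ≤ q := (ENNReal.ofReal_le_ofReal_iff hq0).1 hq.1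
    have hN2 : (2 : ℝ) ≤ N := by exact_mod_cast hc.2
    have hq2 : 2 ≤ q := by linarith [hc.1]
    -- This is the exponent whose Sobolev conjugate is q. It lies in [1, N] because N and q are at
    -- least 2.
    refine gradientBound_sobolev (q := N * q / (N + q)) hN hs hρ ?_ ?_ hpq ?_
    · rw [le_div_iff₀ (by linarith)]; nlinarith
    · rw [div_le_iff₀ (by linarith), hc.1]; nlinarith
    · field_simp; ring
  · have hpq : p ≤ q := (ENNReal.ofReal_le_ofReal_iff hq0).1 hq.1
    by_cases hpN : p < N
    · have hqs := hq.2
      rw [sobolevExponent, if_pos hpN] at hqs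
      have hd : 0 < N - p := by linarith
      rw [ENNReal.ofReal_le_ofReal_iff (by positivity)] at hqs
      refine hself.interpolate (gradientBound_sobolev (r := N * p / (N - p)) hN hs hρ hp le_rfl
        ?_ ?_) hp0 hpq hqs
      · rw [le_div_iff₀ hd]; nlinarith
      · field_simp
    · refine GradientBoundTop.interpolate hself (gradientBoundTop hs hρ hp ?_) hp0 hpq
      rcases eq_or_lt_of_le (not_lt.1 hpN) with h | h
      · exact Or.inr ⟨h.symm, by
          have : ¬ 1 < N := fun h1 => hc ⟨h.symm, h1⟩
          omega⟩
      · exact Or.inl h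

theorem supercritical_of_top_mem (hN : 1 ≤ N) (h : ∞ ∈ exponentRange N p) : Supercritical N p := by
  unfold exponentRange at h
  split_ifs at h with hc
  · exact absurd h.2 (lt_irrefl _)
  · by_cases hpN : p < N
    · have := h.2
      rw [sobolevExponent, if_pos hpN] at this
      exact absurd this (not_le.2 ENNReal.ofReal_lt_top)
    · rcases eq_or_lt_of_le (not_lt.1 hpN) with h | h
      · exact Or.inr ⟨h.symm, by
          have : ¬ 1 < N := fun h1 => hc ⟨h.symm, h1⟩
          omega⟩
      · exact Or.inl h

end Interpolation

/-! ### From weighted integrals to norms and membership -/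

section Norms

variable {N : ℕ} {p q s t ρ : ℝ}

theorem wnorm_ofReal (hp : 0 < p) (f : Eu N → ℝ) :
    wnorm (ENNReal.ofReal p) t f = wInt p t (fun x => ‖f x‖ₑ) ^ (1 / p) := by
  rw [wnorm, eLpNorm_ofReal hp]
  congr 1
  refine lintegral_congr fun x => ?_
  rw [weighted, ENNReal.toReal_ofReal hp.le, enorm_mul, ENNReal.mul_rpow_of_nonneg _ _ hp.le,
    Real.enorm_of_nonneg (by positivity)]
  change wt (-t - N / p) x ^ p * _ = _
  rw [wt_rpow hp.le]
  congr 2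
  field_simp

theorem wnorm_top_le {f : Eu N → ℝ} {B : ℝ≥0∞} (h : ∀ᵐ x, wt (-t) x * ‖f x‖ₑ ≤ B) :
    wnorm ∞ t f ≤ B := by
  rw [wnorm, eLpNorm_exponent_top]
  refine essSup_le_of_ae_le _ ?_
  filter_upwards [h] with x hx
  rw [weighted, enorm_mul, Real.enorm_of_nonneg (by positivity)]
  simpa [wt] using hx

theorem weighted_congr {P : ℝ≥0∞} {f f' : Eu N → ℝ} (h : f =ᵐ[volume] f') :
    weighted P t f =ᵐ[volume] weighted P t f' := by
  filter_upwards [h] with x hx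
  rw [weighted, weighted, hx]

theorem wnorm_congr {P : ℝ≥0∞} {f f' : Eu N → ℝ} (h : f =ᵐ[volume] f') :
    wnorm P t f = wnorm P t f' := eLpNorm_congr_ae (weighted_congr h)

theorem aestronglyMeasurable_weighted {P : ℝ≥0∞} {f : Eu N → ℝ}
    (hf : AEStronglyMeasurable f volume) : AEStronglyMeasurable (weighted P t f) volume := by
  have : Measurable fun x : Eu N => (1 + ‖x‖) ^ (-t - (N : ℝ) / P.toReal) := by fun_prop
  exact this.aestronglyMeasurable.mul hf

theorem wnorm_const_ne_top {P : ℝ≥0∞} (hP : P ≠ 0) (ht : 0 < t) (c : ℝ) :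
    wnorm P t (fun _ : Eu N => c) ≠ ∞ := by
  rcases eq_or_ne P ∞ with rfl | hP'
  · refine ((wnorm_top_le (B := ‖c‖ₑ) (Eventually.of_forall fun x => ?_)).trans_lt
      enorm_lt_top).ne
    calc wt (-t) x * ‖c‖ₑ ≤ wt 0 x * ‖c‖ₑ := by gcongr; exact wt_mono (by linarith)
      _ = ‖c‖ₑ := by rw [wt_zero, one_mul]
  · have hq : 0 < P.toReal := ENNReal.toReal_pos hP hP'
    rw [← ENNReal.ofReal_toReal hP', wnorm_ofReal hq, wInt_const]
    exact ENNReal.rpow_ne_top_of_nonneg (by positivity) (ENNReal.mul_ne_top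
      (ENNReal.rpow_ne_top_of_nonneg hq.le enorm_ne_top) (lintegral_wt_lt_top ht hq).ne)

/-- Constants lie in the space because t > 0, and on compact sets the weight is bounded below, which
gives local integrability to the power P. -/
theorem memWeighted_of_wnorm_sub_ne_top {P : ℝ≥0∞} (hP : P ≠ 0) (ht : 0 < t) {f : Eu N → ℝ}
    (hf : AEStronglyMeasurable f volume) {c : ℝ} (h : wnorm P t (fun x => f x - c) ≠ ∞) :
    MemWeighted P t f := by
  have hmem : MemLp (weighted P t f) P volume := by
    have h1 : MemLp (weighted P t (fun x => f x - c)) P volume :=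
      ⟨aestronglyMeasurable_weighted (hf.sub aestronglyMeasurable_const), h.lt_top⟩
    have h2 : MemLp (weighted P t (fun _ : Eu N => c)) P volume :=
      ⟨aestronglyMeasurable_weighted aestronglyMeasurable_const,
        (wnorm_const_ne_top hP ht c).lt_top⟩
    refine (h1.add h2).ae_eq (Eventually.of_forall fun x => ?_)
    simp only [Pi.add_apply, weighted]
    ring
  refine ⟨fun K hK => ?_, hmem⟩
  obtain ⟨R, hR⟩ := hK.isBounded.exists_norm_le
  set a := -t - (N : ℝ) / P.toReal
  refine (hmem.restrict K).of_le_mul (c := (1 + R) ^ |a|) hf.restrict ?_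
  filter_upwards [ae_restrict_mem hK.measurableSet] with x hx
  have hxR := hR x hx
  have hR0 : 0 ≤ R := (norm_nonneg x).trans hxR
  have h3 : (1 : ℝ) ^ a ≤ (1 + R) ^ |a| * (1 + ‖x‖) ^ a :=
    rpow_le_rpow_abs (by linarith) one_pos (one_add_norm_pos x)
      (by nlinarith [norm_nonneg x]) (by linarith)
  rw [Real.one_rpow] at h3
  have h4 : ‖weighted P t f x‖ = (1 + ‖x‖) ^ a * ‖f x‖ := by
    rw [weighted, norm_mul, Real.norm_of_nonneg (by positivity)]
  rw [h4, ← mul_assoc]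
  exact le_mul_of_one_le_left (norm_nonneg _) h3

theorem HasGradientIn.wnorm_ne_top {P : ℝ≥0∞} {u : Distr N} {g : Eu N → Eu N}
    (hg : HasGradientIn P s u g) : wnorm P s (fun x => ‖g x‖) ≠ ∞ := by
  have h1 : MemLp (fun x => ∑ i, ‖weighted P s (fun x => g x i) x‖) P volume :=
    memLp_finsetSum _ fun i _ => (hg i).2.2.norm
  refine ((eLpNorm_mono fun x => ?_).trans_lt h1.2).ne
  have hw : 0 ≤ (1 + ‖x‖) ^ (-s - (N : ℝ) / P.toReal) := by positivity
  have h2 : ‖g x‖ ≤ ∑ i, ‖g x i‖ := by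
    conv_lhs => rw [← sum_coord_smul_single (g x)]
    refine (norm_sum_le _ _).trans (Finset.sum_le_sum fun i _ => ?_)
    rw [norm_smul]
    simp
  rw [Real.norm_of_nonneg (Finset.sum_nonneg fun i _ => norm_nonneg _), weighted, norm_mul,
    Real.norm_of_nonneg hw, norm_norm]
  simp only [weighted, norm_mul, Real.norm_of_nonneg hw]
  rw [← Finset.mul_sum]
  gcongr

theorem IsGivenBy.congr {T : Distr N} {f f' : Eu N → ℝ} (hf : IsGivenBy T f)
    (h : f =ᵐ[volume] f') : IsGivenBy T f' := by
  refine ⟨hf.1.congr h, fun φ => ?_⟩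
  rw [hf.2 φ]
  refine integral_congr_ae ?_
  filter_upwards [h] with x hx
  rw [hx]

theorem ballMean_congr {f f' : Eu N → ℝ} (h : f =ᵐ[volume] f') :
    ballMean ρ f = ballMean ρ f' := by
  rw [ballMean, ballMean, setIntegral_congr_ae measurableSet_ball (h.mono fun x hx _ => hx)]

/-- The bounds above are proved for Borel functions; a representative of each component suffices
since every quantity involved ignores null sets. -/
theorem exists_measurable_gradient {u : Distr N} {g : Eu N → Eu N}
    (hu : ∀ i, IsGivenBy (∂_{EuclideanSpace.single i (1 : ℝ)} u) (fun x => g x i)) :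
    ∃ g' : Eu N → Eu N, Measurable g' ∧ g =ᵐ[volume] g' ∧
      ∀ i, IsGivenBy (∂_{EuclideanSpace.single i (1 : ℝ)} u) (fun x => g' x i) := by
  have hm : ∀ i, AEMeasurable (fun x => g x i) := fun i =>
    (hu i).1.aestronglyMeasurable.aemeasurable
  have hae : ∀ᵐ x, ∀ i, g x i = (hm i).mk _ x := ae_all_iff.2 fun i => (hm i).ae_eq_mk
  refine ⟨fun x => WithLp.toLp 2 fun i => (hm i).mk _ x, ?_, ?_, fun i => ?_⟩
  · exact (WithLp.measurable_toLp 2 _).comp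
      (measurable_pi_lambda _ fun i => (hm i).measurable_mk)
  · filter_upwards [hae] with x hx
    ext i
    exact hx i
  · exact (hu i).congr ((hm i).ae_eq_mk)

theorem exists_measurable_of_isGivenBy {u : Distr N} {f : Eu N → ℝ} (hf : IsGivenBy u f) :
    ∃ f' : Eu N → ℝ, Measurable f' ∧ f =ᵐ[volume] f' ∧ IsGivenBy u f' :=
  have hm := hf.1.aestronglyMeasurable.aemeasurable
  ⟨hm.mk f, hm.measurable_mk, hm.ae_eq_mk, hf.congr hm.ae_eq_mk⟩

theorem GradientBound.exists_wnorm_le (h : GradientBound N p s ρ q) (hp : 0 < p) (hq : 0 < q) :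
    ∃ C : ℝ, 0 < C ∧ ∀ (u : Distr N) (f : Eu N → ℝ) (g : Eu N → Eu N), IsGivenBy u f →
      (∀ i, IsGivenBy (∂_{EuclideanSpace.single i (1 : ℝ)} u) (fun x => g x i)) →
      wnorm (ENNReal.ofReal q) (s + 1) (fun x => f x - ballMean ρ f) ≤
        ENNReal.ofReal C * wnorm (ENNReal.ofReal p) s (fun x => ‖g x‖) := by
  obtain ⟨C, hC, h⟩ := h
  have hq1 : 0 ≤ 1 / q := by positivity
  have hCq : C ^ (1 / q) ≠ ∞ := ENNReal.rpow_ne_top_of_nonneg hq1 hC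
  -- Adding 1 makes the real constant strictly positive.
  refine ⟨(C ^ (1 / q)).toReal + 1, by positivity, fun u f g hf hu => ?_⟩
  obtain ⟨g', hg'm, hgg', hu'⟩ := exists_measurable_gradient hu
  obtain ⟨f', hf'm, hff', hf'⟩ := exists_measurable_of_isGivenBy hf
  have e1 : (fun x => f x - ballMean ρ f) =ᵐ[volume] fun x => f' x - ballMean ρ f' := by
    filter_upwards [hff'] with x hx
    rw [hx, ballMean_congr hff']
  have e2 : (fun x => ‖g x‖) =ᵐ[volume] fun x => ‖g' x‖ := by
    filter_upwards [hgg'] with x hx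
    rw [hx]
  rw [wnorm_congr e1, wnorm_congr e2, wnorm_ofReal hq, wnorm_ofReal hp]
  simp only [enorm_norm]
  have hle : C ^ (1 / q) ≤ ENNReal.ofReal ((C ^ (1 / q)).toReal + 1) := by
    nth_rewrite 1 [← ENNReal.ofReal_toReal hCq]
    exact ENNReal.ofReal_le_ofReal (by linarith)
  calc _ ≤ (C * wInt p s (fun x => ‖g' x‖ₑ) ^ (q / p)) ^ (1 / q) := by
        gcongr
        exact h u f' g' hf' hu' hf'm hg'm
    _ = C ^ (1 / q) * wInt p s (fun x => ‖g' x‖ₑ) ^ (1 / p) := by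
        rw [ENNReal.mul_rpow_of_nonneg _ _ hq1, ← ENNReal.rpow_mul]
        congr 2
        field_simp
    _ ≤ _ := by gcongr

theorem GradientBoundTop.exists_wnorm_le (h : GradientBoundTop N p s ρ) (hp : 0 < p) :
    ∃ C : ℝ, 0 < C ∧ ∀ (u : Distr N) (f : Eu N → ℝ) (g : Eu N → Eu N), IsGivenBy u f →
      (∀ i, IsGivenBy (∂_{EuclideanSpace.single i (1 : ℝ)} u) (fun x => g x i)) →
      wnorm ∞ (s + 1) (fun x => f x - ballMean ρ f) ≤
        ENNReal.ofReal C * wnorm (ENNReal.ofReal p) s (fun x => ‖g x‖) := by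
  obtain ⟨C, hC, h⟩ := h
  refine ⟨C.toReal + 1, by positivity, fun u f g hf hu => ?_⟩
  obtain ⟨g', hg'm, hgg', hu'⟩ := exists_measurable_gradient hu
  obtain ⟨f', hf'm, hff', hf'⟩ := exists_measurable_of_isGivenBy hf
  have e1 : (fun x => f x - ballMean ρ f) =ᵐ[volume] fun x => f' x - ballMean ρ f' := by
    filter_upwards [hff'] with x hx
    rw [hx, ballMean_congr hff']
  have e2 : (fun x => ‖g x‖) =ᵐ[volume] fun x => ‖g' x‖ := by
    filter_upwards [hgg'] with x hx
    rw [hx]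
  rw [wnorm_congr e1, wnorm_congr e2, wnorm_ofReal hp]
  simp only [enorm_norm]
  have hle : C ≤ ENNReal.ofReal (C.toReal + 1) := by
    nth_rewrite 1 [← ENNReal.ofReal_toReal hC]
    exact ENNReal.ofReal_le_ofReal (by linarith)
  refine wnorm_top_le ?_
  filter_upwards [h u f' g' hf' hu' hf'm hg'm] with x hx
  exact hx.trans (by gcongr)

theorem ofReal_le_of_mem_exponentRange {P : ℝ≥0∞} (hP : P ∈ exponentRange N p) :
    ENNReal.ofReal p ≤ P := by
  unfold exponentRange at hP
  split_ifs at hP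
  · exact hP.1
  · exact hP.1

theorem exists_wnorm_le_of_mem_exponentRange (hN : 1 ≤ N) (hs : -1 < s) (hp : 1 ≤ p) (hρ : 0 < ρ)
    {P : ℝ≥0∞} (hP : P ∈ exponentRange N p) :
    ∃ C : ℝ, 0 < C ∧ ∀ (u : Distr N) (f : Eu N → ℝ) (g : Eu N → Eu N), IsGivenBy u f →
      (∀ i, IsGivenBy (∂_{EuclideanSpace.single i (1 : ℝ)} u) (fun x => g x i)) →
      wnorm P (s + 1) (fun x => f x - ballMean ρ f) ≤
        ENNReal.ofReal C * wnorm (ENNReal.ofReal p) s (fun x => ‖g x‖) := by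
  have hp0 : 0 < p := by linarith
  rcases eq_or_ne P ∞ with rfl | hP'
  · exact (gradientBoundTop hs hρ hp (supercritical_of_top_mem hN hP)).exists_wnorm_le hp0
  · rw [← ENNReal.ofReal_toReal hP'] at hP ⊢
    have h := gradientBound_of_mem_exponentRange hN hs hp hρ ENNReal.toReal_nonneg hP
    refine h.exists_wnorm_le hp0 ?_
    exact hp0.trans_le ((ENNReal.ofReal_le_ofReal_iff ENNReal.toReal_nonneg).1
      (ofReal_le_of_mem_exponentRange hP))

theorem exists_continuous_tendsto (hN : 1 ≤ N) (hs : -1 < s) (hp : 1 ≤ p)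
    (hNp : Supercritical N p) {u : Distr N} {g : Eu N → Eu N}
    (hg : HasGradientIn (ENNReal.ofReal p) s u g) {f : Eu N → ℝ} (hf : IsGivenBy u f) :
    ∃ f₀ : Eu N → ℝ, Continuous f₀ ∧ f =ᵐ[volume] f₀ ∧
      Tendsto (fun x => ‖x‖ ^ (-(s + 1)) * f₀ x) (Bornology.cobounded (Eu N)) (𝓝 0) := by
  have hp0 : 0 < p := by linarith
  obtain ⟨g', hg'm, hgg', hu'⟩ := exists_measurable_gradient fun i => (hg i).1
  have e2 : (fun x => ‖g x‖) =ᵐ[volume] fun x => ‖g' x‖ := by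
    filter_upwards [hgg'] with x hx
    rw [hx]
  have hfin : wInt p s (fun x => ‖g' x‖ₑ) ≠ ∞ := by
    have h := hg.wnorm_ne_top
    rw [wnorm_congr e2, wnorm_ofReal hp0] at h
    simp only [enorm_norm] at h
    intro h1
    rw [h1, ENNReal.top_rpow_of_pos (by positivity)] at h
    exact h rfl
  obtain ⟨f₀, hc, hff₀⟩ := exists_continuous_representative hN hp hNp hf hu' hg'm hfin
  have hf₀ := hf.congr hff₀
  refine ⟨f₀, hc, hff₀, ?_⟩
  -- Any radius would do: the decay only needs some constant whose difference from `f₀` has finite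
  -- norm.
  obtain ⟨C, hC, h⟩ := gradientBound_self (N := N) hs hp one_pos
  have h1 := h u f₀ g' hf₀ hu' hc.measurable hg'm
  rw [div_self hp0.ne', ENNReal.rpow_one] at h1
  exact tendsto_of_continuous_representative hs hp hNp hf₀ hu' hc hg'm hfin
    (k := ballMean 1 f₀) (h1.trans_lt (ENNReal.mul_lt_top hC.lt_top hfin.lt_top)).ne

end Norms

end Growth

/-! ### The theorem -/

theorem theorem3 (N : ℕ) (hN : 1 ≤ N) (s : ℝ) (hs : -1 < s) (p : ℝ) (hp : 1 ≤ p)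
    (ρ : ℝ) (hρ : 0 < ρ) :
    -- (i)
    (∃ C : ℝ, 0 < C ∧ ∀ (u : Growth.Distr N) (g : Growth.Eu N → Growth.Eu N),
      Growth.HasGradientIn (ENNReal.ofReal p) s u g →
        (∃ f : Growth.Eu N → ℝ, Growth.IsGivenBy u f) ∧
        ∀ f : Growth.Eu N → ℝ, Growth.IsGivenBy u f →
          Growth.MemWeighted (ENNReal.ofReal p) (s + 1) f ∧
          Growth.wnorm (ENNReal.ofReal p) (s + 1) (fun x => f x - Growth.ballMean ρ f) ≤
            ENNReal.ofReal C * Growth.wnorm (ENNReal.ofReal p) s (fun x => ‖g x‖)) ∧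
    -- (ii)
    (∀ q ∈ Growth.exponentRange N p,
      ∃ C : ℝ, 0 < C ∧ ∀ (u : Growth.Distr N) (g : Growth.Eu N → Growth.Eu N),
        Growth.HasGradientIn (ENNReal.ofReal p) s u g →
          ∀ f : Growth.Eu N → ℝ, Growth.IsGivenBy u f → (N = 1 ∨ Growth.IsRadial f) →
            Growth.MemWeighted q (s + 1) f ∧
            Growth.wnorm q (s + 1) (fun x => f x - Growth.ballMean ρ f) ≤
              ENNReal.ofReal C * Growth.wnorm (ENNReal.ofReal p) s (fun x => ‖g x‖)) ∧
    -- growth at infinity of the continuous representative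
    (((N : ℝ) < p ∨ (p = N ∧ N = 1)) →
      ∀ (u : Growth.Distr N) (g : Growth.Eu N → Growth.Eu N),
        Growth.HasGradientIn (ENNReal.ofReal p) s u g →
          ∀ f : Growth.Eu N → ℝ, Growth.IsGivenBy u f → (N = 1 ∨ Growth.IsRadial f) →
            ∃ f₀ : Growth.Eu N → ℝ, Continuous f₀ ∧ f =ᵐ[volume] f₀ ∧
              Tendsto (fun x => ‖x‖ ^ (-(s + 1)) * f₀ x)
                (Bornology.cobounded (Growth.Eu N)) (𝓝 0)) := by
  have hp0 : 0 < p := by linarith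
  have hs1 : 0 < s + 1 := by linarith
  -- Membership follows from the estimate: its right-hand side is finite, so f differs from a
  -- constant by a function of finite norm.
  have hmem : ∀ P : ℝ≥0∞, ENNReal.ofReal p ≤ P → ∀ C : ℝ, ∀ (u : Growth.Distr N)
      (g : Growth.Eu N → Growth.Eu N) (f : Growth.Eu N → ℝ),
      Growth.HasGradientIn (ENNReal.ofReal p) s u g → Growth.IsGivenBy u f →
      Growth.wnorm P (s + 1) (fun x => f x - Growth.ballMean ρ f) ≤
        ENNReal.ofReal C * Growth.wnorm (ENNReal.ofReal p) s (fun x => ‖g x‖) →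
      Growth.MemWeighted P (s + 1) f := by
    intro P hP C u g f hg hf h
    refine Growth.memWeighted_of_wnorm_sub_ne_top ?_ hs1 hf.1.aestronglyMeasurable
      (h.trans_lt (ENNReal.mul_lt_top ENNReal.ofReal_lt_top hg.wnorm_ne_top.lt_top)).ne
    exact ((ENNReal.ofReal_pos.2 hp0).trans_le hP).ne'
  refine ⟨?_, fun q hq => ?_, fun hNp u g hg f hf _ => ?_⟩
  · obtain ⟨C, hC, h⟩ := (Growth.gradientBound_self (N := N) hs hp hρ).exists_wnorm_le hp0 hp0
    refine ⟨C, hC, fun u g hg => ⟨⟨_, Growth.isGivenBy_of_gradient (fun i => (hg i).1)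
      (Growth.mollifier N 1 one_pos) Growth.integral_mollifier⟩, fun f hf => ?_⟩⟩
    have hle := h u f g hf fun i => (hg i).1
    exact ⟨hmem _ le_rfl C u g f hg hf hle, hle⟩
  · obtain ⟨C, hC, h⟩ := Growth.exists_wnorm_le_of_mem_exponentRange hN hs hp hρ hq
    refine ⟨C, hC, fun u g hg f hf _ => ?_⟩
    have hle := h u f g hf fun i => (hg i).1
    exact ⟨hmem _ (Growth.ofReal_le_of_mem_exponentRange hq) C u g f hg hf hle, hle⟩
  · exact Growth.exists_continuous_tendsto hN hs hp hNp hg hf
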